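/- Notation. Let $A:[0,1]\to\mathbb R^{n\times n}$ and $B:[0,1]\to\mathbb R^{n\times p}$ be continuous, and let the system $\dot x=A(t)x+B(t)u$ be controllable on $[0,1]$ (every $x(0)$ can be steered to every $x(1)$ by a continuous input). Let $\Phi(t,s)$ be its state transition matrix, $M(t,s)=\int_s^t\Phi(t,\tau)B(\tau)B(\tau)'\Phi(t,\tau)'\,d\tau$, $\Phi_{10}=\Phi(1,0)$ and $M_{10}=M(1,0)$. Let $m_0,m_1\in\mathbb R^n$, let $\Sigma_0,\Sigma_1$ be symmetric positive definite, and let $\rho_0,\rho_1$ be the densities of $N(m_0,\Sigma_0)$ and $N(m_1,\Sigma_1)$. Optimal mass transport with prior dynamics (OMT-wpd) is the problem $$\inf_{(\rho,u)}\int_{\mathbb R^n}\int_0^1\tfrac12\|u(t,x)\|^2\rho(t,x)\,dt\,dx,\qquad \frac{\partial\rho}{\partial t}+\nabla\cdot\big((A(t)x+B(t)u)\rho\big)=0,\qquad \rho(0,\cdot)=\rho_0,\ \rho(1,\cdot)=\rho_1,$$ over flows $\rho(t,\cdot)$, $0\le t\le1$, of probability densities and continuous feedback laws $u:[0,1]\times\mathbb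 R^n\to\mathbb R^p$, where the continuity equation with its end-point values is understood weakly: for every $f\in C_c^\infty(\mathbb R\times\mathbb R^n)$, $$\int_0^1\!\!\int_{\mathbb R^n}\Big(\frac{\partial f}{\partial t}+\nabla f\cdot(A(t)x+B(t)u)\Big)\rho\,dx\,dt=\int_{\mathbb R^n} f(1,x)\rho(1,x)\,dx-\int_{\mathbb R^n} f(0,x)\rho(0,x)\,dx .$$ Statement. $M_{10}$ is invertible, and the Riccati equation $$\dot\Pi_0+A'\Pi_0+\Pi_0A-\Pi_0BB'\Pi_0=0$$ with initial value $$\Pi_0(0)=\Sigma_0^{-1/2}\Big[\Sigma_0^{1/2}\Phi_{10}'M_{10}^{-1}\Phi_{10}\Sigma_0^{1/2}-\big(\Sigma_0^{1/2}\Phi_{10}'M_{10}^{-1}\Sigma_1M_{10}^{-1}\Phi_{10}\Sigma_0^{1/2}\big)^{1/2}\Big]\Sigma_0^{-1/2}$$ has a solution on all of $[0,1]$. Every such solution satisfies, at every $t\in(0,1]$ for which $M(t,0)$ is invertible, $$\Pi_0(t)=-M(t,0)^{-1}-M(t,0)^{-1}\Phi(t,0)\Big[\Phi_{10}'M_{10}^{-1}\Phi_{10}-\Sigma_0^{-1/2}\big(\Sigma_0^{1/2}\Phi_{10}'M_{10}^{-1}\Sigma_1M_{10}^{-1}\Phi_{10}\Sigma_0^{1/2}\big)^{1/2}\Sigma_0^{-1/2}-\Phi(t,0)'M(t,0)^{-1}\Phi(t,0)\Big]^{-1}\Phi(t,0)'M(t,0)^{-1},$$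 where the bracket is invertible. Let $\hat\Phi(t,s)$ be the state transition matrix of $A-BB'\Pi_0$ and $\hat M(t,s)=\int_s^t\hat\Phi(t,\tau)B(\tau)B(\tau)'\hat\Phi(t,\tau)'\,d\tau$. Then $\hat M(1,0)$ is invertible; put $$m(t)=\hat\Phi(1,t)'\hat M(1,0)^{-1}\big(m_1-\hat\Phi(1,0)m_0\big).$$ There is a process $x(t)$, $0\le t\le1$, with $$dx(t)=(A(t)-B(t)B(t)'\Pi_0(t))x(t)\,dt+B(t)B(t)'m(t)\,dt,\qquad x(0)\sim N(m_0,\Sigma_0),$$ and for every such process $x(t)$ has a probability density $\rho(t,\cdot)$ for all $t\in[0,1]$ (which can be chosen nonnegative and jointly measurable in $(t,x)$). For any such $\rho$ and $$u(t,x)=-B(t)'\Pi_0(t)x+B(t)'m(t),$$ the pair $(\rho,u)$ is a solution of the OMT-wpd problem: it satisfies all the constraints, in particular $\rho(0,\cdot)=\rho_0$ and $\rho(1,\cdot)=\rho_1$ almost everywhere, and its cost is finite and minimal among all pairs that satisfy the constraints. -/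

import Mathlib

open Set MeasureTheory Matrix
open scoped MatrixOrder ContDiff

noncomputable section

namespace OMTwpd

variable {n p : ℕ}

/-- `Φ t s` is a state transition matrix of `ẋ = A(t) x` on `[0,1]`:
`∂Φ(t,s)/∂t = A(t) Φ(t,s)`, `Φ(s,s) = I` (one-sided derivatives at the end points). -/
def IsTransitionMatrix (A : ℝ → Matrix (Fin n) (Fin n) ℝ)
    (Φ : ℝ → ℝ → Matrix (Fin n) (Fin n) ℝ) : Prop :=
  ∀ s ∈ Icc (0 : ℝ) 1, Φ s s = 1 ∧
    ∀ t ∈ Icc (0 : ℝ) 1, HasDerivWithinAt (fun r => Φ r s) (A t * Φ t s) (Icc 0 1) t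

open Classical in
/-- The state transition matrix `Φ(t,s)` of `ẋ = A(t) x` on `[0,1]`. For continuous `A` it exists,
and its values for `s, t ∈ [0,1]` are unique (the value `0` is never used in that case). -/
def transitionMatrix (A : ℝ → Matrix (Fin n) (Fin n) ℝ) : ℝ → ℝ → Matrix (Fin n) (Fin n) ℝ :=
  if h : ∃ Φ, IsTransitionMatrix A Φ then h.choose else 0

/-- The controllability Gramian
`M(t,s) = ∫ₛᵗ Φ(t,τ) B(τ) B(τ)' Φ(t,τ)' dτ` of the pair `(A, B)`, entry by entry. -/
def gramian (A : ℝ → Matrix (Fin n) (Fin n) ℝ) (B : ℝ → Matrix (Fin n) (Fin p) ℝ) (t s : ℝ) :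
    Matrix (Fin n) (Fin n) ℝ :=
  Matrix.of fun i j => ∫ τ in s..t,
    (transitionMatrix A t τ * B τ * (B τ)ᵀ * (transitionMatrix A t τ)ᵀ) i j

/-- The system `ẋ = A(t) x + B(t) u` is controllable on `[0,1]`: a continuous input can steer any
initial state at time `0` to any final state at time `1`. -/
def IsControllable (A : ℝ → Matrix (Fin n) (Fin n) ℝ) (B : ℝ → Matrix (Fin n) (Fin p) ℝ) : Prop :=
  ∀ x y : EuclideanSpace ℝ (Fin n), ∃ (u : ℝ → EuclideanSpace ℝ (Fin p))
    (ξ : ℝ → EuclideanSpace ℝ (Fin n)), ContinuousOn u (Icc 0 1) ∧ ξ 0 = x ∧ ξ 1 = y ∧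
      ∀ t ∈ Icc (0 : ℝ) 1, HasDerivWithinAt ξ
        ((A t).toEuclideanLin (ξ t) + (B t).toEuclideanLin (u t)) (Icc 0 1) t

/-- The density of the normal distribution with mean `m` and (positive definite) covariance `S`. -/
def gaussianDensity (m : EuclideanSpace ℝ (Fin n)) (S : Matrix (Fin n) (Fin n) ℝ)
    (x : EuclideanSpace ℝ (Fin n)) : ℝ :=
  (Real.sqrt ((2 * Real.pi) ^ n * S.det))⁻¹ *
    Real.exp (-(1 / 2) * inner ℝ (x - m) (S⁻¹.toEuclideanLin (x - m)))

/-! ### The fluid-dynamic problem of optimal mass transport with prior dynamics -/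

/-- `ρ(t,·)`, `0 ≤ t ≤ 1`, is a flow of probability densities. -/
structure IsDensityFlow (ρ : ℝ → EuclideanSpace ℝ (Fin n) → ℝ) : Prop where
  measurable : Measurable (Function.uncurry ρ)
  nonneg : ∀ t ∈ Icc (0 : ℝ) 1, ∀ x, 0 ≤ ρ t x
  lintegral_eq_one : ∀ t ∈ Icc (0 : ℝ) 1, ∫⁻ x, ENNReal.ofReal (ρ t x) = 1

/-- `∂ρ/∂t + ∇·((A(t)x + B(t)u)ρ) = 0` on `[0,1] × ℝⁿ` in the weak sense, tested against all
smooth compactly supported functions of `(t,x)`. The test functions need not vanish at the times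
`0` and `1`; the boundary terms tie the flow at intermediate times to `ρ(0,·)` and `ρ(1,·)`. -/
def SatisfiesContinuityEq (A : ℝ → Matrix (Fin n) (Fin n) ℝ) (B : ℝ → Matrix (Fin n) (Fin p) ℝ)
    (ρ : ℝ → EuclideanSpace ℝ (Fin n) → ℝ)
    (u : ℝ → EuclideanSpace ℝ (Fin n) → EuclideanSpace ℝ (Fin p)) : Prop :=
  ∀ f : ℝ → EuclideanSpace ℝ (Fin n) → ℝ,
    ContDiff ℝ ∞ (Function.uncurry f) → HasCompactSupport (Function.uncurry f) →
    ∫ t in (0 : ℝ)..1, ∫ x, (deriv (fun s => f s x) t +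
        fderiv ℝ (f t) x ((A t).toEuclideanLin x + (B t).toEuclideanLin (u t x))) * ρ t x
      = (∫ x, f 1 x * ρ 1 x) - ∫ x, f 0 x * ρ 0 x

/-- The constraints of the problem: `ρ` is a flow of probability densities, `u` is a continuous
feedback control law on `[0,1] × ℝⁿ`, the continuity equation holds, and the end-point densities
are `ρ₀` and `ρ₁`. -/
structure IsAdmissible (A : ℝ → Matrix (Fin n) (Fin n) ℝ) (B : ℝ → Matrix (Fin n) (Fin p) ℝ)
    (ρ₀ ρ₁ : EuclideanSpace ℝ (Fin n) → ℝ) (ρ : ℝ → EuclideanSpace ℝ (Fin n) → ℝ)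
    (u : ℝ → EuclideanSpace ℝ (Fin n) → EuclideanSpace ℝ (Fin p)) : Prop where
  flow : IsDensityFlow ρ
  continuous_control : ContinuousOn (Function.uncurry u) (Icc (0 : ℝ) 1 ×ˢ univ)
  continuity_eq : SatisfiesContinuityEq A B ρ u
  initial : ρ 0 =ᵐ[volume] ρ₀
  final : ρ 1 =ᵐ[volume] ρ₁

/-- The cost `∫∫ ½ ‖u(t,x)‖² ρ(t,x) dt dx`, with values in `[0,∞]`. -/
def cost (ρ : ℝ → EuclideanSpace ℝ (Fin n) → ℝ)
    (u : ℝ → EuclideanSpace ℝ (Fin n) → EuclideanSpace ℝ (Fin p)) : ENNReal :=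
  ∫⁻ t in Icc (0 : ℝ) 1, ∫⁻ x, ENNReal.ofReal (1 / 2 * ‖u t x‖ ^ 2 * ρ t x)

/-- `(ρ, u)` is a solution of the problem of optimal mass transport with prior dynamics: it is
admissible, and it has finite cost, minimal among all admissible pairs. -/
structure IsSolution (A : ℝ → Matrix (Fin n) (Fin n) ℝ) (B : ℝ → Matrix (Fin n) (Fin p) ℝ)
    (ρ₀ ρ₁ : EuclideanSpace ℝ (Fin n) → ℝ) (ρ : ℝ → EuclideanSpace ℝ (Fin n) → ℝ)
    (u : ℝ → EuclideanSpace ℝ (Fin n) → EuclideanSpace ℝ (Fin p)) : Prop where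
  admissible : IsAdmissible A B ρ₀ ρ₁ ρ u
  cost_ne_top : cost ρ u ≠ ⊤
  minimal : ∀ ρ' u', IsAdmissible A B ρ₀ ρ₁ ρ' u' → cost ρ u ≤ cost ρ' u'

/-! ### The explicit Gaussian solution -/

/-- `Φ₁₀ = Φ(1,0)`. -/
def phi10 (A : ℝ → Matrix (Fin n) (Fin n) ℝ) : Matrix (Fin n) (Fin n) ℝ :=
  transitionMatrix A 1 0

/-- `M₁₀ = M(1,0)`. -/
def gram10 (A : ℝ → Matrix (Fin n) (Fin n) ℝ) (B : ℝ → Matrix (Fin n) (Fin p) ℝ) :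
    Matrix (Fin n) (Fin n) ℝ :=
  gramian A B 1 0

/-- `(Σ₀^{1/2} Φ₁₀' M₁₀⁻¹ Σ₁ M₁₀⁻¹ Φ₁₀ Σ₀^{1/2})^{1/2}`. -/
def middleRoot (A : ℝ → Matrix (Fin n) (Fin n) ℝ) (B : ℝ → Matrix (Fin n) (Fin p) ℝ)
    (S₀ S₁ : Matrix (Fin n) (Fin n) ℝ) : Matrix (Fin n) (Fin n) ℝ :=
  CFC.sqrt (CFC.sqrt S₀ * (phi10 A)ᵀ * (gram10 A B)⁻¹ * S₁ * (gram10 A B)⁻¹ * phi10 A *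
    CFC.sqrt S₀)

/-- The initial value
`Σ₀^{-1/2} [Σ₀^{1/2} Φ₁₀' M₁₀⁻¹ Φ₁₀ Σ₀^{1/2}
  - (Σ₀^{1/2} Φ₁₀' M₁₀⁻¹ Σ₁ M₁₀⁻¹ Φ₁₀ Σ₀^{1/2})^{1/2}] Σ₀^{-1/2}`. -/
def riccatiInitial (A : ℝ → Matrix (Fin n) (Fin n) ℝ) (B : ℝ → Matrix (Fin n) (Fin p) ℝ)
    (S₀ S₁ : Matrix (Fin n) (Fin n) ℝ) : Matrix (Fin n) (Fin n) ℝ :=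
  (CFC.sqrt S₀)⁻¹ *
    (CFC.sqrt S₀ * (phi10 A)ᵀ * (gram10 A B)⁻¹ * phi10 A * CFC.sqrt S₀ - middleRoot A B S₀ S₁) *
    (CFC.sqrt S₀)⁻¹

/-- `Π` solves `Π̇ + A'Π + ΠA - ΠBB'Π = 0` on `[0,1]` with the initial value above. -/
def IsRiccatiSolution (A : ℝ → Matrix (Fin n) (Fin n) ℝ) (B : ℝ → Matrix (Fin n) (Fin p) ℝ)
    (S₀ S₁ : Matrix (Fin n) (Fin n) ℝ) (P : ℝ → Matrix (Fin n) (Fin n) ℝ) : Prop :=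
  P 0 = riccatiInitial A B S₀ S₁ ∧
    ∀ t ∈ Icc (0 : ℝ) 1, HasDerivWithinAt P
      (-((A t)ᵀ * P t) - P t * A t + P t * B t * (B t)ᵀ * P t) (Icc 0 1) t

/-- `[Φ₁₀' M₁₀⁻¹ Φ₁₀
  - Σ₀^{-1/2} (Σ₀^{1/2} Φ₁₀' M₁₀⁻¹ Σ₁ M₁₀⁻¹ Φ₁₀ Σ₀^{1/2})^{1/2} Σ₀^{-1/2}
  - Φ(t,0)' M(t,0)⁻¹ Φ(t,0)]`. -/
def riccatiBracket (A : ℝ → Matrix (Fin n) (Fin n) ℝ) (B : ℝ → Matrix (Fin n) (Fin p) ℝ)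
    (S₀ S₁ : Matrix (Fin n) (Fin n) ℝ) (t : ℝ) : Matrix (Fin n) (Fin n) ℝ :=
  (phi10 A)ᵀ * (gram10 A B)⁻¹ * phi10 A
    - (CFC.sqrt S₀)⁻¹ * middleRoot A B S₀ S₁ * (CFC.sqrt S₀)⁻¹
    - (transitionMatrix A t 0)ᵀ * (gramian A B t 0)⁻¹ * transitionMatrix A t 0

/-- The closed form
`-M(t,0)⁻¹ - M(t,0)⁻¹ Φ(t,0) [⋯]⁻¹ Φ(t,0)' M(t,0)⁻¹`, with the bracket above. -/
def riccatiClosedForm (A : ℝ → Matrix (Fin n) (Fin n) ℝ) (B : ℝ → Matrix (Fin n) (Fin p) ℝ)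
    (S₀ S₁ : Matrix (Fin n) (Fin n) ℝ) (t : ℝ) : Matrix (Fin n) (Fin n) ℝ :=
  -(gramian A B t 0)⁻¹ - (gramian A B t 0)⁻¹ * transitionMatrix A t 0 *
    (riccatiBracket A B S₀ S₁ t)⁻¹ * (transitionMatrix A t 0)ᵀ * (gramian A B t 0)⁻¹

/-- The closed-loop matrix `A(t) - B(t)B(t)'Π(t)`. -/
def closedLoop (A : ℝ → Matrix (Fin n) (Fin n) ℝ) (B : ℝ → Matrix (Fin n) (Fin p) ℝ)
    (P : ℝ → Matrix (Fin n) (Fin n) ℝ) (t : ℝ) : Matrix (Fin n) (Fin n) ℝ :=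
  A t - B t * (B t)ᵀ * P t

/-- `m(t) = Φ̂(1,t)' M̂(1,0)⁻¹ (m₁ - Φ̂(1,0) m₀)`, where `Φ̂` and `M̂` are the transition matrix and
the Gramian of the pair `(A - BB'Π, B)`. -/
def drift (A : ℝ → Matrix (Fin n) (Fin n) ℝ) (B : ℝ → Matrix (Fin n) (Fin p) ℝ)
    (P : ℝ → Matrix (Fin n) (Fin n) ℝ) (m₀ m₁ : EuclideanSpace ℝ (Fin n)) (t : ℝ) :
    EuclideanSpace ℝ (Fin n) :=
  ((transitionMatrix (closedLoop A B P) 1 t)ᵀ * (gramian (closedLoop A B P) B 1 0)⁻¹).toEuclideanLin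
    (m₁ - (transitionMatrix (closedLoop A B P) 1 0).toEuclideanLin m₀)

/-- The feedback control law `u(t,x) = -B(t)'Π(t)x + B(t)'m(t)`. -/
def feedback (A : ℝ → Matrix (Fin n) (Fin n) ℝ) (B : ℝ → Matrix (Fin n) (Fin p) ℝ)
    (P : ℝ → Matrix (Fin n) (Fin n) ℝ) (m₀ m₁ : EuclideanSpace ℝ (Fin n)) (t : ℝ)
    (x : EuclideanSpace ℝ (Fin n)) : EuclideanSpace ℝ (Fin p) :=
  -((B t)ᵀ * P t).toEuclideanLin x + (B t)ᵀ.toEuclideanLin (drift A B P m₀ m₁ t)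

/-- `X` is a process `dx = (A - BB'Π)x dt + BB'm dt` on `[0,1]` whose initial value is normally
distributed with mean `m₀` and covariance `S₀`; `m` is the drift above. -/
structure IsProcess {Ω : Type*} [MeasurableSpace Ω] (μ : Measure Ω)
    (A : ℝ → Matrix (Fin n) (Fin n) ℝ) (B : ℝ → Matrix (Fin n) (Fin p) ℝ)
    (P : ℝ → Matrix (Fin n) (Fin n) ℝ) (m₀ m₁ : EuclideanSpace ℝ (Fin n))
    (S₀ : Matrix (Fin n) (Fin n) ℝ) (X : ℝ → Ω → EuclideanSpace ℝ (Fin n)) : Prop where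
  aemeasurable : ∀ t ∈ Icc (0 : ℝ) 1, AEMeasurable (X t) μ
  initial : μ.map (X 0) = volume.withDensity fun x => ENNReal.ofReal (gaussianDensity m₀ S₀ x)
  dynamics : ∀ᵐ z ∂μ, ∀ t ∈ Icc (0 : ℝ) 1, HasDerivWithinAt (fun s => X s z)
    ((closedLoop A B P t).toEuclideanLin (X t z) +
      (B t * (B t)ᵀ).toEuclideanLin (drift A B P m₀ m₁ t)) (Icc 0 1) t

/-- `ρ(t,·)` is, for each `t ∈ [0,1]`, a probability density of `X t`; the versions of the densities
are nonnegative and jointly measurable in `(t,x)`. -/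
structure IsDensityOf {Ω : Type*} [MeasurableSpace Ω] (μ : Measure Ω)
    (X : ℝ → Ω → EuclideanSpace ℝ (Fin n)) (ρ : ℝ → EuclideanSpace ℝ (Fin n) → ℝ) : Prop where
  measurable : Measurable (Function.uncurry ρ)
  nonneg : ∀ t ∈ Icc (0 : ℝ) 1, ∀ x, 0 ≤ ρ t x
  map_eq : ∀ t ∈ Icc (0 : ℝ) 1,
    μ.map (X t) = volume.withDensity fun x => ENNReal.ofReal (ρ t x)

end OMTwpd

end

/-! Let `X` be the fundamental matrix of the prior drift, `Y` its inverse, and pull the Gramian back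
to time `0`: `N(t) = ∫₀ᵗ Y B B' Y'`, so that `M(t,0) = X N X'`. In these coordinates the initial
value is `Q = N(1)⁻¹ - K`, where `K` is positive definite and `K Σ₀ K = Φ₁₀' M₁₀⁻¹ Σ₁ M₁₀⁻¹ Φ₁₀`.
The Hamiltonian system behind the Riccati equation is linear, with state `X (1 - N Q)` and costate
`Y' Q`, so the solution is `Π = Y' Q (1 - N Q)⁻¹ Y` as long as `1 - N Q` is invertible. This holds
on all of `[0,1]` because `0 ≤ N(t) ≤ N(1)` and `K > 0` (`isUnit_det_one_sub_mul`).

The closed form is the same expression rewritten. The closed loop has fundamental matrix `X (1 - N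
Q)`, which at time `1` equals `X N K`; hence it carries the covariance `Σ₀` to `Σ₁`
(`IsRiccatiSolution.conj_closedLoop_fundamental`). The drift `m` solves the adjoint equation of the
closed loop and moves the mean from `m₀` to `m₁`. The closed-loop flow is therefore affine and maps
one Gaussian to the other.

Optimality is a verification argument. Put `V(t,x) = -x'Πx/2 + m'x + c(t)` with `c' = -‖B'm‖²/2`, so
that `u⁎ = B'∇V` is the feedback law. The Riccati equation and the adjoint equation say that along
any control `u` the rate of change of `V` is `⟨u⁎,u⟩ - ‖u⁎‖²/2` (`hamiltonJacobi_identity`).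
Integrated against any admissible flow this gives a number `D` that depends on the end-point
densities but not on the flow (`exists_integral_inner_feedback_eq`). Since `⟨u⁎,u⟩ - ‖u⁎‖²/2 ≤
‖u‖²/2`, with equality for `u = u⁎`, every admissible cost is at least `D` and the feedback attains
it.

The analytic work is to test the weak continuity equation with `V`, which is neither compactly
supported nor smooth in time. Time coefficients are approximated in `C¹` by smooth ones, and space
is handled by cutoffs. The domination needed there is a second moment of the competitor. It is not
assumed; it follows from finite cost and the Gaussian initial density by a Grönwall estimate on
bounded regularizations of `‖x‖²` and Fatou's lemma (`IsWeakFlow.integrable_norm_sq`). -/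

namespace OMTwpd

/-! ### Entrywise calculus of matrix-valued functions on `[0,1]`. -/

section MatrixCalculus

variable {l m k : Type*} {s : Set ℝ} {t : ℝ}

theorem hasDerivWithinAt_matrix_iff [Finite m] [Finite k] {M : ℝ → Matrix m k ℝ}
    {M' : Matrix m k ℝ} :
    HasDerivWithinAt M M' s t ↔ ∀ i j, HasDerivWithinAt (fun r => M r i j) (M' i j) s t := by
  have := Fintype.ofFinite m
  have := Fintype.ofFinite k
  have h : @HasDerivWithinAt ℝ _ (m → k → ℝ) _ _ _ _ M M' s t ↔ _ := hasDerivWithinAt_pi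
  simp only [hasDerivWithinAt_pi] at h
  exact h

theorem continuousOn_matrix_iff {M : ℝ → Matrix m k ℝ} :
    ContinuousOn M s ↔ ∀ i j, ContinuousOn (fun r => M r i j) s :=
  (continuousOn_pi (f := M)).trans (forall_congr' fun _ => continuousOn_pi)

theorem continuousOn_of_hasDerivWithinAt [Finite m] [Finite k] {M M' : ℝ → Matrix m k ℝ}
    (h : ∀ t ∈ s, HasDerivWithinAt M (M' t) s t) : ContinuousOn M s :=
  continuousOn_matrix_iff.2 fun i j t ht =>
    (hasDerivWithinAt_matrix_iff.1 (h t ht) i j).continuousWithinAt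

theorem hasDerivWithinAt_matrix_mul [Finite l] [Fintype m] [Finite k] {M : ℝ → Matrix l m ℝ}
    {N : ℝ → Matrix m k ℝ}
    {M' : Matrix l m ℝ} {N' : Matrix m k ℝ}
    (hM : HasDerivWithinAt M M' s t) (hN : HasDerivWithinAt N N' s t) :
    HasDerivWithinAt (fun r => M r * N r) (M' * N t + M t * N') s t := by
  rw [hasDerivWithinAt_matrix_iff] at *
  intro i j
  simp only [Matrix.mul_apply, Matrix.add_apply, ← Finset.sum_add_distrib]
  exact HasDerivWithinAt.fun_sum fun x _ => (hM i x).mul (hN x j)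

theorem hasDerivWithinAt_matrix_transpose [Finite l] [Finite m] {M : ℝ → Matrix l m ℝ}
    {M' : Matrix l m ℝ}
    (hM : HasDerivWithinAt M M' s t) : HasDerivWithinAt (fun r => (M r)ᵀ) M'ᵀ s t := by
  rw [hasDerivWithinAt_matrix_iff] at *
  exact fun i j => hM j i

theorem hasDerivWithinAt_matrix_const [Finite l] [Finite m] (M : Matrix l m ℝ) :
    HasDerivWithinAt (fun _ : ℝ => M) 0 s t :=
  hasDerivWithinAt_matrix_iff.2 fun _ _ => hasDerivWithinAt_const ..

theorem hasDerivWithinAt_matrix_sub [Finite l] [Finite m] {M N : ℝ → Matrix l m ℝ}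
    {M' N' : Matrix l m ℝ}
    (hM : HasDerivWithinAt M M' s t) (hN : HasDerivWithinAt N N' s t) :
    HasDerivWithinAt (fun r => M r - N r) (M' - N') s t := by
  rw [hasDerivWithinAt_matrix_iff] at *
  exact fun i j => (hM i j).sub (hN i j)

theorem eq_initial_of_hasDerivWithinAt_zero {f : ℝ → ℝ}
    (h : ∀ t ∈ Icc (0 : ℝ) 1, HasDerivWithinAt f 0 (Icc 0 1) t) :
    ∀ t ∈ Icc (0 : ℝ) 1, f t = f 0 :=
  constant_of_derivWithin_zero (fun t ht => (h t ht).differentiableWithinAt) fun t ht =>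
    (h t (Ico_subset_Icc_self ht)).derivWithin
      (uniqueDiffOn_Icc zero_lt_one t (Ico_subset_Icc_self ht))

theorem matrix_eq_initial_of_hasDerivWithinAt_zero [Finite m] [Finite k] {M : ℝ → Matrix m k ℝ}
    (h : ∀ t ∈ Icc (0 : ℝ) 1, HasDerivWithinAt M 0 (Icc 0 1) t) :
    ∀ t ∈ Icc (0 : ℝ) 1, M t = M 0 := fun t ht => by
  ext i j
  exact eq_initial_of_hasDerivWithinAt_zero (f := fun r => M r i j)
    (fun t ht => hasDerivWithinAt_matrix_iff.1 (h t ht) i j) t ht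

theorem monotoneOn_of_hasDerivWithinAt_nonneg {f f' : ℝ → ℝ}
    (h : ∀ t ∈ Icc (0 : ℝ) 1, HasDerivWithinAt f (f' t) (Icc 0 1) t)
    (h0 : ∀ t ∈ Icc (0 : ℝ) 1, 0 ≤ f' t) : MonotoneOn f (Icc 0 1) := by
  have hd : ∀ t ∈ interior (Icc (0 : ℝ) 1), HasDerivAt f (f' t) t := fun t ht =>
    (h t (interior_subset ht)).hasDerivAt (mem_interior_iff_mem_nhds.1 ht)
  refine monotoneOn_of_deriv_nonneg (convex_Icc 0 1) (fun t ht => (h t ht).continuousWithinAt)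
    (fun t ht => (hd t ht).differentiableAt.differentiableWithinAt) fun t ht => ?_
  rw [(hd t ht).deriv]
  exact h0 t (interior_subset ht)

/-- An antiderivative of a function that is continuous on `[0,1]` only. -/
theorem hasDerivWithinAt_integral_Icc {g : ℝ → ℝ} (hg : ContinuousOn g (Icc 0 1)) :
    ∀ t ∈ Icc (0 : ℝ) 1, HasDerivWithinAt (fun r => ∫ τ in (0 : ℝ)..r, g τ) (g t) (Icc 0 1) t := by
  intro t ht
  have hc : Continuous (IccExtend (zero_le_one (α := ℝ)) ((Icc 0 1).domRestrict g)) :=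
    (continuousOn_iff_continuous_domRestrict.1 hg).Icc_extend'
  have hext : ∀ r ∈ Icc (0 : ℝ) 1,
      IccExtend (zero_le_one (α := ℝ)) ((Icc 0 1).domRestrict g) r = g r :=
    fun r hr => by rw [IccExtend_of_mem _ _ hr]; rfl
  have h1 : HasDerivWithinAt (fun r => ∫ τ in (0 : ℝ)..r,
      IccExtend (zero_le_one (α := ℝ)) ((Icc 0 1).domRestrict g) τ) (g t) (Icc 0 1) t := by
    rw [← hext t ht]
    exact (intervalIntegral.integral_hasDerivAt_right (hc.intervalIntegrable _ _)
      (hc.stronglyMeasurableAtFilter _ _) hc.continuousAt).hasDerivWithinAt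
  have h2 : ∀ r ∈ Icc (0 : ℝ) 1, ∫ τ in (0 : ℝ)..r, g τ = ∫ τ in (0 : ℝ)..r,
      IccExtend (zero_le_one (α := ℝ)) ((Icc 0 1).domRestrict g) τ := fun r hr => by
    refine intervalIntegral.integral_congr fun τ hτ => (hext τ ?_).symm
    rw [uIcc_of_le hr.1] at hτ
    exact ⟨hτ.1, hτ.2.trans hr.2⟩
  exact h1.congr h2 (h2 t ht)

end MatrixCalculus

/-! ### Linear differential equations and the transition matrix. -/

section LinearODE

variable {n p : ℕ}

/-- Truncation of each coordinate to `[-R, R]`. -/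
def clamp (R : ℝ) (y : Fin n → ℝ) : Fin n → ℝ := fun i => max (-R) (min R (y i))

theorem norm_clamp_le {R : ℝ} (hR : 0 ≤ R) (y : Fin n → ℝ) : ‖clamp R y‖ ≤ R :=
  (pi_norm_le_iff_of_nonneg hR).2 fun i => by
    rw [Real.norm_eq_abs, abs_le]
    exact ⟨le_max_left _ _, max_le (by linarith) (min_le_left _ _)⟩

theorem norm_clamp_le_norm {R : ℝ} (hR : 0 ≤ R) (y : Fin n → ℝ) : ‖clamp R y‖ ≤ ‖y‖ :=
  (pi_norm_le_iff_of_nonneg (norm_nonneg y)).2 fun i => by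
    have h := norm_le_pi_norm y i
    rw [Real.norm_eq_abs, abs_le] at *
    refine ⟨?_, max_le (by linarith [norm_nonneg y]) ((min_le_right _ _).trans h.2)⟩
    exact (le_min (by linarith [norm_nonneg y]) h.1).trans (le_max_right _ _)

theorem clamp_of_norm_le {R : ℝ} {y : Fin n → ℝ} (hy : ‖y‖ ≤ R) : clamp R y = y := by
  funext i
  have h := (norm_le_pi_norm y i).trans hy
  rw [Real.norm_eq_abs, abs_le] at h
  simp [clamp, h.1, h.2]

theorem norm_clamp_sub_le (R : ℝ) (y z : Fin n → ℝ) : ‖clamp R y - clamp R z‖ ≤ ‖y - z‖ :=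
  (pi_norm_le_iff_of_nonneg (norm_nonneg _)).2 fun i => by
    have h := norm_le_pi_norm (y - z) i
    refine le_trans ?_ h
    simp only [Pi.sub_apply, clamp, Real.norm_eq_abs]
    rw [max_comm (-R), max_comm (-R)]
    exact (abs_max_sub_max_le_abs _ _ _).trans ((abs_min_sub_min_le_max R (y i) R (z i)).trans
      (by simp))

theorem exists_entry_bound {m k : Type*} [Fintype m] [Fintype k] {M : ℝ → Matrix m k ℝ}
    (hM : ContinuousOn M (Icc 0 1)) :
    ∃ C, 0 ≤ C ∧ ∀ t ∈ Icc (0 : ℝ) 1, ∀ i j, |M t i j| ≤ C := by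
  choose C hC using fun i j => isCompact_Icc.exists_bound_of_continuousOn
    (continuousOn_matrix_iff.1 hM i j)
  refine ⟨∑ i, ∑ j, |C i j|, by positivity, fun t ht i j => ?_⟩
  calc |M t i j| ≤ |C i j| := (hC i j t ht).trans (le_abs_self _)
    _ ≤ ∑ j, |C i j| := Finset.single_le_sum (f := fun j => |C i j|) (fun _ _ => abs_nonneg _)
      (Finset.mem_univ j)
    _ ≤ _ := Finset.single_le_sum (f := fun i => ∑ j, |C i j|)
      (fun _ _ => Finset.sum_nonneg fun _ _ => abs_nonneg _) (Finset.mem_univ i)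

theorem exists_norm_mulVec_le {A : ℝ → Matrix (Fin n) (Fin n) ℝ} (hA : ContinuousOn A (Icc 0 1)) :
    ∃ K : NNReal, ∀ t ∈ Icc (0 : ℝ) 1, ∀ y, ‖A t *ᵥ y‖ ≤ K * ‖y‖ := by
  obtain ⟨C, hC0, hC⟩ := exists_entry_bound hA
  refine ⟨(n * C).toNNReal, fun t ht y => ?_⟩
  rw [Real.coe_toNNReal _ (mul_nonneg n.cast_nonneg hC0)]
  refine (pi_norm_le_iff_of_nonneg (by positivity)).2 fun i => ?_
  simp only [mulVec, dotProduct]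
  refine (norm_sum_le _ _).trans ?_
  calc ∑ j, ‖A t i j * y j‖ ≤ ∑ _j : Fin n, C * ‖y‖ := Finset.sum_le_sum fun j _ => by
        rw [norm_mul]
        exact mul_le_mul (hC t ht i j) (norm_le_pi_norm y j) (norm_nonneg _) hC0
    _ = _ := by simp [mul_assoc]

/-- Truncating the state makes the vector field bounded, so Picard–Lindelöf reaches the whole
interval in one step; Grönwall then shows that the truncation was never active. -/
theorem exists_linear_ode_solution {A : ℝ → Matrix (Fin n) (Fin n) ℝ}
    (hA : ContinuousOn A (Icc 0 1)) (x₀ : Fin n → ℝ) :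
    ∃ x : ℝ → Fin n → ℝ, x 0 = x₀ ∧
      ∀ t ∈ Icc (0 : ℝ) 1, HasDerivWithinAt x (A t *ᵥ x t) (Icc 0 1) t := by
  obtain ⟨K, hK⟩ := exists_norm_mulVec_le hA
  -- This is the Grönwall bound at time `1` for an equation with growth constant `K`.
  set R : NNReal := (‖x₀‖ * Real.exp K).toNNReal with hRdef
  have hR : (0 : ℝ) ≤ R := R.2
  have hPL : IsPicardLindelof (fun t y => A t *ᵥ clamp R y)
      (⟨0, by simp⟩ : Icc (0 : ℝ) 1) x₀ (K * R) 0 (K * R) K := by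
    refine ⟨fun t ht => LipschitzOnWith.of_dist_le_mul fun y _ z _ => ?_, fun y _ => ?_,
      fun t ht y _ => ?_, by simp⟩
    · rw [dist_eq_norm, dist_eq_norm, ← mulVec_sub]
      exact (hK t ht _).trans (by gcongr; exact norm_clamp_sub_le _ _ _)
    · refine continuousOn_pi.2 fun i => ?_
      simp only [mulVec, dotProduct]
      exact continuousOn_finsetSum _ fun j _ =>
        (continuousOn_matrix_iff.1 hA i j).mul continuousOn_const
    · exact (hK t ht _).trans (by push_cast; gcongr; exact norm_clamp_le hR _)
  obtain ⟨x, hx0, hx⟩ := hPL.exists_eq_forall_mem_Icc_hasDerivWithinAt₀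
  refine ⟨x, hx0, fun t ht => ?_⟩
  have hbound : ∀ t ∈ Icc (0 : ℝ) 1, ‖x t‖ ≤ gronwallBound ‖x₀‖ K 0 (t - 0) := by
    refine norm_le_gronwallBound_of_norm_deriv_right_le (f' := fun t => A t *ᵥ clamp R (x t))
      (fun t ht => (hx t ht).continuousWithinAt) (fun t ht => ?_) (by simp at hx0; rw [hx0])
      fun t ht => ?_
    · exact (hx t (Ico_subset_Icc_self ht)).mono_of_mem_nhdsWithin (Icc_mem_nhdsGE_of_mem ht)
    · rw [add_zero]
      exact (hK t (Ico_subset_Icc_self ht) _).trans (by gcongr; exact norm_clamp_le_norm hR _)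
  have hle : ‖x t‖ ≤ R := by
    refine (hbound t ht).trans ?_
    rw [gronwallBound_ε0, sub_zero, hRdef, Real.coe_toNNReal _ (by positivity)]
    gcongr
    exact mul_le_of_le_one_right K.2 ht.2
  have h := hx t ht
  rwa [clamp_of_norm_le hle] at h

/-- `X` and `Y` are the fundamental matrix of `ẋ = A x` that is `1` at time `0`, and its inverse. -/
structure IsFundamentalPair (A X Y : ℝ → Matrix (Fin n) (Fin n) ℝ) : Prop where
  zero : X 0 = 1
  zero_inv : Y 0 = 1
  deriv : ∀ t ∈ Icc (0 : ℝ) 1, HasDerivWithinAt X (A t * X t) (Icc 0 1) t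
  deriv_inv : ∀ t ∈ Icc (0 : ℝ) 1, HasDerivWithinAt Y (-(Y t * A t)) (Icc 0 1) t
  inv_mul : ∀ t ∈ Icc (0 : ℝ) 1, Y t * X t = 1
  mul_inv : ∀ t ∈ Icc (0 : ℝ) 1, X t * Y t = 1
  transitionMatrix_eq : ∀ t ∈ Icc (0 : ℝ) 1, ∀ s ∈ Icc (0 : ℝ) 1,
    transitionMatrix A t s = X t * Y s

theorem exists_linear_matrix_ode_solution {A : ℝ → Matrix (Fin n) (Fin n) ℝ}
    (hA : ContinuousOn A (Icc 0 1)) :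
    ∃ X : ℝ → Matrix (Fin n) (Fin n) ℝ, X 0 = 1 ∧
      ∀ t ∈ Icc (0 : ℝ) 1, HasDerivWithinAt X (A t * X t) (Icc 0 1) t := by
  choose x hx0 hx using fun j : Fin n => exists_linear_ode_solution hA (Pi.single j 1)
  refine ⟨fun t => Matrix.of fun i j => x j t i, ?_, fun t ht => ?_⟩
  · ext i j
    simp [hx0, Matrix.one_apply, Pi.single_apply]
  · rw [hasDerivWithinAt_matrix_iff]
    exact fun i j => hasDerivWithinAt_pi.1 (hx j t ht) i

/-- The derivatives `-Y A Z` and `Y A Z` cancel. This conservation law does the work of every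
uniqueness theorem below. -/
theorem inverse_mul_eq_of_hasDerivWithinAt {l : Type*} [Finite l]
    {A Y : ℝ → Matrix (Fin n) (Fin n) ℝ}
    (hY : ∀ t ∈ Icc (0 : ℝ) 1, HasDerivWithinAt Y (-(Y t * A t)) (Icc 0 1) t)
    {Z : ℝ → Matrix (Fin n) l ℝ}
    (hZ : ∀ t ∈ Icc (0 : ℝ) 1, HasDerivWithinAt Z (A t * Z t) (Icc 0 1) t) :
    ∀ t ∈ Icc (0 : ℝ) 1, Y t * Z t = Y 0 * Z 0 := by
  refine matrix_eq_initial_of_hasDerivWithinAt_zero fun t ht => ?_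
  have h := hasDerivWithinAt_matrix_mul (hY t ht) (hZ t ht)
  rwa [Matrix.neg_mul, Matrix.mul_assoc, neg_add_cancel] at h

/-- The inverse is the transpose of a fundamental solution of the adjoint equation. The conservation
law also forces any chosen transition matrix to agree with `X t * Y s` on `[0,1]`, so the arbitrary
choice in its definition is harmless. -/
theorem exists_isFundamentalPair {A : ℝ → Matrix (Fin n) (Fin n) ℝ}
    (hA : ContinuousOn A (Icc 0 1)) : ∃ X Y, IsFundamentalPair A X Y := by
  obtain ⟨X, hX0, hX⟩ := exists_linear_matrix_ode_solution hA
  obtain ⟨Z, hZ0, hZ⟩ := exists_linear_matrix_ode_solution (A := fun t => -(A t)ᵀ) <|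
    continuousOn_matrix_iff.2 fun i j => (continuousOn_matrix_iff.1 hA j i).neg
  have hY : ∀ t ∈ Icc (0 : ℝ) 1,
      HasDerivWithinAt (fun t => (Z t)ᵀ) (-((Z t)ᵀ * A t)) (Icc 0 1) t := fun t ht => by
    have h := hasDerivWithinAt_matrix_transpose (hZ t ht)
    rwa [Matrix.neg_mul, transpose_neg, transpose_mul, transpose_transpose] at h
  have hYX : ∀ t ∈ Icc (0 : ℝ) 1, (Z t)ᵀ * X t = 1 := fun t ht => by
    rw [inverse_mul_eq_of_hasDerivWithinAt hY hX t ht, hX0, hZ0]; simp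
  have hXY : ∀ t ∈ Icc (0 : ℝ) 1, X t * (Z t)ᵀ = 1 := fun t ht => mul_eq_one_comm.1 (hYX t ht)
  have hT : IsTransitionMatrix A fun t s => X t * (Z s)ᵀ := fun s hs =>
    ⟨hXY s hs, fun t ht => by
      have h := hasDerivWithinAt_matrix_mul (hX t ht) (hasDerivWithinAt_matrix_const (Z s)ᵀ)
      rwa [Matrix.mul_zero, add_zero, Matrix.mul_assoc] at h⟩
  refine ⟨X, fun t => (Z t)ᵀ, hX0, by simp [hZ0], hX, hY, hYX, hXY, fun t ht s hs => ?_⟩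
  have hex : ∃ Φ, IsTransitionMatrix A Φ := ⟨_, hT⟩
  obtain ⟨h1, h2⟩ := hex.choose_spec s hs
  have hΦ : transitionMatrix A = hex.choose := dif_pos hex
  have h3 := inverse_mul_eq_of_hasDerivWithinAt hY h2
  rw [hΦ, ← Matrix.one_mul (hex.choose t s), ← hXY t ht, Matrix.mul_assoc, h3 t ht, ← h3 s hs, h1,
    Matrix.mul_one]

end LinearODE

end OMTwpd

noncomputable section

namespace OMTwpd

variable {n p : ℕ}

/-! ### The Gramian pulled back to time `0`, and controllability. -/

section Gramian

theorem continuousOn_matrix_mul {l m k : Type*} [Fintype m] {s : Set ℝ}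
    {M : ℝ → Matrix l m ℝ} {N : ℝ → Matrix m k ℝ}
    (hM : ContinuousOn M s) (hN : ContinuousOn N s) : ContinuousOn (fun t => M t * N t) s := by
  rw [continuousOn_matrix_iff] at *
  intro i j
  simp only [Matrix.mul_apply]
  exact continuousOn_finsetSum _ fun x _ => (hM i x).mul (hN x j)

theorem continuousOn_matrix_transpose {l m : Type*} {s : Set ℝ} {M : ℝ → Matrix l m ℝ}
    (hM : ContinuousOn M s) : ContinuousOn (fun t => (M t)ᵀ) s := by
  rw [continuousOn_matrix_iff] at *
  exact fun i j => hM j i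

theorem hasDerivWithinAt_dotProduct_mulVec {l m : Type*} [Fintype l] [Fintype m] {s : Set ℝ} {t : ℝ}
    {M : ℝ → Matrix l m ℝ} {M' : Matrix l m ℝ} (hM : HasDerivWithinAt M M' s t)
    (v : l → ℝ) (w : m → ℝ) :
    HasDerivWithinAt (fun r => v ⬝ᵥ M r *ᵥ w) (v ⬝ᵥ M' *ᵥ w) s t := by
  rw [hasDerivWithinAt_matrix_iff] at hM
  simp only [mulVec, dotProduct]
  exact HasDerivWithinAt.fun_sum fun i _ => (HasDerivWithinAt.fun_sum fun j _ =>
    (hM i j).mul_const _).const_mul _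

theorem IsFundamentalPair.continuousOn {A X Y : ℝ → Matrix (Fin n) (Fin n) ℝ}
    (h : IsFundamentalPair A X Y) : ContinuousOn X (Icc 0 1) :=
  continuousOn_of_hasDerivWithinAt h.deriv

theorem IsFundamentalPair.continuousOn_inv {A X Y : ℝ → Matrix (Fin n) (Fin n) ℝ}
    (h : IsFundamentalPair A X Y) : ContinuousOn Y (Icc 0 1) :=
  continuousOn_of_hasDerivWithinAt h.deriv_inv

/-- The Gramian `∫₀ᵗ Φ(0,τ) B(τ) B(τ)' Φ(0,τ)' dτ` pulled back to time `0`, where `Y τ = Φ(0,τ)`. -/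
def initialGramian (Y : ℝ → Matrix (Fin n) (Fin n) ℝ) (B : ℝ → Matrix (Fin n) (Fin p) ℝ) (t : ℝ) :
    Matrix (Fin n) (Fin n) ℝ :=
  Matrix.of fun i j => ∫ τ in (0 : ℝ)..t, (Y τ * B τ * (Y τ * B τ)ᵀ) i j

variable {A X Y : ℝ → Matrix (Fin n) (Fin n) ℝ} {B : ℝ → Matrix (Fin n) (Fin p) ℝ}

theorem continuousOn_initialGramian_integrand (hY : ContinuousOn Y (Icc 0 1))
    (hB : ContinuousOn B (Icc 0 1)) :
    ContinuousOn (fun τ => Y τ * B τ * (Y τ * B τ)ᵀ) (Icc 0 1) :=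
  continuousOn_matrix_mul (continuousOn_matrix_mul hY hB)
    (continuousOn_matrix_transpose (continuousOn_matrix_mul hY hB))

theorem hasDerivWithinAt_initialGramian (hY : ContinuousOn Y (Icc 0 1))
    (hB : ContinuousOn B (Icc 0 1)) :
    ∀ t ∈ Icc (0 : ℝ) 1,
      HasDerivWithinAt (initialGramian Y B) (Y t * B t * (Y t * B t)ᵀ) (Icc 0 1) t := fun t ht =>
  hasDerivWithinAt_matrix_iff.2 fun i j => hasDerivWithinAt_integral_Icc
    (continuousOn_matrix_iff.1 (continuousOn_initialGramian_integrand hY hB) i j) t ht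

theorem initialGramian_zero : initialGramian Y B 0 = 0 := by
  ext i j
  simp [initialGramian]

theorem transpose_initialGramian (t : ℝ) : (initialGramian Y B t)ᵀ = initialGramian Y B t := by
  ext i j
  simp only [initialGramian, transpose_apply, of_apply]
  congr 1 with τ
  conv_rhs => rw [← transpose_transpose (Y τ * B τ * (Y τ * B τ)ᵀ), transpose_mul,
    transpose_transpose, transpose_apply]

/-- Since `Φ(t,τ) = X(t) Y(τ)`, the outer factors do not depend on `τ` and leave the integral. -/
theorem gramian_eq (hA : IsFundamentalPair A X Y) (hB : ContinuousOn B (Icc 0 1)) {t : ℝ}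
    (ht : t ∈ Icc (0 : ℝ) 1) : gramian A B t 0 = X t * initialGramian Y B t * (X t)ᵀ := by
  ext i j
  have hc := continuousOn_matrix_iff.1
    (continuousOn_initialGramian_integrand hA.continuousOn_inv hB)
  have hint : ∀ a b, IntervalIntegrable (fun τ => (Y τ * B τ * (Y τ * B τ)ᵀ) a b) volume 0 t :=
    fun a b => ((hc a b).mono (by rw [uIcc_of_le ht.1]; exact Icc_subset_Icc_right ht.2))
      |>.intervalIntegrable
  have h1 : gramian A B t 0 i j =
      ∫ τ in (0 : ℝ)..t, (X t * (Y τ * B τ * (Y τ * B τ)ᵀ) * (X t)ᵀ) i j := by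
    simp only [gramian, of_apply]
    refine intervalIntegral.integral_congr fun τ hτ => ?_
    rw [uIcc_of_le ht.1] at hτ
    simp only [hA.transitionMatrix_eq t ht τ ⟨hτ.1, hτ.2.trans ht.2⟩, transpose_mul,
      Matrix.mul_assoc]
  rw [h1]
  simp only [Matrix.mul_apply (M := X t * _), Matrix.mul_apply (M := X t), initialGramian, of_apply]
  rw [intervalIntegral.integral_finsetSum]
  · refine Finset.sum_congr rfl fun b _ => ?_
    rw [intervalIntegral.integral_mul_const, intervalIntegral.integral_finsetSum]
    · simp only [intervalIntegral.integral_const_mul]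
    · exact fun a _ => (hint a b).const_mul _
  · exact fun b _ => IntervalIntegrable.mul_const
      (by simpa only [Finset.sum_fn] using
        IntervalIntegrable.sum Finset.univ fun a _ => (hint a b).const_mul (X t i a)) _

theorem dotProduct_self_mul_transpose_mulVec (C : Matrix (Fin n) (Fin p) ℝ) (w : Fin n → ℝ) :
    w ⬝ᵥ (C * Cᵀ) *ᵥ w = (Cᵀ *ᵥ w) ⬝ᵥ (Cᵀ *ᵥ w) := by
  rw [← mulVec_mulVec, dotProduct_mulVec, ← mulVec_transpose]

/-- The derivative of the quadratic form is `‖(Y B)' w‖²`. -/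
theorem dotProduct_initialGramian_monotoneOn (hY : ContinuousOn Y (Icc 0 1))
    (hB : ContinuousOn B (Icc 0 1)) (w : Fin n → ℝ) :
    MonotoneOn (fun t => w ⬝ᵥ initialGramian Y B t *ᵥ w) (Icc 0 1) :=
  monotoneOn_of_hasDerivWithinAt_nonneg
    (fun t ht =>
      hasDerivWithinAt_dotProduct_mulVec (hasDerivWithinAt_initialGramian hY hB t ht) w w)
    fun t _ => by
      rw [dotProduct_self_mul_transpose_mulVec]
      exact Finset.sum_nonneg fun _ _ => mul_self_nonneg _

theorem dotProduct_initialGramian_nonneg (hY : ContinuousOn Y (Icc 0 1))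
    (hB : ContinuousOn B (Icc 0 1)) (w : Fin n → ℝ) {t : ℝ} (ht : t ∈ Icc (0 : ℝ) 1) :
    0 ≤ w ⬝ᵥ initialGramian Y B t *ᵥ w := by
  have h := dotProduct_initialGramian_monotoneOn hY hB w (left_mem_Icc.2 zero_le_one) ht ht.1
  simpa [initialGramian_zero] using h

/-- A monotone form that is `0` at both ends is constant, so its derivative, the square of the
vector in question, vanishes. -/
theorem transpose_mulVec_eq_zero_of_initialGramian (hY : ContinuousOn Y (Icc 0 1))
    (hB : ContinuousOn B (Icc 0 1)) {w : Fin n → ℝ}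
    (hw : w ⬝ᵥ initialGramian Y B 1 *ᵥ w = 0) {t : ℝ} (ht : t ∈ Icc (0 : ℝ) 1) :
    (Y t * B t)ᵀ *ᵥ w = 0 := by
  have hzero : ∀ s ∈ Icc (0 : ℝ) 1, w ⬝ᵥ initialGramian Y B s *ᵥ w = 0 := fun s hs =>
    le_antisymm ((dotProduct_initialGramian_monotoneOn hY hB w hs (right_mem_Icc.2 zero_le_one)
      hs.2).trans hw.le) (dotProduct_initialGramian_nonneg hY hB w hs)
  have h1 := hasDerivWithinAt_dotProduct_mulVec (hasDerivWithinAt_initialGramian hY hB t ht) w w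
  have h2 : HasDerivWithinAt (fun r => w ⬝ᵥ initialGramian Y B r *ᵥ w) 0 (Icc 0 1) t :=
    (hasDerivWithinAt_const t (Icc (0 : ℝ) 1) (0 : ℝ)).congr hzero (hzero t ht)
  have h3 := (uniqueDiffOn_Icc zero_lt_one t ht).eq_deriv _ h1 h2
  rwa [dotProduct_self_mul_transpose_mulVec, dotProduct_self_eq_zero] at h3

/-- Let `w` be a null vector and steer the state from `w` to `0` along `ξ`. The derivative of `w'Yξ`
is `w'YBu = 0`, so the value `‖w‖²` at time `0` equals the value `0` at time `1`. -/
theorem initialGramian_posDef (hA : IsFundamentalPair A X Y) (hB : ContinuousOn B (Icc 0 1))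
    (hAB : IsControllable A B) : (initialGramian Y B 1).PosDef := by
  refine PosDef.of_dotProduct_mulVec_pos ?_ fun w hw => ?_
  · rw [IsHermitian, conjTranspose_eq_transpose_of_trivial, transpose_initialGramian]
  rw [star_trivial]
  refine lt_of_le_of_ne (dotProduct_initialGramian_nonneg hA.continuousOn_inv hB w
    (right_mem_Icc.2 zero_le_one)) fun h0 => hw ?_
  obtain ⟨u, ξ, -, hξ0, hξ1, hξ⟩ := hAB (WithLp.toLp 2 w) 0
  -- The trajectory is written as a one-column matrix so that the matrix product rule applies to it.
  set Z : ℝ → Matrix (Fin n) (Fin 1) ℝ := fun t => Matrix.of fun i _ => ξ t i with hZdef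
  have hZ : ∀ t ∈ Icc (0 : ℝ) 1, HasDerivWithinAt Z
      (A t * Z t + Matrix.of fun i _ => (B t *ᵥ (u t).ofLp) i) (Icc 0 1) t := fun t ht => by
    refine hasDerivWithinAt_matrix_iff.2 fun i j => ?_
    have h := ((EuclideanSpace.proj (𝕜 := ℝ) i).hasFDerivAt (x := ξ t)).comp_hasDerivWithinAt t
      (hξ t ht)
    exact h
  have hW : ∀ t ∈ Icc (0 : ℝ) 1,
      HasDerivWithinAt (fun t => w ⬝ᵥ (Y t * Z t) *ᵥ (fun _ => 1)) 0 (Icc 0 1) t := fun t ht => by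
    have h := hasDerivWithinAt_dotProduct_mulVec
      (hasDerivWithinAt_matrix_mul (hA.deriv_inv t ht) (hZ t ht)) w (fun _ => 1)
    convert h using 1
    have hB0 := transpose_mulVec_eq_zero_of_initialGramian hA.continuousOn_inv hB h0.symm ht
    have hcol : (Matrix.of fun i (_ : Fin 1) => (B t *ᵥ (u t).ofLp) i)
        = B t * (Matrix.of fun i (_ : Fin 1) => u t i) := by
      ext i j
      simp [Matrix.mul_apply, mulVec, dotProduct]
    rw [Matrix.mul_add, Matrix.neg_mul, Matrix.mul_assoc, neg_add_cancel_left, hcol,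
      ← Matrix.mul_assoc, ← mulVec_mulVec, dotProduct_mulVec, ← mulVec_transpose, hB0,
      zero_dotProduct]
  have h := eq_initial_of_hasDerivWithinAt_zero hW 1 (right_mem_Icc.2 zero_le_one)
  have hZ1 : Z 1 = 0 := by ext i j; simp [hZdef, hξ1]
  have hZ0 : Z 0 *ᵥ (fun _ => 1) = w := by ext i; simp [hZdef, hξ0, mulVec, dotProduct]
  rw [hZ1, Matrix.mul_zero, zero_mulVec, dotProduct_zero, hA.zero_inv, Matrix.one_mul, hZ0] at h
  exact dotProduct_self_eq_zero.1 h.symm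

theorem isUnit_det_initialGramian (hA : IsFundamentalPair A X Y) (hB : ContinuousOn B (Icc 0 1))
    (hAB : IsControllable A B) : IsUnit (initialGramian Y B 1).det :=
  (isUnit_iff_isUnit_det _).1 (initialGramian_posDef hA hB hAB).isUnit

theorem IsFundamentalPair.isUnit_det (hA : IsFundamentalPair A X Y) {t : ℝ}
    (ht : t ∈ Icc (0 : ℝ) 1) : IsUnit (X t).det :=
  isUnit_det_of_right_inverse (hA.mul_inv t ht)

theorem isUnit_det_gramian (hA : IsFundamentalPair A X Y) (hB : ContinuousOn B (Icc 0 1))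
    (hAB : IsControllable A B) : IsUnit (gramian A B 1 0).det := by
  have h1 := right_mem_Icc.2 (zero_le_one (α := ℝ))
  rw [gramian_eq hA hB h1, det_mul, det_mul, det_transpose]
  exact ((hA.isUnit_det h1).mul (isUnit_det_initialGramian hA hB hAB)).mul (hA.isUnit_det h1)

/-- No invertibility of the Gramian is needed: reversing a product under `⁻¹` is unconditional, and
both sides are `0` when the Gramian is singular and `n > 0`. -/
theorem gramian_inv (hA : IsFundamentalPair A X Y) (hB : ContinuousOn B (Icc 0 1)) {t : ℝ}
    (ht : t ∈ Icc (0 : ℝ) 1) :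
    (gramian A B t 0)⁻¹ = (Y t)ᵀ * (initialGramian Y B t)⁻¹ * Y t := by
  rw [gramian_eq hA hB ht, Matrix.mul_inv_rev, Matrix.mul_inv_rev, ← transpose_nonsing_inv,
    inv_eq_right_inv (hA.mul_inv t ht), Matrix.mul_assoc]

theorem transpose_mul_gramian_inv_mul (hA : IsFundamentalPair A X Y) (hB : ContinuousOn B (Icc 0 1))
    {t : ℝ} (ht : t ∈ Icc (0 : ℝ) 1) :
    (X t)ᵀ * (gramian A B t 0)⁻¹ * X t = (initialGramian Y B t)⁻¹ := by
  have h : (X t)ᵀ * (Y t)ᵀ = 1 := by rw [← transpose_mul, hA.inv_mul t ht, transpose_one]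
  rw [gramian_inv hA hB ht, ← Matrix.mul_assoc, ← Matrix.mul_assoc, h, Matrix.one_mul,
    Matrix.mul_assoc, hA.inv_mul t ht, Matrix.mul_one]

end Gramian

/-! ### Controllability of the closed loop. -/

section Controllability

/-- State feedback preserves controllability. -/
theorem isControllable_closedLoop {A P : ℝ → Matrix (Fin n) (Fin n) ℝ}
    {B : ℝ → Matrix (Fin n) (Fin p) ℝ} (hB : ContinuousOn B (Icc 0 1))
    (hP : ContinuousOn P (Icc 0 1)) (hAB : IsControllable A B) :
    IsControllable (closedLoop A B P) B := by
  intro x y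
  obtain ⟨u, ξ, hu, hξ0, hξ1, hξ⟩ := hAB x y
  -- The new input cancels the feedback term, so the open-loop trajectory `ξ` still works.
  refine ⟨fun t => u t + ((B t)ᵀ * P t).toEuclideanLin (ξ t), ξ, ?_, hξ0, hξ1, fun t ht => ?_⟩
  · refine hu.add ?_
    have h1 := continuousOn_matrix_iff.1 <|
      continuousOn_matrix_mul (continuousOn_matrix_transpose hB) hP
    have h2 : ContinuousOn ξ (Icc 0 1) := fun t ht => (hξ t ht).continuousWithinAt
    refine (PiLp.continuous_toLp 2 _).comp_continuousOn (continuousOn_pi.2 fun i => ?_)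
    show ContinuousOn (fun t => (((B t)ᵀ * P t) *ᵥ (ξ t).ofLp) i) _
    simp only [mulVec, dotProduct]
    refine continuousOn_finsetSum _ fun j _ => (h1 i j).mul ?_
    exact (EuclideanSpace.proj (𝕜 := ℝ) j).continuous.comp_continuousOn h2
  · convert hξ t ht using 1
    ext i
    simp [closedLoop, Matrix.mul_assoc]

end Controllability

/-! ### The initial value of the Riccati equation. -/

section InitialValue

/-- `Σ₀^{-1/2} (Σ₀^{1/2} Φ₁₀' M₁₀⁻¹ Σ₁ M₁₀⁻¹ Φ₁₀ Σ₀^{1/2})^{1/2} Σ₀^{-1/2}`. -/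
def scaledRoot (A : ℝ → Matrix (Fin n) (Fin n) ℝ) (B : ℝ → Matrix (Fin n) (Fin p) ℝ)
    (S₀ S₁ : Matrix (Fin n) (Fin n) ℝ) : Matrix (Fin n) (Fin n) ℝ :=
  (CFC.sqrt S₀)⁻¹ * middleRoot A B S₀ S₁ * (CFC.sqrt S₀)⁻¹

variable {A X Y : ℝ → Matrix (Fin n) (Fin n) ℝ} {B : ℝ → Matrix (Fin n) (Fin p) ℝ}
  {S₀ S₁ : Matrix (Fin n) (Fin n) ℝ}

theorem posDef_sqrt {S : Matrix (Fin n) (Fin n) ℝ} (hS : S.PosDef) : (CFC.sqrt S).PosDef := by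
  have h1 : (CFC.sqrt S).PosSemidef := nonneg_iff_posSemidef.1 (CFC.sqrt_nonneg S)
  have h2 : CFC.sqrt S * CFC.sqrt S = S :=
    CFC.sqrt_mul_sqrt_self S (nonneg_iff_posSemidef.2 hS.posSemidef)
  refine h1.posDef_iff_isUnit.2 ((isUnit_iff_isUnit_det _).2 ?_)
  have h3 := (isUnit_iff_isUnit_det _).1 hS.isUnit
  rw [← h2, det_mul] at h3
  exact isUnit_of_mul_isUnit_left h3

theorem sqrt_mul_sqrt {S : Matrix (Fin n) (Fin n) ℝ} (hS : S.PosDef) :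
    CFC.sqrt S * CFC.sqrt S = S :=
  CFC.sqrt_mul_sqrt_self S (nonneg_iff_posSemidef.2 hS.posSemidef)

theorem posDef_transpose_eq {S : Matrix (Fin n) (Fin n) ℝ} (hS : S.PosDef) : Sᵀ = S := by
  rw [← conjTranspose_eq_transpose_of_trivial]; exact hS.isHermitian

theorem posDef_conj {S C : Matrix (Fin n) (Fin n) ℝ} (hS : S.PosDef) (hC : IsUnit C.det) :
    (C * S * Cᵀ).PosDef := by
  rw [← conjTranspose_eq_transpose_of_trivial]
  exact (IsUnit.posDef_star_right_conjugate_iff ((isUnit_iff_isUnit_det _).2 hC)).2 hS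

theorem phi10_eq (hA : IsFundamentalPair A X Y) : phi10 A = X 1 := by
  rw [phi10, hA.transitionMatrix_eq 1 (right_mem_Icc.2 zero_le_one) 0 (left_mem_Icc.2 zero_le_one),
    hA.zero_inv, Matrix.mul_one]

theorem transitionMatrix_zero_eq (hA : IsFundamentalPair A X Y) {t : ℝ} (ht : t ∈ Icc (0 : ℝ) 1) :
    transitionMatrix A t 0 = X t := by
  rw [hA.transitionMatrix_eq t ht 0 (left_mem_Icc.2 zero_le_one), hA.zero_inv, Matrix.mul_one]

theorem transpose_gramian_inv (hA : IsFundamentalPair A X Y) (hB : ContinuousOn B (Icc 0 1))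
    {t : ℝ} (ht : t ∈ Icc (0 : ℝ) 1) : ((gramian A B t 0)⁻¹)ᵀ = (gramian A B t 0)⁻¹ := by
  rw [gramian_inv hA hB ht, transpose_mul, transpose_mul, transpose_transpose,
    transpose_nonsing_inv, transpose_initialGramian, Matrix.mul_assoc]

/-- It is the congruence `C Σ₁ C'` with the invertible matrix `C = Σ₀^{1/2} Φ₁₀' M₁₀⁻¹`. -/
theorem posDef_middleRoot_sq (hA : IsFundamentalPair A X Y) (hB : ContinuousOn B (Icc 0 1))
    (hAB : IsControllable A B) (hS₀ : S₀.PosDef) (hS₁ : S₁.PosDef) :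
    (CFC.sqrt S₀ * (phi10 A)ᵀ * (gram10 A B)⁻¹ * S₁ * (gram10 A B)⁻¹ * phi10 A *
      CFC.sqrt S₀).PosDef := by
  have h1 := right_mem_Icc.2 (zero_le_one (α := ℝ))
  have h := posDef_conj (C := CFC.sqrt S₀ * (phi10 A)ᵀ * (gram10 A B)⁻¹) hS₁ (by
    rw [det_mul, det_mul, det_transpose, phi10_eq hA]
    refine (((isUnit_iff_isUnit_det _).1 (posDef_sqrt hS₀).isUnit).mul (hA.isUnit_det h1)).mul ?_
    rw [det_nonsing_inv]
    exact isUnit_ringInverse.2 (isUnit_det_gramian hA hB hAB))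
  simpa only [transpose_mul, transpose_transpose, posDef_transpose_eq (posDef_sqrt hS₀), gram10,
    transpose_gramian_inv hA hB h1, Matrix.mul_assoc] using h

theorem posDef_scaledRoot (hA : IsFundamentalPair A X Y) (hB : ContinuousOn B (Icc 0 1))
    (hAB : IsControllable A B) (hS₀ : S₀.PosDef) (hS₁ : S₁.PosDef) :
    (scaledRoot A B S₀ S₁).PosDef := by
  have h := posDef_conj (C := (CFC.sqrt S₀)⁻¹) (S := middleRoot A B S₀ S₁)
    (posDef_sqrt (posDef_middleRoot_sq hA hB hAB hS₀ hS₁))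
    ((isUnit_iff_isUnit_det _).1 (posDef_sqrt hS₀).inv.isUnit)
  rwa [posDef_transpose_eq (posDef_sqrt hS₀).inv] at h

/-- The inner factors `Σ₀^{-1/2} Σ₀ Σ₀^{-1/2}` cancel and leave the square of the middle root; its
outer `Σ₀^{1/2}` then cancel too. This equation for `K` is what makes the covariance arrive at `Σ₁`.
-/
theorem scaledRoot_mul_mul_scaledRoot (hA : IsFundamentalPair A X Y)
    (hB : ContinuousOn B (Icc 0 1))
    (hAB : IsControllable A B) (hS₀ : S₀.PosDef) (hS₁ : S₁.PosDef) :
    scaledRoot A B S₀ S₁ * S₀ * scaledRoot A B S₀ S₁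
      = (X 1)ᵀ * (gramian A B 1 0)⁻¹ * S₁ * (gramian A B 1 0)⁻¹ * X 1 := by
  have hR : IsUnit (CFC.sqrt S₀).det := (isUnit_iff_isUnit_det _).1 (posDef_sqrt hS₀).isUnit
  have hQ : ∀ Q, (CFC.sqrt S₀)⁻¹ * Q * (CFC.sqrt S₀)⁻¹ * S₀ * ((CFC.sqrt S₀)⁻¹ * Q * (CFC.sqrt S₀)⁻¹)
      = (CFC.sqrt S₀)⁻¹ * (Q * Q) * (CFC.sqrt S₀)⁻¹ := fun Q => by
    nth_rw 3 [← sqrt_mul_sqrt hS₀]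
    simp only [Matrix.mul_assoc, nonsing_inv_mul_cancel_left _ _ hR,
      mul_nonsing_inv_cancel_left _ _ hR]
  rw [scaledRoot, hQ, middleRoot, sqrt_mul_sqrt (posDef_middleRoot_sq hA hB hAB hS₀ hS₁),
    phi10_eq hA, gram10]
  simp only [Matrix.mul_assoc, nonsing_inv_mul_cancel_left _ _ hR, mul_nonsing_inv _ hR,
    Matrix.mul_one]

/-- In coordinates at time `0`, `Φ₁₀' M₁₀⁻¹ Φ₁₀` is `N(1)⁻¹`; this splitting drives everything about
the Riccati equation. -/
theorem riccatiInitial_eq (hA : IsFundamentalPair A X Y) (hB : ContinuousOn B (Icc 0 1))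
    (hS₀ : S₀.PosDef) :
    riccatiInitial A B S₀ S₁ = (initialGramian Y B 1)⁻¹ - scaledRoot A B S₀ S₁ := by
  have hR : IsUnit (CFC.sqrt S₀).det := (isUnit_iff_isUnit_det _).1 (posDef_sqrt hS₀).isUnit
  rw [← transpose_mul_gramian_inv_mul hA hB (right_mem_Icc.2 zero_le_one), riccatiInitial,
    scaledRoot, Matrix.mul_sub, Matrix.sub_mul, phi10_eq hA, gram10]
  simp only [Matrix.mul_assoc, nonsing_inv_mul_cancel_left _ _ hR, mul_nonsing_inv _ hR,
    Matrix.mul_one]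

theorem transpose_riccatiInitial (hA : IsFundamentalPair A X Y) (hB : ContinuousOn B (Icc 0 1))
    (hAB : IsControllable A B) (hS₀ : S₀.PosDef) (hS₁ : S₁.PosDef) :
    (riccatiInitial A B S₀ S₁)ᵀ = riccatiInitial A B S₀ S₁ := by
  rw [riccatiInitial_eq hA hB hS₀, transpose_sub, transpose_nonsing_inv, transpose_initialGramian,
    posDef_transpose_eq (posDef_scaledRoot hA hB hAB hS₀ hS₁)]

end InitialValue

end OMTwpd

end

noncomputable section

namespace OMTwpd

variable {n p : ℕ}

/-! ### The Riccati equation: existence, closed form, symmetry, covariance transport. -/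

section Riccati

theorem continuousOn_matrix_inv {s : Set ℝ} {W : ℝ → Matrix (Fin n) (Fin n) ℝ}
    (hW : ContinuousOn W s) (hu : ∀ t ∈ s, IsUnit (W t).det) :
    ContinuousOn (fun t => (W t)⁻¹) s := by
  have hdet : ContinuousOn (fun t => (W t).det) s :=
    (Continuous.matrix_det continuous_id).comp_continuousOn hW
  have hadj := continuousOn_matrix_iff.1 <|
    (Continuous.matrix_adjugate continuous_id).comp_continuousOn hW
  refine continuousOn_matrix_iff.2 fun i j => ?_
  simp only [inv_def, Matrix.smul_apply, Ring.inverse_eq_inv', smul_eq_mul]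
  exact (hdet.inv₀ fun t ht => (hu t ht).ne_zero).mul (hadj i j)

/-- `W` solves the linear equation with coefficient `W' W⁻¹`. If `V` is the inverse fundamental
matrix of that equation, then `V W = W(0)` is conserved, so `W⁻¹ = W(0)⁻¹ V` and the derivative of
`V` is known. -/
theorem hasDerivWithinAt_matrix_inv {W W' : ℝ → Matrix (Fin n) (Fin n) ℝ}
    (hW : ∀ t ∈ Icc (0 : ℝ) 1, HasDerivWithinAt W (W' t) (Icc 0 1) t)
    (hW' : ContinuousOn W' (Icc 0 1)) (hu : ∀ t ∈ Icc (0 : ℝ) 1, IsUnit (W t).det) :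
    ∀ t ∈ Icc (0 : ℝ) 1, HasDerivWithinAt (fun t => (W t)⁻¹) (-((W t)⁻¹ * W' t * (W t)⁻¹))
      (Icc 0 1) t := by
  have h0 := left_mem_Icc.2 (zero_le_one (α := ℝ))
  have hinv := continuousOn_matrix_inv (continuousOn_of_hasDerivWithinAt hW) hu
  obtain ⟨Z, V, hZ⟩ := exists_isFundamentalPair (continuousOn_matrix_mul hW' hinv)
  have hVW : ∀ t ∈ Icc (0 : ℝ) 1, V t * W t = W 0 := fun t ht => by
    have h := inverse_mul_eq_of_hasDerivWithinAt hZ.deriv_inv (Z := W) (fun t ht => by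
      rw [Matrix.mul_assoc, nonsing_inv_mul _ (hu t ht), Matrix.mul_one]; exact hW t ht) t ht
    rwa [hZ.zero_inv, Matrix.one_mul] at h
  have hinv_eq : ∀ t ∈ Icc (0 : ℝ) 1, (W t)⁻¹ = (W 0)⁻¹ * V t := fun t ht => by
    refine inv_eq_left_inv ?_
    rw [Matrix.mul_assoc, hVW t ht, nonsing_inv_mul _ (hu 0 h0)]
  intro t ht
  have h := hasDerivWithinAt_matrix_mul (hasDerivWithinAt_matrix_const (W 0)⁻¹)
    (hZ.deriv_inv t ht)
  rw [Matrix.zero_mul, zero_add, Matrix.mul_neg, ← Matrix.mul_assoc, ← Matrix.mul_assoc,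
    ← hinv_eq t ht] at h
  rw [hasDerivWithinAt_matrix_iff] at *
  exact fun i j => (h i j).congr (fun s hs => by rw [hinv_eq s hs]) (by rw [hinv_eq t ht])

/-- If `0 ≤ N ≤ M`, `M` is invertible and `K` is positive definite, then `1 - N (M⁻¹ - K)` is
invertible. -/
theorem isUnit_det_one_sub_mul {N M K : Matrix (Fin n) (Fin n) ℝ} (hNt : Nᵀ = N)
    (hM : IsUnit M.det) (hK : K.PosDef)
    (hN0 : ∀ w, 0 ≤ w ⬝ᵥ N *ᵥ w) (hNM : ∀ w, w ⬝ᵥ N *ᵥ w ≤ w ⬝ᵥ M *ᵥ w) :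
    IsUnit (1 - N * (M⁻¹ - K)).det := by
  rw [isUnit_iff_ne_zero]
  intro hdet
  obtain ⟨v, hv0, hv⟩ := exists_mulVec_eq_zero_iff.2 hdet
  apply hv0
  set w := (M⁻¹ - K) *ᵥ v with hw
  have hvN : v = N *ᵥ w := by
    rwa [sub_mulVec, one_mulVec, ← mulVec_mulVec, sub_eq_zero] at hv
  -- A kernel vector `v` satisfies `v = N w` with `w = y - K v`. Expanding the square, `0 ≤ (w -
  -- y)'N(w - y) = w'v - 2 y'v + y'N y ≤ (y'v - v'K v) - 2 y'v + y'v = -v'K v`, which forces `v =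
  -- 0`.
  set y := M⁻¹ *ᵥ v with hy
  have hMy : M *ᵥ y = v := by rw [hy, mulVec_mulVec, mul_nonsing_inv _ hM, one_mulVec]
  have hsymm : ∀ a b : Fin n → ℝ, a ⬝ᵥ N *ᵥ b = b ⬝ᵥ N *ᵥ a := fun a b => by
    rw [dotProduct_mulVec, ← mulVec_transpose, hNt, dotProduct_comm]
  have h1 : w ⬝ᵥ N *ᵥ w = v ⬝ᵥ y - v ⬝ᵥ K *ᵥ v := by
    rw [← hvN, hw, sub_mulVec, sub_dotProduct, dotProduct_comm, dotProduct_comm _ v]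
  have h2 := hN0 (w - y)
  have h3 := hNM y
  rw [hMy] at h3
  have h4 : (w - y) ⬝ᵥ N *ᵥ (w - y) = w ⬝ᵥ N *ᵥ w - 2 * (y ⬝ᵥ v) + y ⬝ᵥ N *ᵥ y := by
    rw [mulVec_sub, sub_dotProduct, dotProduct_sub, dotProduct_sub, hsymm w y, ← hvN]
    ring
  by_contra hne
  have h5 := hK.dotProduct_mulVec_pos hne
  rw [star_trivial] at h5
  rw [dotProduct_comm y v] at h3 h4
  linarith

variable {A X Y P : ℝ → Matrix (Fin n) (Fin n) ℝ} {B : ℝ → Matrix (Fin n) (Fin p) ℝ}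
  {S₀ S₁ : Matrix (Fin n) (Fin n) ℝ}

theorem isUnit_det_one_sub_initialGramian_mul (hA : IsFundamentalPair A X Y)
    (hB : ContinuousOn B (Icc 0 1)) (hAB : IsControllable A B) (hS₀ : S₀.PosDef) (hS₁ : S₁.PosDef) :
    ∀ t ∈ Icc (0 : ℝ) 1,
      IsUnit (1 - initialGramian Y B t * riccatiInitial A B S₀ S₁).det := fun t ht => by
  rw [riccatiInitial_eq hA hB hS₀]
  exact isUnit_det_one_sub_mul (transpose_initialGramian t) (isUnit_det_initialGramian hA hB hAB)
    (posDef_scaledRoot hA hB hAB hS₀ hS₁)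
    (fun w => dotProduct_initialGramian_nonneg hA.continuousOn_inv hB w ht)
    fun w => dotProduct_initialGramian_monotoneOn hA.continuousOn_inv hB w ht
      (right_mem_Icc.2 zero_le_one) ht.2

theorem hasDerivWithinAt_one_sub_initialGramian_mul (hY : ContinuousOn Y (Icc 0 1))
    (hB : ContinuousOn B (Icc 0 1)) (Q : Matrix (Fin n) (Fin n) ℝ) :
    ∀ t ∈ Icc (0 : ℝ) 1, HasDerivWithinAt (fun t => 1 - initialGramian Y B t * Q)
      (-(Y t * B t * (Y t * B t)ᵀ * Q)) (Icc 0 1) t := fun t ht => by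
  have h := hasDerivWithinAt_matrix_sub (hasDerivWithinAt_matrix_const 1)
    (hasDerivWithinAt_matrix_mul (hasDerivWithinAt_initialGramian hY hB t ht)
      (hasDerivWithinAt_matrix_const Q))
  simpa only [Matrix.mul_zero, add_zero, zero_sub] using h

/-- The solution is costate times inverse state of the linear Hamiltonian system, `(Y'Q)(X W)⁻¹ = Y'
Q W⁻¹ Y` with `W = 1 - N Q`; invertibility of `W` rules out blow-up. -/
theorem exists_isRiccatiSolution (hA : IsFundamentalPair A X Y)
    (hB : ContinuousOn B (Icc 0 1)) (hAB : IsControllable A B) (hS₀ : S₀.PosDef) (hS₁ : S₁.PosDef) :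
    ∃ P, IsRiccatiSolution A B S₀ S₁ P := by
  set Q := riccatiInitial A B S₀ S₁ with hQ
  set W : ℝ → Matrix (Fin n) (Fin n) ℝ := fun t => 1 - initialGramian Y B t * Q with hWdef
  have hYc := hA.continuousOn_inv
  have hW := hasDerivWithinAt_one_sub_initialGramian_mul hYc hB Q
  have hW' : ContinuousOn (fun t => -(Y t * B t * (Y t * B t)ᵀ * Q)) (Icc 0 1) := by
    have h := continuousOn_matrix_iff.1 <| continuousOn_matrix_mul
      (continuousOn_initialGramian_integrand hYc hB) (continuousOn_const (c := Q))
    exact continuousOn_matrix_iff.2 fun i j => (h i j).neg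
  have hinv := hasDerivWithinAt_matrix_inv hW hW'
    (isUnit_det_one_sub_initialGramian_mul hA hB hAB hS₀ hS₁)
  refine ⟨fun t => (Y t)ᵀ * (Q * ((W t)⁻¹ * Y t)), ?_, fun t ht => ?_⟩
  · simp [hWdef, initialGramian_zero, hA.zero_inv, hQ]
  · have h := hasDerivWithinAt_matrix_mul (hasDerivWithinAt_matrix_transpose (hA.deriv_inv t ht))
      (hasDerivWithinAt_matrix_mul (hasDerivWithinAt_matrix_const Q)
        (hasDerivWithinAt_matrix_mul (hinv t ht) (hA.deriv_inv t ht)))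
    convert h using 1
    simp only [hWdef, transpose_neg, transpose_mul, Matrix.mul_assoc, Matrix.neg_mul,
      Matrix.mul_neg, neg_neg, Matrix.zero_mul, zero_add, Matrix.mul_add]
    abel

theorem IsRiccatiSolution.continuousOn (hP : IsRiccatiSolution A B S₀ S₁ P) :
    ContinuousOn P (Icc 0 1) :=
  continuousOn_of_hasDerivWithinAt hP.2

theorem continuousOn_closedLoop (hA : ContinuousOn A (Icc 0 1)) (hB : ContinuousOn B (Icc 0 1))
    (hP : ContinuousOn P (Icc 0 1)) : ContinuousOn (closedLoop A B P) (Icc 0 1) := by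
  have h := continuousOn_matrix_iff.1 <| continuousOn_matrix_mul
    (continuousOn_matrix_mul hB (continuousOn_matrix_transpose hB)) hP
  rw [continuousOn_matrix_iff] at *
  exact fun i j => (hA i j).sub (h i j)

/-- The adjoint variable along the closed loop. -/
theorem IsRiccatiSolution.mul_closedLoop_eq (hA : IsFundamentalPair A X Y)
    (hP : IsRiccatiSolution A B S₀ S₁ P) {Z V : ℝ → Matrix (Fin n) (Fin n) ℝ}
    (hZ : IsFundamentalPair (closedLoop A B P) Z V) :
    ∀ t ∈ Icc (0 : ℝ) 1, P t * Z t = (Y t)ᵀ * riccatiInitial A B S₀ S₁ := fun t ht => by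
  have hX : ∀ t ∈ Icc (0 : ℝ) 1,
      HasDerivWithinAt (fun t => (X t)ᵀ) (-((X t)ᵀ * -(A t)ᵀ)) (Icc 0 1) t := fun t ht => by
    simpa only [transpose_mul, Matrix.mul_neg, neg_neg] using
      hasDerivWithinAt_matrix_transpose (hA.deriv t ht)
  -- By the Riccati equation `P Z` solves the adjoint equation `λ̇ = -A'λ`, for which `X'` is the
  -- inverse fundamental matrix.
  have h := inverse_mul_eq_of_hasDerivWithinAt (A := fun t => -(A t)ᵀ) hX
    (Z := fun t => P t * Z t) (fun t ht => by
      convert hasDerivWithinAt_matrix_mul (hP.2 t ht) (hZ.deriv t ht) using 1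
      simp only [closedLoop, Matrix.add_mul, Matrix.sub_mul, Matrix.neg_mul, Matrix.mul_sub,
        Matrix.mul_assoc]
      abel) t ht
  have hYX : (Y t)ᵀ * (X t)ᵀ = 1 := by rw [← transpose_mul, hA.mul_inv t ht, transpose_one]
  rw [hA.zero, hZ.zero, hP.1, transpose_one, Matrix.one_mul, Matrix.mul_one] at h
  rw [← h, ← Matrix.mul_assoc, hYX, Matrix.one_mul]

/-- Since `P Z = Y'Q`, the derivative of `Y Z` is `-Y B B' Y' Q`, the same as that of `1 - N Q`. -/
theorem IsRiccatiSolution.closedLoop_fundamental_eq (hA : IsFundamentalPair A X Y)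
    (hB : ContinuousOn B (Icc 0 1))
    (hP : IsRiccatiSolution A B S₀ S₁ P) {Z V : ℝ → Matrix (Fin n) (Fin n) ℝ}
    (hZ : IsFundamentalPair (closedLoop A B P) Z V) :
    ∀ t ∈ Icc (0 : ℝ) 1,
      Z t = X t * (1 - initialGramian Y B t * riccatiInitial A B S₀ S₁) := fun t ht => by
  set Q := riccatiInitial A B S₀ S₁ with hQ
  have h := matrix_eq_initial_of_hasDerivWithinAt_zero
    (M := fun t => Y t * Z t - (1 - initialGramian Y B t * Q)) (fun t ht => by
      convert hasDerivWithinAt_matrix_sub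
        (hasDerivWithinAt_matrix_mul (hA.deriv_inv t ht) (hZ.deriv t ht))
        (hasDerivWithinAt_one_sub_initialGramian_mul hA.continuousOn_inv hB Q t ht) using 1
      have hPZ := hP.mul_closedLoop_eq hA hZ t ht
      simp only [closedLoop, transpose_mul, Matrix.sub_mul, Matrix.neg_mul, Matrix.mul_sub,
        Matrix.mul_assoc, hPZ, ← hQ]
      abel) t ht
  simp only [hA.zero_inv, hZ.zero, initialGramian_zero, Matrix.zero_mul, sub_zero, Matrix.mul_one,
    sub_self, sub_eq_zero] at h
  rw [← h, ← Matrix.mul_assoc, hA.mul_inv t ht, Matrix.one_mul]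

/-- With `W = 1 - N Q`, the bracket is `Q - N⁻¹ = -N⁻¹ W`, with inverse `-W⁻¹ N`. The closed form
becomes `-Y'N⁻¹Y + Y'N⁻¹W⁻¹Y`, and `N⁻¹ W⁻¹ = N⁻¹ + Q W⁻¹` reduces it to `Y'Q W⁻¹Y`, which is `P`.
-/
theorem IsRiccatiSolution.eq_closedForm (hA : IsFundamentalPair A X Y)
    (hAc : ContinuousOn A (Icc 0 1)) (hB : ContinuousOn B (Icc 0 1)) (hS₀ : S₀.PosDef)
    (hP : IsRiccatiSolution A B S₀ S₁ P) {t : ℝ} (ht : t ∈ Icc (0 : ℝ) 1)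
    (hM : IsUnit (gramian A B t 0).det) :
    IsUnit (riccatiBracket A B S₀ S₁ t).det ∧ P t = riccatiClosedForm A B S₀ S₁ t := by
  obtain ⟨Z, V, hZ⟩ := exists_isFundamentalPair (continuousOn_closedLoop hAc hB hP.continuousOn)
  set Q := riccatiInitial A B S₀ S₁ with hQ
  set N := initialGramian Y B t with hN
  have hNu : IsUnit N.det := by
    rw [gramian_eq hA hB ht, det_mul, det_mul] at hM
    exact isUnit_of_mul_isUnit_right (isUnit_of_mul_isUnit_left hM)
  have hbr : riccatiBracket A B S₀ S₁ t = Q - N⁻¹ := by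
    rw [riccatiBracket, transitionMatrix_zero_eq hA ht, transpose_mul_gramian_inv_mul hA hB ht,
      phi10_eq hA, gram10, transpose_mul_gramian_inv_mul hA hB (right_mem_Icc.2 zero_le_one), hQ,
      riccatiInitial_eq hA hB hS₀, scaledRoot]
  have hW : Y t * Z t = 1 - N * Q := by
    rw [hP.closedLoop_fundamental_eq hA hB hZ t ht, ← Matrix.mul_assoc, hA.inv_mul t ht,
      Matrix.one_mul]
  have hR : Q - N⁻¹ = -(N⁻¹ * (Y t * Z t)) := by
    rw [hW, Matrix.mul_sub, nonsing_inv_mul_cancel_left _ _ hNu, Matrix.mul_one, neg_sub]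
  -- `V X` plays the role of `W⁻¹` from here on.
  have hVX : (V t * X t) * (Y t * Z t) = 1 := by
    rw [Matrix.mul_assoc, ← Matrix.mul_assoc (X t), hA.mul_inv t ht, Matrix.one_mul,
      hZ.inv_mul t ht]
  have hR1 : (Q - N⁻¹) * -(V t * X t * N) = 1 := by
    rw [hR, Matrix.neg_mul, Matrix.mul_neg, neg_neg, Matrix.mul_assoc,
      ← Matrix.mul_assoc (Y t * Z t),
      mul_eq_one_comm.1 hVX, Matrix.one_mul, nonsing_inv_mul _ hNu]
  refine ⟨hbr ▸ isUnit_det_of_right_inverse hR1, ?_⟩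
  have hPV : P t = (Y t)ᵀ * Q * V t := by
    rw [← hP.mul_closedLoop_eq hA hZ t ht, Matrix.mul_assoc, hZ.mul_inv t ht, Matrix.mul_one]
  have hXY : (X t)ᵀ * (Y t)ᵀ = 1 := by rw [← transpose_mul, hA.inv_mul t ht, transpose_one]
  have hNQ : N⁻¹ * (V t * X t * N) * N⁻¹ = N⁻¹ + Q * (V t * X t) := by
    have h2 : (Q - N⁻¹) * (V t * X t) = -N⁻¹ := by
      rw [hR, Matrix.neg_mul, Matrix.mul_assoc, mul_eq_one_comm.1 hVX, Matrix.mul_one]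
    rw [Matrix.sub_mul, sub_eq_iff_eq_add] at h2
    rw [h2, Matrix.mul_assoc, Matrix.mul_assoc (V t * X t), mul_nonsing_inv _ hNu, Matrix.mul_one]
    abel
  rw [riccatiClosedForm, hbr, inv_eq_right_inv hR1, transitionMatrix_zero_eq hA ht,
    gramian_inv hA hB ht, ← hN, hPV]
  have h1 : (Y t)ᵀ * N⁻¹ * Y t * X t * -(V t * X t * N) * (X t)ᵀ * ((Y t)ᵀ * N⁻¹ * Y t)
      = -((Y t)ᵀ * (N⁻¹ * (V t * X t * N) * N⁻¹) * Y t) := by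
    calc _ = -((Y t)ᵀ * N⁻¹ * (Y t * X t) * (V t * X t * N) * ((X t)ᵀ * (Y t)ᵀ) * N⁻¹ * Y t) := by
          simp only [Matrix.mul_assoc, Matrix.mul_neg, Matrix.neg_mul]
      _ = _ := by
          rw [hA.inv_mul t ht, hXY]
          simp only [Matrix.mul_assoc, Matrix.mul_one]
  rw [h1, hNQ, Matrix.mul_add, Matrix.add_mul, sub_neg_eq_add, neg_add_cancel_left]
  simp only [Matrix.mul_assoc, hA.mul_inv t ht, Matrix.mul_one]

/-- The closed loop transports the covariance `Σ₀` to `Σ₁`. -/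
theorem IsRiccatiSolution.conj_closedLoop_fundamental (hA : IsFundamentalPair A X Y)
    (hB : ContinuousOn B (Icc 0 1)) (hAB : IsControllable A B) (hS₀ : S₀.PosDef) (hS₁ : S₁.PosDef)
    (hP : IsRiccatiSolution A B S₀ S₁ P) {Z V : ℝ → Matrix (Fin n) (Fin n) ℝ}
    (hZ : IsFundamentalPair (closedLoop A B P) Z V) : Z 1 * S₀ * (Z 1)ᵀ = S₁ := by
  have h1 := right_mem_Icc.2 (zero_le_one (α := ℝ))
  set N := initialGramian Y B 1 with hN
  set K := scaledRoot A B S₀ S₁ with hK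
  have hNu : IsUnit N.det := isUnit_det_initialGramian hA hB hAB
  -- At time `1` the summand `N⁻¹` of the initial value cancels the identity in `1 - N Q`.
  have hZ1 : Z 1 = X 1 * N * K := by
    rw [hP.closedLoop_fundamental_eq hA hB hZ 1 h1, riccatiInitial_eq hA hB hS₀, ← hN,
      ← hK, Matrix.mul_sub N, mul_nonsing_inv _ hNu, sub_sub_cancel, Matrix.mul_assoc]
  have hXY : (X 1)ᵀ * (Y 1)ᵀ = 1 := by rw [← transpose_mul, hA.inv_mul 1 h1, transpose_one]
  have hYXt : (Y 1)ᵀ * (X 1)ᵀ = 1 := by rw [← transpose_mul, hA.mul_inv 1 h1, transpose_one]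
  have hKK := scaledRoot_mul_mul_scaledRoot hA hB hAB hS₀ hS₁
  rw [gramian_inv hA hB h1, ← hK] at hKK
  rw [hZ1, transpose_mul, transpose_mul, posDef_transpose_eq (posDef_scaledRoot hA hB hAB hS₀ hS₁),
    transpose_initialGramian]
  calc X 1 * N * K * S₀ * (K * (N * (X 1)ᵀ)) = X 1 * N * (K * S₀ * K) * N * (X 1)ᵀ := by
        simp only [Matrix.mul_assoc]
    _ = X 1 * N * ((X 1)ᵀ * (Y 1)ᵀ) * N⁻¹ * Y 1 * S₁ * (Y 1)ᵀ * N⁻¹ * (Y 1 * X 1) * N * (X 1)ᵀ := by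
        rw [hKK]; simp only [Matrix.mul_assoc, ← hN]
    _ = _ := by
        rw [hXY, hA.inv_mul 1 h1]
        simp only [Matrix.mul_assoc, mul_nonsing_inv_cancel_left _ _ hNu,
          nonsing_inv_mul_cancel_left _ _ hNu, hYXt, Matrix.mul_one]
        rw [← Matrix.mul_assoc, hA.mul_inv 1 h1, Matrix.one_mul]

/-- The congruent matrix `Z'P Z = (1 - Q N) Q = Q - Q N Q` is visibly symmetric, and `Z` is
invertible. -/
theorem IsRiccatiSolution.transpose_eq (hA : IsFundamentalPair A X Y)
    (hAc : ContinuousOn A (Icc 0 1)) (hB : ContinuousOn B (Icc 0 1))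
    (hAB : IsControllable A B) (hS₀ : S₀.PosDef) (hS₁ : S₁.PosDef)
    (hP : IsRiccatiSolution A B S₀ S₁ P) : ∀ t ∈ Icc (0 : ℝ) 1, (P t)ᵀ = P t := fun t ht => by
  obtain ⟨Z, V, hZ⟩ := exists_isFundamentalPair (continuousOn_closedLoop hAc hB hP.continuousOn)
  set Q := riccatiInitial A B S₀ S₁ with hQ
  have hQt : Qᵀ = Q := transpose_riccatiInitial hA hB hAB hS₀ hS₁
  set N := initialGramian Y B t with hN
  have hNt : Nᵀ = N := transpose_initialGramian t
  have hPZ := hP.mul_closedLoop_eq hA hZ t ht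
  have hXY : (X t)ᵀ * (Y t)ᵀ = 1 := by rw [← transpose_mul, hA.inv_mul t ht, transpose_one]
  have hsymm : ((Z t)ᵀ * (P t * Z t))ᵀ = (Z t)ᵀ * (P t * Z t) := by
    rw [hPZ, hP.closedLoop_fundamental_eq hA hB hZ t ht, ← hQ, ← hN]
    have : (X t * (1 - N * Q))ᵀ * ((Y t)ᵀ * Q) = Q - Q * N * Q := by
      rw [transpose_mul, Matrix.mul_assoc, ← Matrix.mul_assoc (X t)ᵀ, hXY, Matrix.one_mul,
        transpose_sub, transpose_mul, hQt, hNt, transpose_one, Matrix.sub_mul, Matrix.one_mul]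
    rw [this, transpose_sub, transpose_mul, transpose_mul, hQt, hNt, Matrix.mul_assoc]
  have hVZ : (V t)ᵀ * (Z t)ᵀ = 1 := by rw [← transpose_mul, hZ.mul_inv t ht, transpose_one]
  have key : ∀ R, (V t)ᵀ * ((Z t)ᵀ * (R * Z t)) * V t = R := fun R => by
    rw [← Matrix.mul_assoc, hVZ, Matrix.one_mul, Matrix.mul_assoc, hZ.mul_inv t ht, Matrix.mul_one]
  rw [transpose_mul, transpose_mul, transpose_transpose, Matrix.mul_assoc] at hsymm
  rw [← key (P t)ᵀ, hsymm, key]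

end Riccati

end OMTwpd

end

noncomputable section

namespace OMTwpd

variable {n p : ℕ}

/-! ### Gaussian measures: affine images and second moments. -/

section Gaussian

theorem inner_eq_dotProduct (x y : EuclideanSpace ℝ (Fin n)) :
    inner ℝ x y = x.ofLp ⬝ᵥ y.ofLp := by
  rw [EuclideanSpace.inner_eq_star_dotProduct, star_trivial, dotProduct_comm]

theorem continuous_gaussianDensity (m : EuclideanSpace ℝ (Fin n)) (S : Matrix (Fin n) (Fin n) ℝ) :
    Continuous (gaussianDensity m S) := by
  unfold gaussianDensity
  have h : Continuous (S⁻¹.toEuclideanLin) := LinearMap.continuous_of_finiteDimensional _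
  fun_prop

theorem gaussianDensity_nonneg (m : EuclideanSpace ℝ (Fin n)) (S : Matrix (Fin n) (Fin n) ℝ)
    (x : EuclideanSpace ℝ (Fin n)) : 0 ≤ gaussianDensity m S x := by
  unfold gaussianDensity
  positivity

/-- The normal distribution with mean `m` and covariance `S`. -/
def gaussianMeasure (m : EuclideanSpace ℝ (Fin n)) (S : Matrix (Fin n) (Fin n) ℝ) :
    Measure (EuclideanSpace ℝ (Fin n)) :=
  volume.withDensity fun x => ENNReal.ofReal (gaussianDensity m S x)

/-- The quadratic form in the exponent is invariant, and `det (Z S Z') = (det Z)² det S` supplies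
the Jacobian. -/
theorem gaussianDensity_affine (m b : EuclideanSpace ℝ (Fin n)) {S Z : Matrix (Fin n) (Fin n) ℝ}
    (hZ : IsUnit Z.det) (x : EuclideanSpace ℝ (Fin n)) :
    gaussianDensity m S x = |Z.det| *
      gaussianDensity (Z.toEuclideanLin m + b) (Z * S * Zᵀ) (Z.toEuclideanLin x + b) := by
  have hdet : (2 * Real.pi) ^ n * (Z * S * Zᵀ).det = Z.det ^ 2 * ((2 * Real.pi) ^ n * S.det) := by
    rw [det_mul, det_mul, det_transpose]; ring
  have hZt : IsUnit (Zᵀ).det := by rwa [det_transpose]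
  have hexp : inner ℝ (Z.toEuclideanLin x + b - (Z.toEuclideanLin m + b))
      ((Z * S * Zᵀ)⁻¹.toEuclideanLin (Z.toEuclideanLin x + b - (Z.toEuclideanLin m + b)))
      = inner ℝ (x - m) (S⁻¹.toEuclideanLin (x - m)) := by
    rw [add_sub_add_right_eq_sub, ← map_sub, inner_eq_dotProduct, inner_eq_dotProduct]
    simp only [toLpLin_apply, mulVec_mulVec]
    rw [dotProduct_comm, dotProduct_mulVec, ← mulVec_transpose, mulVec_mulVec, dotProduct_comm]
    congr 2
    rw [Matrix.mul_inv_rev, Matrix.mul_inv_rev]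
    simp only [Matrix.mul_assoc, nonsing_inv_mul _ hZ, Matrix.mul_one]
    rw [← Matrix.mul_assoc, mul_nonsing_inv _ hZt, Matrix.one_mul]
  rw [gaussianDensity, gaussianDensity, hdet, hexp, Real.sqrt_mul (sq_nonneg _),
    Real.sqrt_sq_eq_abs,
    mul_inv, ← mul_assoc, ← mul_assoc, mul_inv_cancel₀ (abs_ne_zero.2 hZ.ne_zero), one_mul]

theorem continuous_affine (Z : Matrix (Fin n) (Fin n) ℝ) (b : EuclideanSpace ℝ (Fin n)) :
    Continuous fun x => Z.toEuclideanLin x + b :=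
  (LinearMap.continuous_of_finiteDimensional _).add continuous_const

theorem map_gaussianMeasure_affine (m b : EuclideanSpace ℝ (Fin n))
    {S Z : Matrix (Fin n) (Fin n) ℝ} (hZ : IsUnit Z.det) :
    (gaussianMeasure m S).map (fun x => Z.toEuclideanLin x + b)
      = gaussianMeasure (Z.toEuclideanLin m + b) (Z * S * Zᵀ) := by
  have hT := (continuous_affine Z b).measurable
  have hdet : LinearMap.det Z.toEuclideanLin = Z.det := LinearMap.det_toLpLin 2 Z
  have hvol : (volume : Measure (EuclideanSpace ℝ (Fin n))).map (fun x => Z.toEuclideanLin x + b)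
      = ENNReal.ofReal |Z.det⁻¹| • volume := by
    have h1 : (fun x => Z.toEuclideanLin x + b) = (fun x => x + b) ∘ Z.toEuclideanLin := rfl
    rw [h1, ← Measure.map_map (measurable_add_const b)
      (LinearMap.continuous_of_finiteDimensional _).measurable,
      Measure.map_linearMap_addHaar_eq_smul_addHaar _ (by rw [hdet]; exact hZ.ne_zero), hdet,
      Measure.map_smul, map_add_right_eq_self]
  ext s hs
  have hmeas : Measurable fun y => ENNReal.ofReal
      (gaussianDensity (Z.toEuclideanLin m + b) (Z * S * Zᵀ) y) :=
    (continuous_gaussianDensity _ _).measurable.ennreal_ofReal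
  rw [Measure.map_apply hT hs, gaussianMeasure, gaussianMeasure, withDensity_apply _ (hT hs),
    withDensity_apply _ hs]
  simp_rw [gaussianDensity_affine m b hZ, ENNReal.ofReal_mul (abs_nonneg _)]
  have h2 := setLIntegral_map (μ := volume) hs hmeas hT
  rw [lintegral_const_mul _ (by exact hmeas.comp hT), ← h2, hvol,
    Measure.restrict_smul, lintegral_smul_measure, smul_eq_mul, ← mul_assoc,
    ← ENNReal.ofReal_mul (abs_nonneg _), ← abs_mul, mul_inv_cancel₀ hZ.ne_zero, abs_one,
    ENNReal.ofReal_one, one_mul]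

theorem integrable_norm_sq_standardGaussian :
    Integrable (fun x => 1 + ‖x‖ ^ 2) (gaussianMeasure (0 : EuclideanSpace ℝ (Fin n)) 1) := by
  have hmeas : Measurable fun x => ENNReal.ofReal
      (gaussianDensity (0 : EuclideanSpace ℝ (Fin n)) 1 x) :=
    (continuous_gaussianDensity _ _).measurable.ennreal_ofReal
  rw [gaussianMeasure, integrable_withDensity_iff_integrable_smul' hmeas (by simp)]
  -- Half of the exponent `‖x‖²/2` absorbs the weight, since `1 + ‖x‖² ≤ 4 exp (‖x‖²/4)`; the other
  -- half remains integrable.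
  have h1 := (GaussianFourier.integrable_cexp_neg_mul_sq_norm_add (V := EuclideanSpace ℝ (Fin n))
    (b := ((1 / 4 : ℝ) : ℂ)) (by simp) 0 0).norm.const_mul
    ((Real.sqrt ((2 * Real.pi) ^ n * 1))⁻¹ * 4)
  refine h1.mono' ?_ (.of_forall fun x => ?_)
  · exact (hmeas.ennreal_toReal.smul (by fun_prop)).aestronglyMeasurable
  · rw [ENNReal.toReal_ofReal (gaussianDensity_nonneg _ _ _), norm_smul, Real.norm_of_nonneg
      (gaussianDensity_nonneg _ _ _), Real.norm_of_nonneg (by positivity), gaussianDensity]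
    have h2 : (-((1 / 4 : ℝ) : ℂ) * (‖x‖ : ℂ) ^ 2 + 0 * ((inner ℝ 0 x : ℝ) : ℂ))
        = ((-(1 / 4) * ‖x‖ ^ 2 : ℝ) : ℂ) := by push_cast; ring
    rw [h2, Complex.norm_exp_ofReal]
    simp only [det_one, inv_one, sub_zero, toLpLin_one, LinearMap.id_apply,
      real_inner_self_eq_norm_sq]
    have h3 : 1 + ‖x‖ ^ 2 ≤ 4 * Real.exp (1 / 4 * ‖x‖ ^ 2) := by
      nlinarith [Real.add_one_le_exp (1 / 4 * ‖x‖ ^ 2), sq_nonneg ‖x‖]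
    have h4 : Real.exp (-(1 / 4) * ‖x‖ ^ 2)
        = Real.exp (1 / 4 * ‖x‖ ^ 2) * Real.exp (-(1 / 2) * ‖x‖ ^ 2) := by
      rw [← Real.exp_add]; ring_nf
    rw [h4, mul_assoc, mul_assoc]
    refine mul_le_mul_of_nonneg_left ?_ (by positivity)
    rw [mul_comm, ← mul_assoc]
    exact mul_le_mul_of_nonneg_right h3 (Real.exp_nonneg _)

theorem integrable_norm_sq_affine {γ : Measure (EuclideanSpace ℝ (Fin n))}
    (hγ : Integrable (fun x => 1 + ‖x‖ ^ 2) γ) (Z : Matrix (Fin n) (Fin n) ℝ)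
    (b : EuclideanSpace ℝ (Fin n)) :
    Integrable (fun x => 1 + ‖x‖ ^ 2) (γ.map fun x => Z.toEuclideanLin x + b) := by
  have hT := continuous_affine Z b
  rw [integrable_map_measure (by fun_prop) hT.measurable.aemeasurable]
  set L := LinearMap.toContinuousLinearMap Z.toEuclideanLin with hL
  refine (hγ.const_mul (1 + 2 * ‖L‖ ^ 2 + 2 * ‖b‖ ^ 2)).mono' ?_ (.of_forall fun x => ?_)
  · exact (continuous_const.add (hT.norm.pow 2)).aestronglyMeasurable
  · have h1 : ‖Z.toEuclideanLin x + b‖ ≤ ‖L‖ * ‖x‖ + ‖b‖ :=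
      (norm_add_le _ _).trans (by gcongr; exact L.le_opNorm x)
    have h2 : ‖Z.toEuclideanLin x + b‖ ^ 2 ≤ 2 * (‖L‖ ^ 2 * ‖x‖ ^ 2) + 2 * ‖b‖ ^ 2 := by
      have := pow_le_pow_left₀ (norm_nonneg _) h1 2
      nlinarith [sq_nonneg (‖L‖ * ‖x‖ - ‖b‖)]
    simp only [Function.comp_apply]
    rw [Real.norm_of_nonneg (by positivity)]
    nlinarith [mul_nonneg (sq_nonneg ‖b‖) (sq_nonneg ‖x‖), sq_nonneg ‖L‖, sq_nonneg ‖x‖,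
      mul_nonneg (sq_nonneg ‖L‖) (sq_nonneg ‖x‖)]

/-- `N(m, S)` is the image of the standard normal law under `x ↦ S^{1/2} x + m`. -/
theorem integrable_norm_sq_gaussianMeasure (m : EuclideanSpace ℝ (Fin n))
    {S : Matrix (Fin n) (Fin n) ℝ} (hS : S.PosDef) :
    Integrable (fun x => 1 + ‖x‖ ^ 2) (gaussianMeasure m S) := by
  have hR : IsUnit (CFC.sqrt S).det := (isUnit_iff_isUnit_det _).1 (posDef_sqrt hS).isUnit
  have h := integrable_norm_sq_affine integrable_norm_sq_standardGaussian (CFC.sqrt S) m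
  rwa [map_gaussianMeasure_affine 0 m hR, map_zero, zero_add, Matrix.mul_one,
    posDef_transpose_eq (posDef_sqrt hS), sqrt_mul_sqrt hS] at h

theorem isFiniteMeasure_of_integrable_one_add {E : Type*} [NormedAddCommGroup E]
    [MeasurableSpace E] [OpensMeasurableSpace E] {γ : Measure E}
    (h : Integrable (fun x => 1 + ‖x‖ ^ 2) γ) : IsFiniteMeasure γ := by
  have h1 : Integrable (fun _ => (1 : ℝ)) γ := h.mono' aestronglyMeasurable_const <|
    .of_forall fun x => by rw [norm_one]; nlinarith [sq_nonneg ‖x‖]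
  exact (integrable_const_iff_isFiniteMeasure one_ne_zero).1 h1

end Gaussian

end OMTwpd

end

noncomputable section

namespace OMTwpd

/-! ### Weak flows and test functions `a(t) φ(x)` with `φ` compactly supported. -/

section WeakFlow

variable {n : ℕ}

/-- `ν` is a finite measure on `[0,1] × ℝⁿ` that is transported weakly along the velocity field `v`
from `γ₀` to `γ₁`. The velocity has at most linear growth up to a square integrable term `g`. -/
structure IsWeakFlow (v : ℝ × EuclideanSpace ℝ (Fin n) → EuclideanSpace ℝ (Fin n))
    (g : ℝ × EuclideanSpace ℝ (Fin n) → ℝ) (C : ℝ) (ν : Measure (ℝ × EuclideanSpace ℝ (Fin n)))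
    (γ₀ γ₁ : Measure (EuclideanSpace ℝ (Fin n))) : Prop where
  finite : IsFiniteMeasure ν
  finite_initial : IsFiniteMeasure γ₀
  finite_final : IsFiniteMeasure γ₁
  time_mem : ∀ᵐ z ∂ν, z.1 ∈ Icc (0 : ℝ) 1
  aestronglyMeasurable : AEStronglyMeasurable v ν
  const_nonneg : 0 ≤ C
  memLp : MemLp g 2 ν
  nonneg : ∀ z, 0 ≤ g z
  growth : ∀ᵐ z ∂ν, ‖v z‖ ≤ C * (‖z.2‖ + g z)
  weak : ∀ f : ℝ → EuclideanSpace ℝ (Fin n) → ℝ, ContDiff ℝ ∞ (Function.uncurry f) →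
    HasCompactSupport (Function.uncurry f) →
    ∫ z, (deriv (fun s => f s z.2) z.1 + fderiv ℝ (f z.1) z.2 (v z)) ∂ν
      = (∫ x, f 1 x ∂γ₁) - ∫ x, f 0 x ∂γ₀

/-- The derivative of `a(t) φ(x)` along the velocity field `v`, where `a'` is the derivative of
`a`. -/
def transportDeriv (v : ℝ × EuclideanSpace ℝ (Fin n) → EuclideanSpace ℝ (Fin n)) (a a' : ℝ → ℝ)
    (φ : EuclideanSpace ℝ (Fin n) → ℝ) (z : ℝ × EuclideanSpace ℝ (Fin n)) : ℝ :=
  a' z.1 * φ z.2 + a z.1 * fderiv ℝ φ z.2 (v z)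

variable {v : ℝ × EuclideanSpace ℝ (Fin n) → EuclideanSpace ℝ (Fin n)}
  {g : ℝ × EuclideanSpace ℝ (Fin n) → ℝ} {C : ℝ} {ν : Measure (ℝ × EuclideanSpace ℝ (Fin n))}
  {γ₀ γ₁ : Measure (EuclideanSpace ℝ (Fin n))}

namespace IsWeakFlow

theorem aestronglyMeasurable_time (h : IsWeakFlow v g C ν γ₀ γ₁) {a : ℝ → ℝ}
    (ha : ContinuousOn a (Icc 0 1)) : AEStronglyMeasurable (fun z => a z.1) ν := by
  have hc : Continuous (IccExtend (zero_le_one (α := ℝ)) ((Icc 0 1).domRestrict a)) :=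
    (continuousOn_iff_continuous_domRestrict.1 ha).Icc_extend'
  refine (hc.comp continuous_fst).aestronglyMeasurable.congr ?_
  filter_upwards [h.time_mem] with z hz
  rw [Function.comp_apply, IccExtend_of_mem _ _ hz]
  rfl

theorem aestronglyMeasurable_fderiv_apply (h : IsWeakFlow v g C ν γ₀ γ₁)
    {φ : EuclideanSpace ℝ (Fin n) → ℝ}
    (hφ : ContDiff ℝ ∞ φ) : AEStronglyMeasurable (fun z => fderiv ℝ φ z.2 (v z)) ν := by
  have h1 : AEStronglyMeasurable (fun z : ℝ × EuclideanSpace ℝ (Fin n) => fderiv ℝ φ z.2) ν :=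
    ((hφ.continuous_fderiv (by simp)).comp continuous_snd).aestronglyMeasurable
  exact isBoundedBilinearMap_apply.continuous.comp_aestronglyMeasurable
    (h1.prodMk h.aestronglyMeasurable)

theorem aestronglyMeasurable_transportDeriv (h : IsWeakFlow v g C ν γ₀ γ₁) {a a' : ℝ → ℝ}
    (ha : ContinuousOn a (Icc 0 1)) (ha' : ContinuousOn a' (Icc 0 1))
    {φ : EuclideanSpace ℝ (Fin n) → ℝ}
    (hφ : ContDiff ℝ ∞ φ) : AEStronglyMeasurable (transportDeriv v a a' φ) ν :=
  ((h.aestronglyMeasurable_time ha').mul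
    (hφ.continuous.comp continuous_snd).aestronglyMeasurable).add
    ((h.aestronglyMeasurable_time ha).mul (h.aestronglyMeasurable_fderiv_apply hφ))

theorem exists_bound_of_continuousOn {a : ℝ → ℝ} (ha : ContinuousOn a (Icc 0 1)) :
    ∃ K, 0 ≤ K ∧ ∀ t ∈ Icc (0 : ℝ) 1, |a t| ≤ K := by
  obtain ⟨K, hK⟩ := isCompact_Icc.exists_bound_of_continuousOn ha
  exact ⟨max K 0, le_max_right _ _, fun t ht => (hK t ht).trans (le_max_left _ _)⟩

theorem abs_fderiv_apply_le (h : IsWeakFlow v g C ν γ₀ γ₁) (φ : EuclideanSpace ℝ (Fin n) → ℝ) :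
    ∀ᵐ z ∂ν, |fderiv ℝ φ z.2 (v z)| ≤ C * (‖fderiv ℝ φ z.2‖ * (‖z.2‖ + g z)) := by
  filter_upwards [h.growth] with z hz
  calc _ ≤ ‖fderiv ℝ φ z.2‖ * ‖v z‖ := (fderiv ℝ φ z.2).le_opNorm _
    _ ≤ ‖fderiv ℝ φ z.2‖ * (C * (‖z.2‖ + g z)) := by gcongr
    _ = _ := by ring

theorem integrable_fderiv_apply (h : IsWeakFlow v g C ν γ₀ γ₁) {φ : EuclideanSpace ℝ (Fin n) → ℝ}
    (hφ : ContDiff ℝ ∞ φ)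
    (h2 : Integrable (fun z => ‖fderiv ℝ φ z.2‖ * (‖z.2‖ + g z)) ν) :
    Integrable (fun z => fderiv ℝ φ z.2 (v z)) ν :=
  (h2.const_mul C).mono' (h.aestronglyMeasurable_fderiv_apply hφ) (h.abs_fderiv_apply_le φ)

theorem integrable_transportDeriv (h : IsWeakFlow v g C ν γ₀ γ₁) {a a' : ℝ → ℝ}
    (ha : ContinuousOn a (Icc 0 1)) (ha' : ContinuousOn a' (Icc 0 1))
    {φ : EuclideanSpace ℝ (Fin n) → ℝ}
    (hφ : ContDiff ℝ ∞ φ) (h1 : Integrable (fun z => φ z.2) ν)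
    (h2 : Integrable (fun z => ‖fderiv ℝ φ z.2‖ * (‖z.2‖ + g z)) ν) :
    Integrable (transportDeriv v a a' φ) ν := by
  obtain ⟨K, hK0, hK⟩ := exists_bound_of_continuousOn ha
  obtain ⟨K', hK0', hK'⟩ := exists_bound_of_continuousOn ha'
  refine ((h1.norm.const_mul K').add ((h.integrable_fderiv_apply hφ h2).norm.const_mul K)).mono'
    (h.aestronglyMeasurable_transportDeriv ha ha' hφ) ?_
  filter_upwards [h.time_mem] with z hz
  refine (norm_add_le _ _).trans (add_le_add ?_ ?_) <;> rw [norm_mul]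
  · exact mul_le_mul_of_nonneg_right (hK' _ hz) (norm_nonneg _)
  · exact mul_le_mul_of_nonneg_right (hK _ hz) (norm_nonneg _)

theorem integrable_of_bounded (h : IsWeakFlow v g C ν γ₀ γ₁) {φ : EuclideanSpace ℝ (Fin n) → ℝ}
    (hφ : Continuous φ)
    {K : ℝ} (hK : ∀ x, |φ x| ≤ K) : Integrable (fun z => φ z.2) ν := by
  have := h.finite
  exact (integrable_const K).mono' (hφ.comp continuous_snd).aestronglyMeasurable
    (.of_forall fun z => hK z.2)

theorem integrable_weight (h : IsWeakFlow v g C ν γ₀ γ₁) : Integrable g ν := by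
  have := h.finite
  exact h.memLp.integrable (by norm_num)

theorem integrable_norm_fderiv_of_hasCompactSupport (h : IsWeakFlow v g C ν γ₀ γ₁)
    {φ : EuclideanSpace ℝ (Fin n) → ℝ}
    (hφ : ContDiff ℝ ∞ φ) (hφc : HasCompactSupport φ) :
    Integrable (fun z => ‖fderiv ℝ φ z.2‖ * (‖z.2‖ + g z)) ν := by
  have := h.finite
  have hcont : Continuous fun x => ‖fderiv ℝ φ x‖ := (hφ.continuous_fderiv (by simp)).norm
  have hcs : HasCompactSupport fun x => ‖fderiv ℝ φ x‖ := (hφc.fderiv ℝ).norm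
  obtain ⟨K, hK⟩ := hcs.exists_bound_of_continuous hcont
  obtain ⟨L, hL⟩ := (hcs.mul_right (f' := fun x => ‖x‖)).exists_bound_of_continuous
    (hcont.mul continuous_norm)
  refine ((integrable_const L).add (h.integrable_weight.const_mul K)).mono' ?_
    (.of_forall fun z => ?_)
  · exact (hcont.comp continuous_snd).aestronglyMeasurable.mul
      (continuous_snd.norm.aestronglyMeasurable.add h.integrable_weight.1)
  · rw [mul_add]
    refine (norm_add_le _ _).trans (add_le_add (hL z.2) ?_)
    rw [norm_mul, Real.norm_of_nonneg (h.nonneg z)]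
    exact mul_le_mul_of_nonneg_right (hK z.2) (h.nonneg z)

/-- The identity for `a(t) φ(x)` with smooth `a`. -/
theorem integral_transportDeriv_of_contDiff (h : IsWeakFlow v g C ν γ₀ γ₁) {a : ℝ → ℝ}
    (ha : ContDiff ℝ ∞ a) {φ : EuclideanSpace ℝ (Fin n) → ℝ} (hφ : ContDiff ℝ ∞ φ)
    (hφc : HasCompactSupport φ) :
    ∫ z, transportDeriv v a (deriv a) φ z ∂ν
      = a 1 * ∫ x, φ x ∂γ₁ - a 0 * ∫ x, φ x ∂γ₀ := by
  -- A time cutoff equal to `1` on a neighbourhood of `[0,1]` gives compact support without changing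
  -- `a` or its derivative there.
  let χ : ContDiffBump (0 : ℝ) := ⟨2, 3, by norm_num, by norm_num⟩
  have hχ1 : ∀ t ∈ Icc (0 : ℝ) 1, χ t = 1 := fun t ht => χ.one_of_mem_closedBall (by
    rw [Metric.mem_closedBall, dist_zero_right, Real.norm_eq_abs, abs_of_nonneg ht.1]
    exact ht.2.trans one_le_two)
  have hχd : ∀ t ∈ Icc (0 : ℝ) 1, deriv (fun s => χ s * a s) t = deriv a t := fun t ht => by
    refine Filter.EventuallyEq.deriv_eq ?_
    have : Metric.ball (0 : ℝ) 2 ∈ nhds t := Metric.isOpen_ball.mem_nhds (by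
      rw [Metric.mem_ball, dist_zero_right, Real.norm_eq_abs, abs_of_nonneg ht.1]
      linarith [ht.2])
    filter_upwards [this] with s hs
    rw [χ.one_of_mem_closedBall (Metric.ball_subset_closedBall hs), one_mul]
  have hcs : HasCompactSupport (Function.uncurry fun t x => χ t * a t * φ x) := by
    refine HasCompactSupport.intro (K := Metric.closedBall (0 : ℝ) 3 ×ˢ tsupport φ)
      ((isCompact_closedBall _ _).prod hφc) fun z hz => ?_
    simp only [Function.uncurry]
    by_cases h1 : z.1 ∈ Metric.closedBall (0 : ℝ) 3
    · rw [image_eq_zero_of_notMem_tsupport fun h2 => hz ⟨h1, h2⟩, mul_zero]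
    · rw [χ.zero_of_le_dist (not_le.1 h1).le, zero_mul, zero_mul]
  have hsm : ContDiff ℝ ∞ (Function.uncurry fun t x => χ t * a t * φ x) :=
    ((χ.contDiff.comp contDiff_fst).mul (ha.comp contDiff_fst)).mul (hφ.comp contDiff_snd)
  have hw := h.weak _ hsm hcs
  rw [← integral_const_mul, ← integral_const_mul]
  simp only [hχ1 1 (right_mem_Icc.2 zero_le_one), hχ1 0 (left_mem_Icc.2 zero_le_one), one_mul] at hw
  rw [← hw]
  refine integral_congr_ae ?_
  filter_upwards [h.time_mem] with z hz
  rw [transportDeriv, deriv_mul_const_field, hχd _ hz, hχ1 _ hz, one_mul,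
    fderiv_const_mul (hφ.differentiable (by simp) _)]
  rfl

/-- Approximate `a'` uniformly by a polynomial (Weierstrass) and integrate it from the value `a 0`.
-/
theorem exists_contDiff_near {a a' : ℝ → ℝ}
    (ha : ∀ t ∈ Icc (0 : ℝ) 1, HasDerivWithinAt a (a' t) (Icc 0 1) t)
    (ha' : ContinuousOn a' (Icc 0 1)) {ε : ℝ} (hε : 0 < ε) :
    ∃ b : ℝ → ℝ, ContDiff ℝ ∞ b ∧ ∀ t ∈ Icc (0 : ℝ) 1,
      |a t - b t| ≤ ε ∧ |a' t - deriv b t| ≤ ε := by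
  obtain ⟨q, hq⟩ := exists_polynomial_near_of_continuousOn 0 1 a' ha' ε hε
  have hqc : Continuous fun t => q.eval t := q.continuous
  have hb : ∀ t, HasDerivAt (fun t => a 0 + ∫ s in (0 : ℝ)..t, q.eval s) (q.eval t) t := fun t =>
    (intervalIntegral.integral_hasDerivAt_right (hqc.intervalIntegrable _ _)
      (hqc.stronglyMeasurableAtFilter _ _) hqc.continuousAt).const_add _
  have hderiv : deriv (fun t => a 0 + ∫ s in (0 : ℝ)..t, q.eval s) = fun t => q.eval t :=
    funext fun t => (hb t).deriv
  have hq' : ∀ t ∈ Icc (0 : ℝ) 1, |a' t - q.eval t| ≤ ε := fun t ht => by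
    rw [abs_sub_comm]; exact (hq t ht).le
  refine ⟨_, contDiff_infty_iff_deriv.2 ⟨fun t => (hb t).differentiableAt, ?_⟩, fun t ht =>
    ⟨?_, by rw [hderiv]; exact hq' t ht⟩⟩
  · rw [hderiv]; simpa using q.contDiff_aeval (𝕜 := ℝ) ∞
  · have h1 := norm_image_sub_le_of_norm_deriv_le_segment'
      (f := fun t => a t - (a 0 + ∫ s in (0 : ℝ)..t, q.eval s))
      (fun t ht => (ha t ht).sub (hb t).hasDerivWithinAt)
      (fun t ht => hq' t (Ico_subset_Icc_self ht)) t ht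
    simp only [intervalIntegral.integral_same, add_zero, sub_self, sub_zero, Real.norm_eq_abs] at h1
    exact h1.trans (mul_le_of_le_one_right hε.le ht.2)

/-- The identity for `a(t) φ(x)` where `a` is only continuously differentiable on `[0,1]`. -/
theorem integral_transportDeriv_of_hasCompactSupport (h : IsWeakFlow v g C ν γ₀ γ₁) {a a' : ℝ → ℝ}
    (ha : ∀ t ∈ Icc (0 : ℝ) 1, HasDerivWithinAt a (a' t) (Icc 0 1) t)
    (ha' : ContinuousOn a' (Icc 0 1)) {φ : EuclideanSpace ℝ (Fin n) → ℝ} (hφ : ContDiff ℝ ∞ φ)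
    (hφc : HasCompactSupport φ) :
    ∫ z, transportDeriv v a a' φ z ∂ν = a 1 * ∫ x, φ x ∂γ₁ - a 0 * ∫ x, φ x ∂γ₀ := by
  obtain ⟨K, hK⟩ := hφc.exists_bound_of_continuous hφ.continuous
  have h1 := h.integrable_of_bounded hφ.continuous hK
  have h2 := h.integrable_norm_fderiv_of_hasCompactSupport hφ hφc
  have h3 := h.integrable_fderiv_apply hφ h2
  have hac : ContinuousOn a (Icc 0 1) := fun t ht => (ha t ht).continuousWithinAt
  -- Both sides are linear in `(a, a')`; a `C¹` error `ε` changes their difference by at most `ε J`.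
  set J := (∫ z, |φ z.2| ∂ν) + (∫ z, |fderiv ℝ φ z.2 (v z)| ∂ν) + |∫ x, φ x ∂γ₁| + |∫ x, φ x ∂γ₀|
    with hJ
  have hJ0 : 0 ≤ J := by
    have : 0 ≤ ∫ z, |φ z.2| ∂ν := integral_nonneg fun _ => abs_nonneg _
    have : 0 ≤ ∫ z, |fderiv ℝ φ z.2 (v z)| ∂ν := integral_nonneg fun _ => abs_nonneg _
    positivity
  have key : ∀ ε > 0, |∫ z, transportDeriv v a a' φ z ∂ν
      - (a 1 * ∫ x, φ x ∂γ₁ - a 0 * ∫ x, φ x ∂γ₀)| ≤ ε * J := fun ε hε => by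
    obtain ⟨b, hb, hab⟩ := exists_contDiff_near ha ha' hε
    have hbd : Continuous (deriv b) := hb.continuous_deriv (by simp)
    have hia := h.integrable_transportDeriv hac ha' hφ h1 h2
    have hib := h.integrable_transportDeriv hb.continuous.continuousOn hbd.continuousOn hφ h1 h2
    have hsub : |∫ z, transportDeriv v a a' φ z ∂ν - ∫ z, transportDeriv v b (deriv b) φ z ∂ν|
        ≤ ε * ((∫ z, |φ z.2| ∂ν) + ∫ z, |fderiv ℝ φ z.2 (v z)| ∂ν) := by
      rw [← integral_sub hia hib, ← integral_add h1.abs h3.abs, ← integral_const_mul]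
      refine norm_integral_le_of_norm_le (G := ℝ) ((h1.abs.add h3.abs).const_mul ε) ?_
      filter_upwards [h.time_mem] with z hz
      have : transportDeriv v a a' φ z - transportDeriv v b (deriv b) φ z
          = (a' z.1 - deriv b z.1) * φ z.2 + (a z.1 - b z.1) * fderiv ℝ φ z.2 (v z) := by
        simp only [transportDeriv]; ring
      rw [this, mul_add]
      refine (norm_add_le _ _).trans (add_le_add ?_ ?_) <;> rw [norm_mul, Real.norm_eq_abs]
      · exact mul_le_mul_of_nonneg_right (hab _ hz).2 (norm_nonneg _)
      · exact mul_le_mul_of_nonneg_right (hab _ hz).1 (norm_nonneg _)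
    rw [h.integral_transportDeriv_of_contDiff hb hφ hφc] at hsub
    have e1 := (hab 1 (right_mem_Icc.2 zero_le_one)).1
    have e0 := (hab 0 (left_mem_Icc.2 zero_le_one)).1
    have e1' : |(a 1 - b 1) * ∫ x, φ x ∂γ₁| ≤ ε * |∫ x, φ x ∂γ₁| := by
      rw [abs_mul]; gcongr
    have e0' : |(a 0 - b 0) * ∫ x, φ x ∂γ₀| ≤ ε * |∫ x, φ x ∂γ₀| := by
      rw [abs_mul]; gcongr
    rw [hJ]
    rw [abs_le] at *
    constructor <;> nlinarith [e1'.1, e1'.2, e0'.1, e0'.2, hsub.1, hsub.2]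
  refine sub_eq_zero.1 (abs_eq_zero.1 (le_antisymm (le_of_forall_pos_le_add fun δ hδ => ?_)
    (abs_nonneg _)))
  -- `J` may be `0`, hence the denominator `J + 1`.
  refine (key (δ / (J + 1)) (by positivity)).trans ?_
  rw [zero_add, div_mul_eq_mul_div, div_le_iff₀ (by positivity)]
  nlinarith

end IsWeakFlow

end WeakFlow

end OMTwpd

end

noncomputable section

namespace OMTwpd

/-! ### Spatial cutoffs and test functions without compact support. -/

section Cutoff

variable {n : ℕ}

/-- A smooth cutoff at scale `k + 1`. -/
def cutoff (n k : ℕ) (x : EuclideanSpace ℝ (Fin n)) : ℝ :=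
  (⟨1, 2, by norm_num, by norm_num⟩ : ContDiffBump (0 : EuclideanSpace ℝ (Fin n)))
    (((k : ℝ) + 1)⁻¹ • x)

theorem contDiff_cutoff (k : ℕ) : ContDiff ℝ ∞ (cutoff n k) :=
  (ContDiffBump.contDiff _).comp (contDiff_const_smul _)

theorem abs_cutoff_le (k : ℕ) (x : EuclideanSpace ℝ (Fin n)) : |cutoff n k x| ≤ 1 := by
  unfold cutoff
  rw [abs_of_nonneg (ContDiffBump.nonneg _)]
  exact ContDiffBump.le_one _

theorem hasCompactSupport_cutoff (k : ℕ) : HasCompactSupport (cutoff n k) :=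
  (ContDiffBump.hasCompactSupport _).comp_homeomorph
    (Homeomorph.smulOfNeZero ((k : ℝ) + 1)⁻¹ (by positivity))

theorem tendsto_cutoff (x : EuclideanSpace ℝ (Fin n)) :
    Filter.Tendsto (fun k => cutoff n k x) Filter.atTop (nhds 1) := by
  refine tendsto_const_nhds.congr' ?_
  filter_upwards [Filter.eventually_ge_atTop ⌈‖x‖⌉₊] with k hk
  refine (ContDiffBump.one_of_mem_closedBall _ ?_).symm
  rw [Metric.mem_closedBall, dist_zero_right, norm_smul, norm_inv, Real.norm_of_nonneg
    (by positivity), inv_mul_le_iff₀ (by positivity), mul_one]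
  have := (Nat.le_ceil ‖x‖).trans (Nat.cast_le.2 hk)
  linarith

/-- By scaling from `‖∇χ(y)‖ (1 + ‖y‖) ≤ K`. The first bound is uniform in `k` and serves for
domination; the second tends to `0` and serves for the pointwise limit. -/
theorem exists_norm_fderiv_cutoff_le (n : ℕ) : ∃ K, 0 ≤ K ∧ ∀ k (x : EuclideanSpace ℝ (Fin n)),
    ‖fderiv ℝ (cutoff n k) x‖ ≤ K * (1 + ‖x‖)⁻¹ ∧
      ‖fderiv ℝ (cutoff n k) x‖ ≤ K * ((k : ℝ) + 1)⁻¹ := by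
  set χ : ContDiffBump (0 : EuclideanSpace ℝ (Fin n)) := ⟨1, 2, by norm_num, by norm_num⟩ with hχ
  have hsm : ContDiff ℝ ∞ χ := χ.contDiff
  have hcont : Continuous fun x => ‖fderiv ℝ χ x‖ := (hsm.continuous_fderiv (by simp)).norm
  have hcs : HasCompactSupport fun x => ‖fderiv ℝ χ x‖ := (χ.hasCompactSupport.fderiv ℝ).norm
  obtain ⟨K, hK⟩ := (hcs.mul_right (f' := fun x => 1 + ‖x‖)).exists_bound_of_continuous
    (hcont.mul (continuous_const.add continuous_norm))
  have hK' : ∀ y, ‖fderiv ℝ χ y‖ * (1 + ‖y‖) ≤ K := fun y => (le_abs_self _).trans (hK y)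
  have hK0 : 0 ≤ K := (by positivity : (0 : ℝ) ≤ ‖fderiv ℝ χ 0‖ * (1 + ‖(0 : EuclideanSpace ℝ
    (Fin n))‖)).trans (hK' 0)
  refine ⟨K, hK0, fun k x => ?_⟩
  set r : ℝ := ((k : ℝ) + 1)⁻¹ with hr
  have hr0 : 0 < r := by positivity
  have hr1 : r ≤ 1 := inv_le_one_of_one_le₀ (by linarith [k.cast_nonneg (α := ℝ)])
  have hd : fderiv ℝ (cutoff n k) x = r • fderiv ℝ χ (r • x) := by
    have : cutoff n k = fun x => χ (r • x) := rfl
    rw [this, fderiv_comp_smul]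
  have hn : ‖r • x‖ = r * ‖x‖ := by rw [norm_smul, Real.norm_of_nonneg hr0.le]
  have h1 := hK' (r • x)
  rw [hd, norm_smul, Real.norm_of_nonneg hr0.le]
  rw [hn] at h1
  constructor
  · rw [← div_eq_mul_inv, le_div_iff₀ (by positivity)]
    refine le_trans ?_ h1
    have : r * (1 + ‖x‖) ≤ 1 + r * ‖x‖ := by linarith
    calc r * ‖fderiv ℝ χ (r • x)‖ * (1 + ‖x‖) = ‖fderiv ℝ χ (r • x)‖ * (r * (1 + ‖x‖)) := by ring
      _ ≤ _ := by gcongr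
  · rw [mul_comm]
    refine mul_le_mul_of_nonneg_right (le_trans ?_ h1) hr0.le
    exact le_mul_of_one_le_right (norm_nonneg _) (le_add_of_nonneg_right (by positivity))

end Cutoff

namespace IsWeakFlow

variable {n : ℕ} {v : ℝ × EuclideanSpace ℝ (Fin n) → EuclideanSpace ℝ (Fin n)}
  {g : ℝ × EuclideanSpace ℝ (Fin n) → ℝ} {C : ℝ}
  {ν : Measure (ℝ × EuclideanSpace ℝ (Fin n))} {γ₀ γ₁ : Measure (EuclideanSpace ℝ (Fin n))}

theorem tendsto_integral_cutoff_mul {γ : Measure (EuclideanSpace ℝ (Fin n))}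
    {φ : EuclideanSpace ℝ (Fin n) → ℝ} (hφ : Integrable φ γ) :
    Filter.Tendsto (fun k => ∫ x, cutoff n k x * φ x ∂γ) Filter.atTop (nhds (∫ x, φ x ∂γ)) := by
  refine tendsto_integral_of_dominated_convergence (fun x => ‖φ x‖)
    (fun k => (contDiff_cutoff k).continuous.aestronglyMeasurable.mul hφ.1) hφ.norm
    (fun k => .of_forall fun x => ?_) (.of_forall fun x => ?_)
  · rw [norm_mul]
    exact mul_le_of_le_one_left (norm_nonneg _) (abs_cutoff_le k x)
  · simpa using (tendsto_cutoff x).mul_const (φ x)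

/-- The identity for `a(t) φ(x)` where `φ` need not have compact support. -/
theorem integral_transportDeriv (h : IsWeakFlow v g C ν γ₀ γ₁) {a a' : ℝ → ℝ}
    (ha : ∀ t ∈ Icc (0 : ℝ) 1, HasDerivWithinAt a (a' t) (Icc 0 1) t)
    (ha' : ContinuousOn a' (Icc 0 1)) {φ : EuclideanSpace ℝ (Fin n) → ℝ} (hφ : ContDiff ℝ ∞ φ)
    (h1 : Integrable (fun z => φ z.2) ν)
    (h2 : Integrable (fun z => ‖fderiv ℝ φ z.2‖ * (‖z.2‖ + g z)) ν)
    (h3 : Integrable (fun z => |φ z.2| * (1 + ‖z.2‖)⁻¹ * (‖z.2‖ + g z)) ν)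
    (h₀ : Integrable φ γ₀) (h₁ : Integrable φ γ₁) :
    ∫ z, transportDeriv v a a' φ z ∂ν = a 1 * ∫ x, φ x ∂γ₁ - a 0 * ∫ x, φ x ∂γ₀ := by
  have hac : ContinuousOn a (Icc 0 1) := fun t ht => (ha t ht).continuousWithinAt
  obtain ⟨La, hLa0, hLa⟩ := exists_bound_of_continuousOn hac
  obtain ⟨La', hLa0', hLa'⟩ := exists_bound_of_continuousOn ha'
  obtain ⟨K, hK0, hK⟩ := exists_norm_fderiv_cutoff_le n
  have hsm : ∀ k, ContDiff ℝ ∞ fun x => cutoff n k x * φ x := fun k => (contDiff_cutoff k).mul hφ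
  have hcs : ∀ k, HasCompactSupport fun x => cutoff n k x * φ x := fun k =>
    (hasCompactSupport_cutoff k).mul_right
  have hfd : ∀ k x w, fderiv ℝ (fun x => cutoff n k x * φ x) x w
      = cutoff n k x * fderiv ℝ φ x w + φ x * fderiv ℝ (cutoff n k) x w := fun k x w => by
    rw [fderiv_fun_mul ((contDiff_cutoff k).differentiable (by simp) _)
      (hφ.differentiable (by simp) _)]
    rfl
  have hR : Filter.Tendsto
      (fun k => a 1 * ∫ x, cutoff n k x * φ x ∂γ₁ - a 0 * ∫ x, cutoff n k x * φ x ∂γ₀)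
      Filter.atTop (nhds (a 1 * ∫ x, φ x ∂γ₁ - a 0 * ∫ x, φ x ∂γ₀)) :=
    ((tendsto_integral_cutoff_mul h₁).const_mul _).sub
      ((tendsto_integral_cutoff_mul h₀).const_mul _)
  have hL : Filter.Tendsto
      (fun k => ∫ z, transportDeriv v a a' (fun x => cutoff n k x * φ x) z ∂ν)
      Filter.atTop (nhds (∫ z, transportDeriv v a a' φ z ∂ν)) := by
    refine tendsto_integral_of_dominated_convergence
      -- The three terms dominate the time derivative, the gradient of `φ`, and the gradient of the
      -- cutoff.
      (fun z => La' * |φ z.2| + (La * C * (‖fderiv ℝ φ z.2‖ * (‖z.2‖ + g z)) +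
        La * K * C * (|φ z.2| * (1 + ‖z.2‖)⁻¹ * (‖z.2‖ + g z))))
      (fun k => h.aestronglyMeasurable_transportDeriv hac ha' (hsm k))
      ((h1.abs.const_mul _).add ((h2.const_mul _).add (h3.const_mul _)))
      (fun k => ?_) (.of_forall fun z => ?_)
    · filter_upwards [h.time_mem, h.abs_fderiv_apply_le φ, h.growth] with z hz hz1 hz2
      rw [transportDeriv, hfd]
      have e1 : ‖a' z.1 * (cutoff n k z.2 * φ z.2)‖ ≤ La' * |φ z.2| := by
        rw [norm_mul, norm_mul]
        exact mul_le_mul (hLa' _ hz)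
          (mul_le_of_le_one_left (norm_nonneg _) (abs_cutoff_le k _)) (by positivity) hLa0'
      have e2 : ‖cutoff n k z.2 * fderiv ℝ φ z.2 (v z)‖
          ≤ C * (‖fderiv ℝ φ z.2‖ * (‖z.2‖ + g z)) := by
        rw [norm_mul]
        exact (mul_le_of_le_one_left (norm_nonneg _) (abs_cutoff_le k _)).trans hz1
      have e3 : ‖φ z.2 * fderiv ℝ (cutoff n k) z.2 (v z)‖
          ≤ K * C * (|φ z.2| * (1 + ‖z.2‖)⁻¹ * (‖z.2‖ + g z)) := by
        rw [norm_mul]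
        calc _ ≤ ‖φ z.2‖ * ((K * (1 + ‖z.2‖)⁻¹) * (C * (‖z.2‖ + g z))) := by
              refine mul_le_mul_of_nonneg_left ?_ (norm_nonneg _)
              refine ((fderiv ℝ (cutoff n k) z.2).le_opNorm _).trans ?_
              exact mul_le_mul (hK k z.2).1 hz2 (norm_nonneg _) (by positivity)
          _ = _ := by rw [Real.norm_eq_abs]; ring
      refine (norm_add_le _ _).trans (add_le_add e1 ?_)
      rw [norm_mul]
      calc _ ≤ La * (C * (‖fderiv ℝ φ z.2‖ * (‖z.2‖ + g z)) +
            K * C * (|φ z.2| * (1 + ‖z.2‖)⁻¹ * (‖z.2‖ + g z))) :=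
          mul_le_mul (hLa _ hz) ((norm_add_le _ _).trans (add_le_add e2 e3)) (norm_nonneg _) hLa0
        _ = _ := by ring
    · have t1 := tendsto_cutoff z.2
      have t2 : Filter.Tendsto (fun k => fderiv ℝ (cutoff n k) z.2 (v z)) Filter.atTop
          (nhds 0) := by
        refine squeeze_zero_norm (a := fun k : ℕ => K * ‖v z‖ * (1 / ((k : ℝ) + 1)))
          (fun k => ?_) ?_
        · refine ((fderiv ℝ (cutoff n k) z.2).le_opNorm _).trans ?_
          calc _ ≤ K * ((k : ℝ) + 1)⁻¹ * ‖v z‖ := by gcongr; exact (hK k z.2).2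
            _ = _ := by ring
        · simpa using tendsto_one_div_add_atTop_nhds_zero_nat.const_mul (K * ‖v z‖)
      simp only [transportDeriv, hfd]
      have t3 := ((t1.mul_const (φ z.2)).const_mul (a' z.1)).add
        (((t1.mul_const (fderiv ℝ φ z.2 (v z))).add (t2.const_mul (φ z.2))).const_mul (a z.1))
      simpa using t3
  refine tendsto_nhds_unique hL (hR.congr fun k => ?_)
  exact (h.integral_transportDeriv_of_hasCompactSupport ha ha' (hsm k) (hcs k)).symm

end IsWeakFlow

/-! ### Second moments of weak flows, and test functions of quadratic growth. -/

section SecondMoment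

variable {n : ℕ}

/-- A bounded regularization of `‖x‖²`. -/
def truncatedSq (ε : ℝ) (x : EuclideanSpace ℝ (Fin n)) : ℝ := ‖x‖ ^ 2 / (1 + ε * ‖x‖ ^ 2)

variable {ε : ℝ}

theorem contDiff_truncatedSq (hε : 0 < ε) : ContDiff ℝ ∞ (truncatedSq (n := n) ε) := by
  have h : ContDiff ℝ ∞ fun x : EuclideanSpace ℝ (Fin n) => ‖x‖ ^ 2 := contDiff_norm_sq ℝ
  exact h.div (contDiff_const.add (contDiff_const.mul h)) fun x => by positivity

theorem truncatedSq_nonneg (hε : 0 < ε) (x : EuclideanSpace ℝ (Fin n)) : 0 ≤ truncatedSq ε x := by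
  unfold truncatedSq; positivity

theorem truncatedSq_le (hε : 0 < ε) (x : EuclideanSpace ℝ (Fin n)) : truncatedSq ε x ≤ ‖x‖ ^ 2 :=
  div_le_self (by positivity) (by nlinarith [sq_nonneg ‖x‖])

theorem truncatedSq_le_inv (hε : 0 < ε) (x : EuclideanSpace ℝ (Fin n)) :
    truncatedSq ε x ≤ ε⁻¹ := by
  rw [truncatedSq, div_le_iff₀ (by positivity), mul_add, inv_mul_cancel_left₀ hε.ne']
  have := inv_pos.2 hε
  linarith

theorem norm_fderiv_truncatedSq_le (hε : 0 < ε) (x : EuclideanSpace ℝ (Fin n)) :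
    ‖fderiv ℝ (truncatedSq ε) x‖ ≤ 2 * ‖x‖ / (1 + ε * ‖x‖ ^ 2) := by
  have h0 : (0 : ℝ) < 1 + ε * ‖x‖ ^ 2 := by positivity
  have hF : HasDerivAt (fun s => s / (1 + ε * s)) (((1 + ε * ‖x‖ ^ 2) ^ 2)⁻¹) (‖x‖ ^ 2) := by
    refine ((hasDerivAt_id _).div (((hasDerivAt_id _).const_mul ε).const_add 1)
      h0.ne').congr_deriv ?_
    simp only [id]
    field_simp
    ring
  have hd : HasFDerivAt (truncatedSq ε) ((((1 + ε * ‖x‖ ^ 2) ^ 2)⁻¹) • (2 • innerSL ℝ x)) x :=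
    HasDerivAt.comp_hasFDerivAt (f := fun x : EuclideanSpace ℝ (Fin n) => ‖x‖ ^ 2) x hF
      (hasStrictFDerivAt_norm_sq x).hasFDerivAt
  have h1 : (1 + ε * ‖x‖ ^ 2)⁻¹ ≤ 1 := inv_le_one_of_one_le₀ (by nlinarith [sq_nonneg ‖x‖])
  rw [hd.fderiv, norm_smul, Real.norm_of_nonneg (by positivity), ← Nat.cast_smul_eq_nsmul ℝ,
    norm_smul, innerSL_apply_norm, Nat.cast_ofNat, Real.norm_two]
  calc _ = (1 + ε * ‖x‖ ^ 2)⁻¹ * (2 * ‖x‖ / (1 + ε * ‖x‖ ^ 2)) := by field_simp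
    _ ≤ _ := mul_le_of_le_one_left (by positivity) h1

/-- This and the next bound are those of `‖x‖²` itself, with constants free of `ε`; hence the
Grönwall estimate is uniform in `ε`. -/
theorem norm_fderiv_truncatedSq_mul_le (hε : 0 < ε) (x : EuclideanSpace ℝ (Fin n)) :
    ‖fderiv ℝ (truncatedSq ε) x‖ * ‖x‖ ≤ 2 * truncatedSq ε x := by
  have h0 : (0 : ℝ) < 1 + ε * ‖x‖ ^ 2 := by positivity
  calc _ ≤ 2 * ‖x‖ / (1 + ε * ‖x‖ ^ 2) * ‖x‖ := by
        gcongr; exact norm_fderiv_truncatedSq_le hε x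
    _ = _ := by rw [truncatedSq]; ring

theorem norm_fderiv_truncatedSq_sq_le (hε : 0 < ε) (x : EuclideanSpace ℝ (Fin n)) :
    ‖fderiv ℝ (truncatedSq ε) x‖ ^ 2 ≤ 4 * truncatedSq ε x := by
  have h0 : (0 : ℝ) < 1 + ε * ‖x‖ ^ 2 := by positivity
  calc _ ≤ (2 * ‖x‖ / (1 + ε * ‖x‖ ^ 2)) ^ 2 := by
        gcongr; exact norm_fderiv_truncatedSq_le hε x
    _ = 4 * (‖x‖ ^ 2 / (1 + ε * ‖x‖ ^ 2)) * (1 + ε * ‖x‖ ^ 2)⁻¹ := by field_simp; ring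
    _ ≤ _ := by
      refine mul_le_of_le_one_right (by positivity) ?_
      exact inv_le_one_of_one_le₀ (by nlinarith [sq_nonneg ‖x‖])

end SecondMoment

namespace IsWeakFlow

variable {n : ℕ} {v : ℝ × EuclideanSpace ℝ (Fin n) → EuclideanSpace ℝ (Fin n)}
  {g : ℝ × EuclideanSpace ℝ (Fin n) → ℝ} {C : ℝ}
  {ν : Measure (ℝ × EuclideanSpace ℝ (Fin n))} {γ₀ γ₁ : Measure (EuclideanSpace ℝ (Fin n))}

/-- An integrated Grönwall inequality, uniform in `ε`. Test with `a(t) φ(x)`, where `φ` is the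
regularized square and `a = exp (l (1 - t)) - 1`. As `a 1 = 0`, the final measure drops out. From
`∇φ · v ≤ C (3 φ + g²)`, `a' = -l (a + 1)` and `l = 3 C + 1`, the integrand is at most `-φ + exp l *
C * g²`. -/
theorem integral_truncatedSq_le (h : IsWeakFlow v g C ν γ₀ γ₁)
    (hγ₀ : Integrable (fun x => 1 + ‖x‖ ^ 2) γ₀) {ε : ℝ} (hε : 0 < ε) :
    ∫ z, truncatedSq ε z.2 ∂ν
      ≤ Real.exp (3 * C + 1) * (∫ x, (1 + ‖x‖ ^ 2) ∂γ₀ + C * ∫ z, g z ^ 2 ∂ν) := by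
  have := h.finite
  have := h.finite_initial
  have := h.finite_final
  have hC := h.const_nonneg
  set l := 3 * C + 1 with hl
  set φ : EuclideanSpace ℝ (Fin n) → ℝ := truncatedSq ε with hφdef
  have hφ : ContDiff ℝ ∞ φ := contDiff_truncatedSq hε
  have hφ0 : ∀ x, 0 ≤ φ x := truncatedSq_nonneg hε
  have hφb : ∀ x, |φ x| ≤ ε⁻¹ := fun x => by
    rw [abs_of_nonneg (hφ0 x)]; exact truncatedSq_le_inv hε x
  have hgi := h.integrable_weight
  have hg2 := h.memLp.integrable_sq
  have hfd : Continuous fun x => ‖fderiv ℝ φ x‖ := (hφ.continuous_fderiv (by simp)).norm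
  have h1 : Integrable (fun z => φ z.2) ν := h.integrable_of_bounded hφ.continuous hφb
  -- Young's inequality together with `‖∇φ‖² ≤ 4 φ`.
  have hsq : ∀ x (r : ℝ), 0 ≤ r → ‖fderiv ℝ φ x‖ * r ≤ φ x + r ^ 2 := fun x r hr => by
    nlinarith [norm_fderiv_truncatedSq_sq_le hε x, sq_nonneg (‖fderiv ℝ φ x‖ - 2 * r)]
  have h2 : Integrable (fun z => ‖fderiv ℝ φ z.2‖ * (‖z.2‖ + g z)) ν := by
    refine ((h1.const_mul 3).add hg2).mono' ?_ (.of_forall fun z => ?_)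
    · exact (hfd.comp continuous_snd).aestronglyMeasurable.mul
        (continuous_snd.norm.aestronglyMeasurable.add hgi.1)
    · rw [Real.norm_of_nonneg (mul_nonneg (norm_nonneg _) (add_nonneg (norm_nonneg _)
        (h.nonneg z))), mul_add, Pi.add_apply]
      linarith [hsq z.2 _ (h.nonneg z), norm_fderiv_truncatedSq_mul_le hε z.2]
  have h3 : Integrable (fun z => |φ z.2| * (1 + ‖z.2‖)⁻¹ * (‖z.2‖ + g z)) ν := by
    refine (((integrable_const (1 : ℝ)).add hgi).const_mul ε⁻¹).mono' ?_ (.of_forall fun z => ?_)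
    · have hinv : Continuous fun z : ℝ × EuclideanSpace ℝ (Fin n) => (1 + ‖z.2‖)⁻¹ :=
        (continuous_const.add continuous_snd.norm).inv₀ fun z =>
        ne_of_gt (by positivity : (0 : ℝ) < 1 + ‖z.2‖)
      exact ((hφ.continuous.comp continuous_snd).abs.aestronglyMeasurable.mul
        hinv.aestronglyMeasurable).mul (continuous_snd.norm.aestronglyMeasurable.add hgi.1)
    · have hg0 := h.nonneg z
      rw [Real.norm_of_nonneg (by positivity), mul_assoc]
      refine mul_le_mul (hφb _) ?_ (by positivity) (by positivity)
      rw [inv_mul_le_iff₀ (by positivity)]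
      show _ ≤ (1 + ‖z.2‖) * (1 + g z)
      nlinarith [mul_nonneg (norm_nonneg z.2) hg0]
  have hi : ∀ γ : Measure (EuclideanSpace ℝ (Fin n)), IsFiniteMeasure γ → Integrable φ γ :=
    fun γ _ => (integrable_const ε⁻¹).mono' hφ.continuous.aestronglyMeasurable (.of_forall hφb)
  set a : ℝ → ℝ := fun t => Real.exp (l * (1 - t)) - 1 with hadef
  have had : ∀ t, HasDerivAt a (-l * Real.exp (l * (1 - t))) t := fun t => by
    refine ((((hasDerivAt_id t).const_sub 1).const_mul l).exp.sub_const 1).congr_deriv ?_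
    simp only [id]
    ring
  have hac : Continuous a := by fun_prop
  have hac' : Continuous fun t => -l * Real.exp (l * (1 - t)) := by fun_prop
  have hmain := h.integral_transportDeriv (fun t _ => (had t).hasDerivWithinAt)
    hac'.continuousOn hφ h1 h2 h3 (hi _ h.finite_initial)
    (hi _ h.finite_final)
  have hTi := h.integrable_transportDeriv hac.continuousOn hac'.continuousOn hφ h1 h2
  have ha1 : a 1 = 0 := by simp [hadef]
  have ha0 : a 0 ≤ Real.exp l := by simp [hadef]
  have hanon : ∀ t ∈ Icc (0 : ℝ) 1, 0 ≤ a t ∧ a t ≤ Real.exp l := fun t ht => by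
    have hl0 : 0 ≤ l := by positivity
    constructor
    · exact sub_nonneg.2 (Real.one_le_exp (mul_nonneg hl0 (by linarith [ht.2])))
    · have : Real.exp (l * (1 - t)) ≤ Real.exp l :=
        Real.exp_le_exp.2 (mul_le_of_le_one_right hl0 (by linarith [ht.1]))
      simp only [hadef]; linarith
  rw [ha1, zero_mul, zero_sub] at hmain
  have hle : ∫ z, φ z.2 ∂ν
      ≤ ∫ z, (-transportDeriv v a (fun t => -l * Real.exp (l * (1 - t))) φ z
        + Real.exp l * C * g z ^ 2) ∂ν := by
    refine integral_mono_ae h1 (hTi.neg.add (hg2.const_mul _)) ?_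
    filter_upwards [h.time_mem, h.abs_fderiv_apply_le φ] with z hz hz1
    obtain ⟨p0, p1⟩ := hanon _ hz
    have he : Real.exp (l * (1 - z.1)) = a z.1 + 1 := by simp [hadef]
    simp only [transportDeriv, he]
    have q1 : fderiv ℝ φ z.2 (v z) ≤ C * (3 * φ z.2 + g z ^ 2) := by
      refine (le_abs_self _).trans (hz1.trans (mul_le_mul_of_nonneg_left ?_ hC))
      rw [mul_add]
      linarith [hsq z.2 _ (h.nonneg z), norm_fderiv_truncatedSq_mul_le hε z.2]
    have q2 := mul_le_mul_of_nonneg_left q1 p0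
    have q3 : a z.1 * (C * g z ^ 2) ≤ Real.exp l * (C * g z ^ 2) :=
      mul_le_mul_of_nonneg_right p1 (by positivity)
    have q4 : 0 ≤ a z.1 * φ z.2 := mul_nonneg p0 (hφ0 _)
    have q5 : 0 ≤ C * φ z.2 := mul_nonneg hC (hφ0 _)
    rw [hl]
    nlinarith
  have hφγ : ∫ x, φ x ∂γ₀ ≤ ∫ x, (1 + ‖x‖ ^ 2) ∂γ₀ := by
    refine integral_mono (hi _ ‹_›) hγ₀ fun x => (truncatedSq_le hε x).trans ?_
    simp
  have hadd := integral_add hTi.neg (hg2.const_mul (Real.exp l * C))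
  simp only [Pi.neg_apply] at hadd
  rw [hadd, integral_neg, hmain, neg_neg, integral_const_mul] at hle
  refine hle.trans ?_
  rw [mul_add, mul_assoc]
  gcongr
  exact integral_nonneg hφ0

/-- Fatou's lemma as `ε → 0` in the uniform bound. A moment of the initial measure and the square
integrability of `g` suffice. -/
theorem integrable_norm_sq (h : IsWeakFlow v g C ν γ₀ γ₁)
    (hγ₀ : Integrable (fun x => 1 + ‖x‖ ^ 2) γ₀) : Integrable (fun z => 1 + ‖z.2‖ ^ 2) ν := by
  have := h.finite
  refine (integrable_const 1).add ⟨(continuous_snd.norm.pow 2).aestronglyMeasurable, ?_⟩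
  rw [hasFiniteIntegral_iff_ofReal (.of_forall fun z => by positivity)]
  set D := Real.exp (3 * C + 1) * (∫ x, (1 + ‖x‖ ^ 2) ∂γ₀ + C * ∫ z, g z ^ 2 ∂ν) with hD
  set ε : ℕ → ℝ := fun k => 1 / ((k : ℝ) + 1) with hεdef
  have hε : ∀ k, 0 < ε k := fun k => by positivity
  have hlim : ∀ z : ℝ × EuclideanSpace ℝ (Fin n), ENNReal.ofReal (‖z.2‖ ^ 2)
      = Filter.liminf (fun k => ENNReal.ofReal (truncatedSq (ε k) z.2)) Filter.atTop := fun z => by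
    refine (Filter.Tendsto.liminf_eq ?_).symm
    refine (ENNReal.continuous_ofReal.tendsto _).comp ?_
    have h1 := (tendsto_one_div_add_atTop_nhds_zero_nat (𝕜 := ℝ)).mul_const (‖z.2‖ ^ 2)
    have h2 := (tendsto_const_nhds (x := ‖z.2‖ ^ 2)).div (h1.const_add 1) (by simp)
    simpa [truncatedSq, hεdef, Pi.div_def] using h2
  simp_rw [hlim]
  refine (lintegral_liminf_le fun k => ?_).trans_lt
    (lt_of_le_of_lt ?_ (ENNReal.ofReal_lt_top (r := D)))
  · exact ((contDiff_truncatedSq (hε k)).continuous.comp continuous_snd).measurable.ennreal_ofReal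
  · refine Filter.liminf_le_of_le (by isBoundedDefault) fun b hb => ?_
    obtain ⟨k, hk⟩ := hb.exists
    refine hk.trans ?_
    rw [← ofReal_integral_eq_lintegral_ofReal _ (.of_forall fun z => truncatedSq_nonneg (hε k) _)]
    · exact ENNReal.ofReal_le_ofReal (h.integral_truncatedSq_le hγ₀ (hε k))
    · refine h.integrable_of_bounded (contDiff_truncatedSq (hε k)).continuous (K := (ε k)⁻¹)
        fun x => ?_
      rw [abs_of_nonneg (truncatedSq_nonneg (hε k) x)]
      exact truncatedSq_le_inv (hε k) x

/-- The identity for `a(t) φ(x)` where `φ` has at most quadratic growth. -/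
theorem integral_transportDeriv_of_quadratic (h : IsWeakFlow v g C ν γ₀ γ₁)
    (hγ₀ : Integrable (fun x => 1 + ‖x‖ ^ 2) γ₀) (hγ₁ : Integrable (fun x => 1 + ‖x‖ ^ 2) γ₁)
    {a a' : ℝ → ℝ}
    (ha : ∀ t ∈ Icc (0 : ℝ) 1, HasDerivWithinAt a (a' t) (Icc 0 1) t)
    (ha' : ContinuousOn a' (Icc 0 1)) {φ : EuclideanSpace ℝ (Fin n) → ℝ} (hφ : ContDiff ℝ ∞ φ)
    {K : ℝ} (hK : ∀ x, |φ x| ≤ K * (1 + ‖x‖ ^ 2)) (hK' : ∀ x, ‖fderiv ℝ φ x‖ ≤ K * (1 + ‖x‖)) :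
    Integrable (transportDeriv v a a' φ) ν ∧
    ∫ z, transportDeriv v a a' φ z ∂ν = a 1 * ∫ x, φ x ∂γ₁ - a 0 * ∫ x, φ x ∂γ₀ := by
  have hK0 : 0 ≤ K := by
    have := (abs_nonneg _).trans (hK 0)
    simpa using this
  have hν := h.integrable_norm_sq hγ₀
  have hgi := h.integrable_weight
  have hg2 := h.memLp.integrable_sq
  have hfd : Continuous fun x => ‖fderiv ℝ φ x‖ := (hφ.continuous_fderiv (by simp)).norm
  have hmeas : AEStronglyMeasurable (fun z => ‖z.2‖ + g z) ν :=
    continuous_snd.norm.aestronglyMeasurable.add hgi.1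
  have hdom : Integrable (fun z => K * (4 * (1 + ‖z.2‖ ^ 2) + 2 * g z ^ 2)) ν :=
    ((hν.const_mul 4).add (hg2.const_mul 2)).const_mul K
  have hbound : ∀ z : ℝ × EuclideanSpace ℝ (Fin n),
      K * (1 + ‖z.2‖) * (‖z.2‖ + g z) ≤ K * (4 * (1 + ‖z.2‖ ^ 2) + 2 * g z ^ 2) := fun z => by
    rw [mul_assoc]
    refine mul_le_mul_of_nonneg_left ?_ hK0
    nlinarith [sq_nonneg (‖z.2‖ - g z), sq_nonneg (1 - g z), sq_nonneg (1 - ‖z.2‖)]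
  have hi : ∀ γ : Measure (EuclideanSpace ℝ (Fin n)), Integrable (fun x => 1 + ‖x‖ ^ 2) γ →
      Integrable φ γ := fun γ hγ =>
    (hγ.const_mul K).mono' hφ.continuous.aestronglyMeasurable (.of_forall hK)
  have h1 : Integrable (fun z => φ z.2) ν :=
    (hν.const_mul K).mono' (hφ.continuous.comp continuous_snd).aestronglyMeasurable
      (.of_forall fun z => hK z.2)
  have h2 : Integrable (fun z => ‖fderiv ℝ φ z.2‖ * (‖z.2‖ + g z)) ν := by
    refine hdom.mono' ((hfd.comp continuous_snd).aestronglyMeasurable.mul hmeas)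
      (.of_forall fun z => le_trans ?_ (hbound z))
    have hg0 := h.nonneg z
    rw [Real.norm_of_nonneg (by positivity)]
    gcongr
    exact hK' _
  have h3 : Integrable (fun z => |φ z.2| * (1 + ‖z.2‖)⁻¹ * (‖z.2‖ + g z)) ν := by
    have hinv : Continuous fun z : ℝ × EuclideanSpace ℝ (Fin n) => (1 + ‖z.2‖)⁻¹ :=
      (continuous_const.add continuous_snd.norm).inv₀ fun z =>
        ne_of_gt (by positivity : (0 : ℝ) < 1 + ‖z.2‖)
    refine hdom.mono' (((hφ.continuous.comp continuous_snd).abs.aestronglyMeasurable.mul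
        hinv.aestronglyMeasurable).mul hmeas) (.of_forall fun z => le_trans ?_ (hbound z))
    have hg0 := h.nonneg z
    rw [Real.norm_of_nonneg (by positivity)]
    refine mul_le_mul_of_nonneg_right ?_ (by positivity)
    rw [← div_eq_mul_inv, div_le_iff₀ (by positivity), mul_assoc]
    refine (hK _).trans (mul_le_mul_of_nonneg_left ?_ hK0)
    nlinarith [norm_nonneg z.2]
  exact ⟨h.integrable_transportDeriv (fun t ht => (ha t ht).continuousWithinAt) ha' hφ h1 h2,
    h.integral_transportDeriv ha ha' hφ h1 h2 h3 (hi _ hγ₀) (hi _ hγ₁)⟩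

end IsWeakFlow

end OMTwpd

end

noncomputable section

namespace OMTwpd

variable {n p : ℕ}

/-! ### Coordinate functions and their products. -/

section Coordinates

theorem abs_coord_le (x : EuclideanSpace ℝ (Fin n)) (i : Fin n) : |x i| ≤ ‖x‖ :=
  PiLp.norm_apply_le x i

theorem hasFDerivAt_coord (i : Fin n) (x : EuclideanSpace ℝ (Fin n)) :
    HasFDerivAt (fun x : EuclideanSpace ℝ (Fin n) => x i) (EuclideanSpace.proj (𝕜 := ℝ) i) x :=
  (EuclideanSpace.proj (𝕜 := ℝ) i).hasFDerivAt

theorem contDiff_coord (i : Fin n) : ContDiff ℝ ∞ fun x : EuclideanSpace ℝ (Fin n) => x i :=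
  (EuclideanSpace.proj (𝕜 := ℝ) i).contDiff

theorem norm_proj_le (i : Fin n) :
    ‖(EuclideanSpace.proj i : EuclideanSpace ℝ (Fin n) →L[ℝ] ℝ)‖ ≤ 1 :=
  ContinuousLinearMap.opNorm_le_bound _ zero_le_one fun x => by
    rw [one_mul]; exact PiLp.norm_apply_le x i

theorem fderiv_coord_mul_coord (i j : Fin n) (x : EuclideanSpace ℝ (Fin n)) :
    fderiv ℝ (fun x : EuclideanSpace ℝ (Fin n) => x i * x j) x
      = x i • EuclideanSpace.proj (𝕜 := ℝ) j + x j • EuclideanSpace.proj (𝕜 := ℝ) i :=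
  ((hasFDerivAt_coord i x).mul (hasFDerivAt_coord j x)).fderiv

end Coordinates

/-! ### The verification argument. -/

section Verification

variable {v : ℝ × EuclideanSpace ℝ (Fin n) → EuclideanSpace ℝ (Fin n)}
  {g : ℝ × EuclideanSpace ℝ (Fin n) → ℝ} {C : ℝ}
  {ν : Measure (ℝ × EuclideanSpace ℝ (Fin n))} {γ₀ γ₁ : Measure (EuclideanSpace ℝ (Fin n))}

/-- The integral of `-x'Px/2 + m'x + c` with respect to `γ`, coordinate by coordinate. -/
def quadraticIntegral (P : Matrix (Fin n) (Fin n) ℝ) (m : EuclideanSpace ℝ (Fin n)) (c : ℝ)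
    (γ : Measure (EuclideanSpace ℝ (Fin n))) : ℝ :=
  -(1 / 2) * (∑ i, ∑ j, P i j * ∫ x, x i * x j ∂γ) + (∑ i, m i * ∫ x, x i ∂γ) + c * ∫ _, 1 ∂γ

theorem integral_add_add {α : Type*} [MeasurableSpace α] {μ : Measure α} {f₁ f₂ f₃ : α → ℝ}
    (h₁ : Integrable f₁ μ) (h₂ : Integrable f₂ μ) (h₃ : Integrable f₃ μ) :
    ∫ z, (f₁ z + f₂ z + f₃ z) ∂μ = ∫ z, f₁ z ∂μ + ∫ z, f₂ z ∂μ + ∫ z, f₃ z ∂μ := by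
  rw [← integral_add h₁ h₂]
  exact integral_add (h₁.add h₂) h₃

/-- A time-dependent quadratic polynomial is a finite sum of terms `a(t) φ(x)` with `φ` among `x i *
x j`, `x i` and `1`, and each of these has at most quadratic growth. -/
theorem IsWeakFlow.integral_quadratic (h : IsWeakFlow v g C ν γ₀ γ₁)
    (hγ₀ : Integrable (fun x => 1 + ‖x‖ ^ 2) γ₀) (hγ₁ : Integrable (fun x => 1 + ‖x‖ ^ 2) γ₁)
    {P P' : ℝ → Matrix (Fin n) (Fin n) ℝ}
    (hP : ∀ t ∈ Icc (0 : ℝ) 1, HasDerivWithinAt P (P' t) (Icc 0 1) t)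
    (hP' : ContinuousOn P' (Icc 0 1))
    {m : ℝ → EuclideanSpace ℝ (Fin n)} {m' : ℝ → Fin n → ℝ}
    (hm : ∀ i, ∀ t ∈ Icc (0 : ℝ) 1, HasDerivWithinAt (fun t => m t i) (m' t i) (Icc 0 1) t)
    (hm' : ∀ i, ContinuousOn (fun t => m' t i) (Icc 0 1))
    {c c' : ℝ → ℝ} (hc : ∀ t ∈ Icc (0 : ℝ) 1, HasDerivWithinAt c (c' t) (Icc 0 1) t)
    (hc' : ContinuousOn c' (Icc 0 1)) {G : ℝ × EuclideanSpace ℝ (Fin n) → ℝ}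
    (hG : ∀ᵐ z ∂ν, G z = -(1 / 2) * (z.2.ofLp ⬝ᵥ P' z.1 *ᵥ z.2.ofLp
        + (z.2.ofLp ⬝ᵥ P z.1 *ᵥ (v z).ofLp + (v z).ofLp ⬝ᵥ P z.1 *ᵥ z.2.ofLp))
      + (m' z.1 ⬝ᵥ z.2.ofLp + (m z.1).ofLp ⬝ᵥ (v z).ofLp) + c' z.1) :
    Integrable G ν ∧ ∫ z, G z ∂ν
      = quadraticIntegral (P 1) (m 1) (c 1) γ₁ - quadraticIntegral (P 0) (m 0) (c 0) γ₀ := by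
  have h2 := fun i j => h.integral_transportDeriv_of_quadratic hγ₀ hγ₁
    (fun t ht => hasDerivWithinAt_matrix_iff.1 (hP t ht) i j) (continuousOn_matrix_iff.1 hP' i j)
    ((contDiff_coord i).mul (contDiff_coord j)) (K := 2) (fun x => by
      rw [abs_mul]
      nlinarith [mul_le_mul (abs_coord_le x i) (abs_coord_le x j) (abs_nonneg _) (norm_nonneg _),
        sq_nonneg ‖x‖]) (fun x => by
      rw [fderiv_coord_mul_coord]
      refine (norm_add_le _ _).trans ?_
      rw [norm_smul, norm_smul, Real.norm_eq_abs, Real.norm_eq_abs]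
      have e1 := mul_le_mul (abs_coord_le x i) (norm_proj_le j) (norm_nonneg _) (norm_nonneg _)
      have e2 := mul_le_mul (abs_coord_le x j) (norm_proj_le i) (norm_nonneg _) (norm_nonneg _)
      linarith)
  have h1 := fun i => h.integral_transportDeriv_of_quadratic hγ₀ hγ₁ (hm i) (hm' i)
    (contDiff_coord i) (K := 2) (fun x => by
      nlinarith [abs_coord_le x i, sq_nonneg (‖x‖ - 1)]) (fun x => by
      rw [(hasFDerivAt_coord i x).fderiv]
      linarith [norm_proj_le i, norm_nonneg x])
  have h0 := h.integral_transportDeriv_of_quadratic hγ₀ hγ₁ hc hc' (φ := fun _ => 1)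
    contDiff_const (K := 2) (fun x => by rw [abs_one]; nlinarith [sq_nonneg ‖x‖]) (fun x => by
      rw [fderiv_fun_const, Pi.zero_apply, norm_zero]; positivity)
  have e2 : ∀ i j, ∀ z, transportDeriv v (fun t => P t i j) (fun t => P' t i j)
      (fun x : EuclideanSpace ℝ (Fin n) => x i * x j) z
      = P' z.1 i j * (z.2 i * z.2 j) + P z.1 i j * (z.2 i * v z j + z.2 j * v z i) :=
    fun i j z => by
      rw [transportDeriv, fderiv_coord_mul_coord]
      rfl
  have e1 : ∀ i, ∀ z, transportDeriv v (fun t => m t i) (fun t => m' t i)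
      (fun x : EuclideanSpace ℝ (Fin n) => x i) z = m' z.1 i * z.2 i + m z.1 i * v z i :=
    fun i z => by
      rw [transportDeriv, (hasFDerivAt_coord i _).fderiv]
      rfl
  have e0 : ∀ z, transportDeriv v c c' (fun _ => 1) z = c' z.1 := fun z => by
    simp [transportDeriv]
  have hGe : G =ᵐ[ν] fun z => -(1 / 2) * (∑ i, ∑ j, transportDeriv v (fun t => P t i j)
        (fun t => P' t i j) (fun x : EuclideanSpace ℝ (Fin n) => x i * x j) z)
      + (∑ i, transportDeriv v (fun t => m t i) (fun t => m' t i)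
        (fun x : EuclideanSpace ℝ (Fin n) => x i) z) + transportDeriv v c c' (fun _ => 1) z := by
    filter_upwards [hG] with z hz
    rw [hz]
    simp only [e0, e1, e2, dotProduct, mulVec]
    congr 2
    · simp only [Finset.mul_sum, ← Finset.sum_add_distrib]
      exact Finset.sum_congr rfl fun i _ => Finset.sum_congr rfl fun j _ => by ring
    · exact Finset.sum_add_distrib.symm
  have i2 : Integrable (fun z => -(1 / 2) * ∑ i, ∑ j, transportDeriv v (fun t => P t i j)
        (fun t => P' t i j) (fun x : EuclideanSpace ℝ (Fin n) => x i * x j) z) ν :=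
    (integrable_finsetSum _ fun i _ => integrable_finsetSum _ fun j _ => (h2 i j).1).const_mul _
  have i1 : Integrable (fun z => ∑ i, transportDeriv v (fun t => m t i) (fun t => m' t i)
        (fun x : EuclideanSpace ℝ (Fin n) => x i) z) ν :=
    integrable_finsetSum _ fun i _ => (h1 i).1
  refine ⟨((i2.add i1).add h0.1).congr hGe.symm, ?_⟩
  rw [integral_congr_ae hGe, integral_add_add i2 i1 h0.1, integral_const_mul,
    integral_finsetSum _ fun i _ => integrable_finsetSum _ fun j _ => (h2 i j).1,
    integral_finsetSum _ fun i _ => (h1 i).1, h0.2]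
  simp only [integral_finsetSum Finset.univ fun j _ => (h2 _ j).1, (h2 _ _).2, (h1 _).2,
    Finset.sum_sub_distrib, quadraticIntegral]
  ring

/-- The Hamilton–Jacobi equation for `V = -x'Px/2 + m'x + c`: the right-hand side is `∂V/∂t + ∇V ·
w`, its last term being `c'`, and the left-hand side is `⟨B'∇V, u⟩ - ‖B'∇V‖²/2`. With `b = B'Px` and
`β = B'm` all terms in `A` cancel. -/
theorem hamiltonJacobi_identity {A P P' : Matrix (Fin n) (Fin n) ℝ} {B : Matrix (Fin n) (Fin p) ℝ}
    {m m' x w : Fin n → ℝ} {u : Fin p → ℝ} (hPt : Pᵀ = P)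
    (hP' : P' = -(Aᵀ * P) - P * A + P * B * Bᵀ * P)
    (hm' : m' = -((A - B * Bᵀ * P)ᵀ *ᵥ m)) (hw : w = A *ᵥ x + B *ᵥ u) :
    (-(Bᵀ *ᵥ P *ᵥ x) + Bᵀ *ᵥ m) ⬝ᵥ u
        - 1 / 2 * ((-(Bᵀ *ᵥ P *ᵥ x) + Bᵀ *ᵥ m) ⬝ᵥ (-(Bᵀ *ᵥ P *ᵥ x) + Bᵀ *ᵥ m))
      = -(1 / 2) * (x ⬝ᵥ P' *ᵥ x + (x ⬝ᵥ P *ᵥ w + w ⬝ᵥ P *ᵥ x)) + (m' ⬝ᵥ x + m ⬝ᵥ w)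
        + -(1 / 2) * ((Bᵀ *ᵥ m) ⬝ᵥ (Bᵀ *ᵥ m)) := by
  set b := Bᵀ *ᵥ P *ᵥ x with hb
  set β := Bᵀ *ᵥ m with hβ
  have hsymm : ∀ y z : Fin n → ℝ, y ⬝ᵥ P *ᵥ z = (P *ᵥ y) ⬝ᵥ z := fun y z => by
    rw [dotProduct_mulVec, ← mulVec_transpose, hPt]
  have hBt : ∀ (y : Fin n → ℝ) (z : Fin p → ℝ), y ⬝ᵥ B *ᵥ z = (Bᵀ *ᵥ y) ⬝ᵥ z := fun y z => by
    rw [dotProduct_mulVec, ← mulVec_transpose]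
  have hAt : ∀ y z : Fin n → ℝ, y ⬝ᵥ Aᵀ *ᵥ z = (A *ᵥ y) ⬝ᵥ z := fun y z => by
    rw [dotProduct_mulVec, ← mulVec_transpose, transpose_transpose]
  have t1 : x ⬝ᵥ P' *ᵥ x = -2 * ((P *ᵥ x) ⬝ᵥ A *ᵥ x) + b ⬝ᵥ b := by
    rw [hP', add_mulVec, sub_mulVec, neg_mulVec, dotProduct_add, dotProduct_sub, dotProduct_neg]
    simp only [← mulVec_mulVec, hAt, hsymm, hBt, ← hb]
    rw [← hsymm (A *ᵥ x) x, dotProduct_comm (A *ᵥ x)]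
    ring
  have t2 : x ⬝ᵥ P *ᵥ w + w ⬝ᵥ P *ᵥ x = 2 * ((P *ᵥ x) ⬝ᵥ A *ᵥ x) + 2 * (b ⬝ᵥ u) := by
    rw [dotProduct_comm w, hsymm, hw, dotProduct_add, hBt]
    ring
  have t3 : m' ⬝ᵥ x = -(m ⬝ᵥ A *ᵥ x) + β ⬝ᵥ b := by
    rw [hm', neg_dotProduct, dotProduct_comm, dotProduct_mulVec, vecMul_transpose, sub_mulVec,
      sub_dotProduct, dotProduct_comm _ m, dotProduct_comm _ m, ← mulVec_mulVec, ← mulVec_mulVec,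
      hBt]
    ring
  have t4 : m ⬝ᵥ w = m ⬝ᵥ A *ᵥ x + β ⬝ᵥ u := by rw [hw, dotProduct_add, hBt]
  rw [t1, t2, t3, t4, add_dotProduct, add_dotProduct, dotProduct_add, dotProduct_add,
    neg_dotProduct, neg_dotProduct, dotProduct_neg, dotProduct_neg, neg_dotProduct,
    dotProduct_comm b β]
  ring

/-- Along every weak flow from `γ₀` to `γ₁` that is driven by a control `u`, the quantity
`⟨u⁎, u⟩ - ‖u⁎‖²/2` has the same integral, where `u⁎ = -B'Px + B'm`. -/
theorem exists_integral_inner_feedback_eq {A P : ℝ → Matrix (Fin n) (Fin n) ℝ}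
    {B : ℝ → Matrix (Fin n) (Fin p) ℝ} {m : ℝ → EuclideanSpace ℝ (Fin n)}
    (hA : ContinuousOn A (Icc 0 1)) (hB : ContinuousOn B (Icc 0 1))
    (hPt : ∀ t ∈ Icc (0 : ℝ) 1, (P t)ᵀ = P t)
    (hP : ∀ t ∈ Icc (0 : ℝ) 1, HasDerivWithinAt P
      (-((A t)ᵀ * P t) - P t * A t + P t * B t * (B t)ᵀ * P t) (Icc 0 1) t)
    (hm : ∀ i, ∀ t ∈ Icc (0 : ℝ) 1, HasDerivWithinAt (fun t => m t i)
      ((-((closedLoop A B P t)ᵀ *ᵥ (m t).ofLp)) i) (Icc 0 1) t)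
    (hγ₀ : Integrable (fun x => 1 + ‖x‖ ^ 2) γ₀) (hγ₁ : Integrable (fun x => 1 + ‖x‖ ^ 2) γ₁) :
    ∃ D : ℝ, ∀ (v : ℝ × EuclideanSpace ℝ (Fin n) → EuclideanSpace ℝ (Fin n))
      (g : ℝ × EuclideanSpace ℝ (Fin n) → ℝ) (C : ℝ) (ν : Measure (ℝ × EuclideanSpace ℝ (Fin n)))
      (u : ℝ → EuclideanSpace ℝ (Fin n) → EuclideanSpace ℝ (Fin p)),
      IsWeakFlow v g C ν γ₀ γ₁ →
      (∀ z, v z = (A z.1).toEuclideanLin z.2 + (B z.1).toEuclideanLin (u z.1 z.2)) →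
      Integrable (fun z => inner ℝ (-((B z.1)ᵀ * P z.1).toEuclideanLin z.2
          + (B z.1)ᵀ.toEuclideanLin (m z.1)) (u z.1 z.2)
        - 1 / 2 * ‖-((B z.1)ᵀ * P z.1).toEuclideanLin z.2
          + (B z.1)ᵀ.toEuclideanLin (m z.1)‖ ^ 2) ν ∧
      ∫ z, (inner ℝ (-((B z.1)ᵀ * P z.1).toEuclideanLin z.2
          + (B z.1)ᵀ.toEuclideanLin (m z.1)) (u z.1 z.2)
        - 1 / 2 * ‖-((B z.1)ᵀ * P z.1).toEuclideanLin z.2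
          + (B z.1)ᵀ.toEuclideanLin (m z.1)‖ ^ 2) ∂ν = D := by
  have hPc := continuousOn_of_hasDerivWithinAt hP
  have hBt := continuousOn_matrix_transpose hB
  have hcl := continuousOn_matrix_iff.1 (continuousOn_closedLoop hA hB hPc)
  have hmc : ∀ i, ContinuousOn (fun t => m t i) (Icc 0 1) := fun i t ht =>
    (hm i t ht).continuousWithinAt
  have hP' : ContinuousOn (fun t => -((A t)ᵀ * P t) - P t * A t + P t * B t * (B t)ᵀ * P t)
      (Icc 0 1) := by
    have c1 := continuousOn_matrix_iff.1
      (continuousOn_matrix_mul (continuousOn_matrix_transpose hA) hPc)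
    have c2 := continuousOn_matrix_iff.1 (continuousOn_matrix_mul hPc hA)
    have c3 := continuousOn_matrix_iff.1 (continuousOn_matrix_mul (continuousOn_matrix_mul
      (continuousOn_matrix_mul hPc hB) hBt) hPc)
    exact continuousOn_matrix_iff.2 fun i j => (((c1 i j).neg).sub (c2 i j)).add (c3 i j)
  have hm' : ∀ i, ContinuousOn (fun t => (-((closedLoop A B P t)ᵀ *ᵥ (m t).ofLp)) i) (Icc 0 1) :=
    fun i => by
      simp only [mulVec, dotProduct, Pi.neg_apply, transpose_apply]
      exact (continuousOn_finsetSum _ fun j _ => (hcl j i).mul (hmc j)).neg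
  have hc' : ContinuousOn (fun t => -(1 / 2 : ℝ) * (((B t)ᵀ *ᵥ (m t).ofLp) ⬝ᵥ
      ((B t)ᵀ *ᵥ (m t).ofLp))) (Icc 0 1) := by
    simp only [mulVec, dotProduct]
    have : ∀ i, ContinuousOn (fun t => ∑ j, (B t)ᵀ i j * m t j) (Icc 0 1) := fun i =>
      continuousOn_finsetSum _ fun j _ => (continuousOn_matrix_iff.1 hBt i j).mul (hmc j)
    exact continuousOn_const.mul (continuousOn_finsetSum _ fun i _ => (this i).mul (this i))
  -- `D` is the difference of the end-point integrals of `V`, with `c` the antiderivative of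
  -- `-‖B'm‖²/2`; it involves neither `ν` nor `u`.
  refine ⟨_, fun v g C ν u h hv => h.integral_quadratic hγ₀ hγ₁ hP hP' hm hm'
    (hasDerivWithinAt_integral_Icc hc') hc' ?_⟩
  filter_upwards [h.time_mem] with z hz
  have key := hamiltonJacobi_identity (u := (u z.1 z.2).ofLp) (m := (m z.1).ofLp) (x := z.2.ofLp)
    (w := (v z).ofLp) (hPt _ hz) rfl rfl (by rw [hv]; rfl)
  rw [← real_inner_self_eq_norm_sq, inner_eq_dotProduct, inner_eq_dotProduct]
  refine Eq.trans ?_ key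
  simp only [WithLp.ofLp_add, WithLp.ofLp_neg, toLpLin_apply, mulVec_mulVec]

end Verification

end OMTwpd

end

noncomputable section

namespace OMTwpd

variable {n p : ℕ}

/-! ### Continuity and bounds for time-dependent linear maps. -/

section Operators

theorem continuousOn_toEuclideanLin_apply {X : Type*} [TopologicalSpace X] {k l : ℕ} {s : Set X}
    {M : X → Matrix (Fin k) (Fin l) ℝ} {w : X → EuclideanSpace ℝ (Fin l)}
    (hM : ∀ i j, ContinuousOn (fun x => M x i j) s) (hw : ContinuousOn w s) :
    ContinuousOn (fun x => (M x).toEuclideanLin (w x)) s := by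
  refine (PiLp.continuous_toLp 2 _).comp_continuousOn (continuousOn_pi.2 fun i => ?_)
  show ContinuousOn (fun x => (M x *ᵥ (w x).ofLp) i) s
  simp only [mulVec, dotProduct]
  exact continuousOn_finsetSum _ fun j _ =>
    (hM i j).mul ((EuclideanSpace.proj (𝕜 := ℝ) j).continuous.comp_continuousOn hw)

theorem continuousOn_entries_fst {Y : Type*} [TopologicalSpace Y] {k l : ℕ}
    {M : ℝ → Matrix (Fin k) (Fin l) ℝ} (hM : ContinuousOn M (Icc 0 1)) (i : Fin k) (j : Fin l) :
    ContinuousOn (fun z : ℝ × Y => M z.1 i j) (Icc 0 1 ×ˢ univ) :=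
  (continuousOn_matrix_iff.1 hM i j).comp continuousOn_fst fun _ hz => hz.1

theorem exists_norm_toEuclideanLin_le {k l : ℕ} {M : ℝ → Matrix (Fin k) (Fin l) ℝ}
    (hM : ContinuousOn M (Icc 0 1)) :
    ∃ C, 0 ≤ C ∧ ∀ t ∈ Icc (0 : ℝ) 1, ∀ y, ‖(M t).toEuclideanLin y‖ ≤ C * ‖y‖ := by
  obtain ⟨C, hC0, hC⟩ := exists_entry_bound hM
  refine ⟨k * (l * C), by positivity, fun t ht y => ?_⟩
  have hsum : ∀ z : EuclideanSpace ℝ (Fin k), ‖z‖ ≤ ∑ i, |z i| := fun z => by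
    conv_lhs => rw [← (EuclideanSpace.basisFun (Fin k) ℝ).sum_repr z]
    refine (norm_sum_le _ _).trans (Finset.sum_le_sum fun i _ => ?_)
    rw [norm_smul, (EuclideanSpace.basisFun (Fin k) ℝ).norm_eq_one, mul_one]
    rfl
  refine (hsum _).trans ?_
  calc ∑ i, |((M t).toEuclideanLin y) i| ≤ ∑ _i : Fin k, l * C * ‖y‖ :=
        Finset.sum_le_sum fun i _ => by
          show |(M t *ᵥ y.ofLp) i| ≤ _
          simp only [mulVec, dotProduct]
          refine (Finset.abs_sum_le_sum_abs _ _).trans ?_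
          calc ∑ j, |M t i j * y j| ≤ ∑ _j : Fin l, C * ‖y‖ := Finset.sum_le_sum fun j _ => by
                rw [abs_mul]
                exact mul_le_mul (hC t ht i j) (abs_coord_le y j) (abs_nonneg _) hC0
            _ = l * C * ‖y‖ := by simp [mul_assoc]
    _ = _ := by simp; ring

end Operators

/-! ### The space-time measure of a density flow. -/

section FlowMeasure

/-- Lebesgue measure on `[0,1] × ℝⁿ`. -/
def stripVolume (n : ℕ) : Measure (ℝ × EuclideanSpace ℝ (Fin n)) :=
  (volume.restrict (Icc (0 : ℝ) 1)).prod volume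

theorem stripVolume_eq :
    stripVolume n = (volume.prod volume).restrict (Icc (0 : ℝ) 1 ×ˢ univ) := by
  rw [stripVolume, ← Measure.prod_restrict, Measure.restrict_univ]

/-- The measure `ρ(t,x) dt dx` on `[0,1] × ℝⁿ`. -/
def flowMeasure (ρ : ℝ → EuclideanSpace ℝ (Fin n) → ℝ) :
    Measure (ℝ × EuclideanSpace ℝ (Fin n)) :=
  (stripVolume n).withDensity fun z => ENNReal.ofReal (ρ z.1 z.2)

theorem ae_stripVolume_mem : ∀ᵐ z ∂stripVolume n, z.1 ∈ Icc (0 : ℝ) 1 := by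
  rw [stripVolume_eq]
  filter_upwards [ae_restrict_mem (measurableSet_Icc.prod MeasurableSet.univ)] with z hz
  exact hz.1

variable {ρ : ℝ → EuclideanSpace ℝ (Fin n) → ℝ}

theorem ae_flowMeasure_mem : ∀ᵐ z ∂flowMeasure ρ, z.1 ∈ Icc (0 : ℝ) 1 :=
  (withDensity_absolutelyContinuous _ _).ae_le ae_stripVolume_mem

theorem aestronglyMeasurable_stripVolume {F : Type*} [TopologicalSpace F]
    [TopologicalSpace.PseudoMetrizableSpace F] {f : ℝ × EuclideanSpace ℝ (Fin n) → F}
    (hf : ContinuousOn f (Icc 0 1 ×ˢ univ)) : AEStronglyMeasurable f (stripVolume n) := by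
  rw [stripVolume_eq]
  exact hf.aestronglyMeasurable (measurableSet_Icc.prod MeasurableSet.univ)

theorem aestronglyMeasurable_flowMeasure {F : Type*} [TopologicalSpace F]
    [TopologicalSpace.PseudoMetrizableSpace F] {f : ℝ × EuclideanSpace ℝ (Fin n) → F}
    (hf : ContinuousOn f (Icc 0 1 ×ˢ univ)) : AEStronglyMeasurable f (flowMeasure ρ) :=
  (aestronglyMeasurable_stripVolume hf).mono_ac (withDensity_absolutelyContinuous _ _)

theorem IsDensityFlow.measurable_ofReal (hρ : IsDensityFlow ρ) :
    Measurable fun z : ℝ × EuclideanSpace ℝ (Fin n) => ENNReal.ofReal (ρ z.1 z.2) :=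
  hρ.measurable.ennreal_ofReal

theorem IsDensityFlow.isFiniteMeasure (hρ : IsDensityFlow ρ) :
    IsFiniteMeasure (flowMeasure ρ) := by
  refine ⟨?_⟩
  rw [flowMeasure, withDensity_apply _ MeasurableSet.univ, Measure.restrict_univ, stripVolume,
    lintegral_prod _ hρ.measurable_ofReal.aemeasurable,
    setLIntegral_congr_fun measurableSet_Icc fun t ht => hρ.lintegral_eq_one t ht]
  simp

theorem cost_eq_lintegral (hρ : IsDensityFlow ρ)
    {u : ℝ → EuclideanSpace ℝ (Fin n) → EuclideanSpace ℝ (Fin p)}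
    (hu : ContinuousOn (Function.uncurry u) (Icc (0 : ℝ) 1 ×ˢ univ)) :
    cost ρ u = ∫⁻ z, ENNReal.ofReal (1 / 2 * ‖u z.1 z.2‖ ^ 2) ∂flowMeasure ρ := by
  have hm : AEMeasurable (fun z : ℝ × EuclideanSpace ℝ (Fin n) =>
      ENNReal.ofReal (1 / 2 * ‖u z.1 z.2‖ ^ 2)) (stripVolume n) :=
    (aestronglyMeasurable_stripVolume
      (continuousOn_const.mul (hu.norm.pow 2))).aemeasurable.ennreal_ofReal
  rw [flowMeasure, lintegral_withDensity_eq_lintegral_mul₀ hρ.measurable_ofReal.aemeasurable hm,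
    stripVolume, lintegral_prod _ (hρ.measurable_ofReal.aemeasurable.mul hm), cost]
  refine lintegral_congr fun t => lintegral_congr fun x => ?_
  rw [Pi.mul_apply, mul_comm (ENNReal.ofReal _), ← ENNReal.ofReal_mul (by positivity)]

theorem IsDensityFlow.integral_flowMeasure (hρ : IsDensityFlow ρ)
    {G : ℝ × EuclideanSpace ℝ (Fin n) → ℝ} (hG : Integrable G (flowMeasure ρ)) :
    ∫ z, G z ∂flowMeasure ρ = ∫ t in (0 : ℝ)..1, ∫ x, G (t, x) * ρ t x := by
  rw [flowMeasure, integrable_withDensity_iff_integrable_smul' hρ.measurable_ofReal (by simp)] at hG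
  rw [flowMeasure, integral_withDensity_eq_integral_toReal_smul hρ.measurable_ofReal (by simp),
    stripVolume, integral_prod _ hG, intervalIntegral.integral_of_le zero_le_one,
    integral_Icc_eq_integral_Ioc]
  refine setIntegral_congr_fun measurableSet_Ioc fun t ht =>
    integral_congr_ae (.of_forall fun x => ?_)
  simp only [smul_eq_mul]
  rw [ENNReal.toReal_ofReal (hρ.nonneg t (Ioc_subset_Icc_self ht) x), mul_comm]

theorem integral_withDensity_ofReal {f r : EuclideanSpace ℝ (Fin n) → ℝ} (hr : Measurable r)
    (hr0 : ∀ x, 0 ≤ r x) :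
    ∫ x, f x ∂(volume.withDensity fun x => ENNReal.ofReal (r x)) = ∫ x, f x * r x := by
  rw [integral_withDensity_eq_integral_toReal_smul hr.ennreal_ofReal (by simp)]
  refine integral_congr_ae (.of_forall fun x => ?_)
  simp only [smul_eq_mul]
  rw [ENNReal.toReal_ofReal (hr0 x), mul_comm]

end FlowMeasure

/-! ### Space-time test functions. -/

section TestFunctions

variable {f : ℝ → EuclideanSpace ℝ (Fin n) → ℝ}

/-- As one joint derivative in the direction `(1, w)`, the integrand is easy to measure and to
bound. -/
theorem deriv_add_fderiv_eq (hf : ContDiff ℝ ∞ (Function.uncurry f)) (t : ℝ)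
    (x w : EuclideanSpace ℝ (Fin n)) :
    deriv (fun s => f s x) t + fderiv ℝ (f t) x w =
      fderiv ℝ (Function.uncurry f) (t, x) (1, w) := by
  have hd := (hf.differentiable (by simp) (t, x)).hasFDerivAt
  have h1 : HasDerivAt (fun s => f s x) (fderiv ℝ (Function.uncurry f) (t, x) (1, 0)) t :=
    HasFDerivAt.comp_hasDerivAt (f := fun s => (s, x)) t hd
      ((hasDerivAt_id t).prodMk (hasDerivAt_const t x))
  have h2 : HasFDerivAt (f t) ((fderiv ℝ (Function.uncurry f) (t, x)).comp
      (ContinuousLinearMap.inr ℝ ℝ (EuclideanSpace ℝ (Fin n)))) x :=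
    HasFDerivAt.comp (f := fun y => (t, y)) x hd (hasFDerivAt_prodMk_right t x)
  rw [h1.deriv, h2.fderiv, ContinuousLinearMap.comp_apply, ContinuousLinearMap.inr_apply, ← map_add]
  simp

theorem exists_fderiv_bound (hf : ContDiff ℝ ∞ (Function.uncurry f))
    (hfc : HasCompactSupport (Function.uncurry f)) :
    ∃ K, 0 ≤ K ∧ ∀ t x, ‖fderiv ℝ (Function.uncurry f) (t, x)‖ ≤ K ∧
      ‖fderiv ℝ (Function.uncurry f) (t, x)‖ * ‖x‖ ≤ K := by
  have hcont : Continuous fun z => ‖fderiv ℝ (Function.uncurry f) z‖ :=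
    (hf.continuous_fderiv (by simp)).norm
  have hcs : HasCompactSupport fun z => ‖fderiv ℝ (Function.uncurry f) z‖ := (hfc.fderiv ℝ).norm
  obtain ⟨K, hK⟩ := hcs.exists_bound_of_continuous hcont
  obtain ⟨L, hL⟩ := (hcs.mul_right (f' := fun z => ‖z.2‖)).exists_bound_of_continuous
    (hcont.mul continuous_snd.norm)
  refine ⟨max K L, ?_, fun t x => ⟨?_, ?_⟩⟩
  · exact ((norm_nonneg _).trans (hK (0, 0))).trans (le_max_left _ _)
  · exact ((le_abs_self _).trans (hK (t, x))).trans (le_max_left _ _)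
  · exact ((le_abs_self _).trans (hL (t, x))).trans (le_max_right _ _)

theorem abs_fderiv_one_apply_le {K : ℝ} {t : ℝ} {x w : EuclideanSpace ℝ (Fin n)} {C r : ℝ}
    (hK : ‖fderiv ℝ (Function.uncurry f) (t, x)‖ ≤ K)
    (hK' : ‖fderiv ℝ (Function.uncurry f) (t, x)‖ * ‖x‖ ≤ K) (hC : 0 ≤ C) (hr : 0 ≤ r)
    (hw : ‖w‖ ≤ C * (‖x‖ + r)) :
    |fderiv ℝ (Function.uncurry f) (t, x) (1, w)| ≤ K + C * (K + K * r) := by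
  set N := ‖fderiv ℝ (Function.uncurry f) (t, x)‖ with hN
  have hN0 : 0 ≤ N := norm_nonneg _
  have h1 : ‖((1 : ℝ), w)‖ ≤ 1 + ‖w‖ := by
    rw [Prod.norm_def]
    exact max_le (by rw [norm_one]; linarith [norm_nonneg w]) (by linarith)
  calc _ ≤ N * ‖((1 : ℝ), w)‖ := (fderiv ℝ (Function.uncurry f) (t, x)).le_opNorm _
    _ ≤ N * (1 + C * (‖x‖ + r)) := by gcongr; linarith
    _ = N + C * (N * ‖x‖ + N * r) := by ring
    _ ≤ _ := by gcongr

end TestFunctions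

/-! ### Admissible pairs of finite cost as weak flows. -/

section Admissible

variable {A : ℝ → Matrix (Fin n) (Fin n) ℝ} {B : ℝ → Matrix (Fin n) (Fin p) ℝ}
  {ρ₀ ρ₁ : EuclideanSpace ℝ (Fin n) → ℝ} {ρ : ℝ → EuclideanSpace ℝ (Fin n) → ℝ}
  {u : ℝ → EuclideanSpace ℝ (Fin n) → EuclideanSpace ℝ (Fin p)}

/-- The velocity field `A(t)x + B(t)u(t,x)`. -/
def velocity (A : ℝ → Matrix (Fin n) (Fin n) ℝ) (B : ℝ → Matrix (Fin n) (Fin p) ℝ)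
    (u : ℝ → EuclideanSpace ℝ (Fin n) → EuclideanSpace ℝ (Fin p))
    (z : ℝ × EuclideanSpace ℝ (Fin n)) : EuclideanSpace ℝ (Fin n) :=
  (A z.1).toEuclideanLin z.2 + (B z.1).toEuclideanLin (u z.1 z.2)

theorem continuousOn_velocity (hA : ContinuousOn A (Icc 0 1)) (hB : ContinuousOn B (Icc 0 1))
    (hu : ContinuousOn (Function.uncurry u) (Icc (0 : ℝ) 1 ×ˢ univ)) :
    ContinuousOn (velocity A B u) (Icc 0 1 ×ˢ univ) :=
  (continuousOn_toEuclideanLin_apply (continuousOn_entries_fst hA) continuousOn_snd).add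
    (continuousOn_toEuclideanLin_apply (continuousOn_entries_fst hB) hu)

theorem exists_norm_velocity_le (hA : ContinuousOn A (Icc 0 1)) (hB : ContinuousOn B (Icc 0 1)) :
    ∃ C, 0 ≤ C ∧ ∀ u : ℝ → EuclideanSpace ℝ (Fin n) → EuclideanSpace ℝ (Fin p),
      ∀ z : ℝ × EuclideanSpace ℝ (Fin n), z.1 ∈ Icc (0 : ℝ) 1 →
      ‖velocity A B u z‖ ≤ C * (‖z.2‖ + ‖u z.1 z.2‖) := by
  obtain ⟨CA, hCA0, hCA⟩ := exists_norm_toEuclideanLin_le hA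
  obtain ⟨CB, hCB0, hCB⟩ := exists_norm_toEuclideanLin_le hB
  refine ⟨CA + CB, by positivity, fun u z hz => (norm_add_le _ _).trans ?_⟩
  have := hCA _ hz z.2
  have := hCB _ hz (u z.1 z.2)
  nlinarith [mul_nonneg hCA0 (norm_nonneg (u z.1 z.2)), mul_nonneg hCB0 (norm_nonneg z.2)]

/-- Finite cost says that `g = ‖u‖` is square integrable for `ρ dt dx`. This makes the tested
integrand integrable, so Fubini turns the iterated integral of the continuity equation into an
integral over space-time. -/
theorem isWeakFlow_of_isAdmissible (hA : ContinuousOn A (Icc 0 1)) (hB : ContinuousOn B (Icc 0 1))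
    (h : IsAdmissible A B ρ₀ ρ₁ ρ u) (hcost : cost ρ u ≠ ⊤)
    (hρ₀ : Measurable ρ₀) (hρ₀' : ∀ x, 0 ≤ ρ₀ x) (hρ₁ : Measurable ρ₁) (hρ₁' : ∀ x, 0 ≤ ρ₁ x)
    (hf₀ : IsFiniteMeasure (volume.withDensity fun x => ENNReal.ofReal (ρ₀ x)))
    (hf₁ : IsFiniteMeasure (volume.withDensity fun x => ENNReal.ofReal (ρ₁ x))) :
    ∃ C, IsWeakFlow (velocity A B u) (fun z => ‖u z.1 z.2‖) C (flowMeasure ρ)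
      (volume.withDensity fun x => ENNReal.ofReal (ρ₀ x))
      (volume.withDensity fun x => ENNReal.ofReal (ρ₁ x)) := by
  obtain ⟨C, hC0, hC⟩ := exists_norm_velocity_le (p := p) hA hB
  have hfin := h.flow.isFiniteMeasure
  have hum : AEStronglyMeasurable (fun z => ‖u z.1 z.2‖) (flowMeasure ρ) :=
    aestronglyMeasurable_flowMeasure h.continuous_control.norm
  have hmem : MemLp (fun z => ‖u z.1 z.2‖) 2 (flowMeasure ρ) := by
    rw [memLp_two_iff_integrable_sq hum]
    have hi : Integrable (fun z => 1 / 2 * ‖u z.1 z.2‖ ^ 2) (flowMeasure ρ) := by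
      refine ⟨(hum.pow 2).const_mul _, ?_⟩
      rw [hasFiniteIntegral_iff_ofReal (.of_forall fun z => by positivity),
        ← cost_eq_lintegral h.flow h.continuous_control]
      exact hcost.lt_top
    exact (hi.const_mul 2).congr (.of_forall fun z => by simp)
  have hvm : AEStronglyMeasurable (velocity A B u) (flowMeasure ρ) :=
    aestronglyMeasurable_flowMeasure (continuousOn_velocity hA hB h.continuous_control)
  refine ⟨C, hfin, hf₀, hf₁, ae_flowMeasure_mem, hvm, hC0, hmem, fun _ => norm_nonneg _,
    ?_, fun f hf hfc => ?_⟩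
  · filter_upwards [ae_flowMeasure_mem] with z hz
    exact hC u z hz
  · obtain ⟨K, hK0, hK⟩ := exists_fderiv_bound hf hfc
    have hG : Integrable (fun z => deriv (fun s => f s z.2) z.1
        + fderiv ℝ (f z.1) z.2 (velocity A B u z)) (flowMeasure ρ) := by
      refine ((integrable_const K).add (((integrable_const K).add
        ((hmem.integrable (by norm_num)).const_mul K)).const_mul C)).mono' ?_ ?_
      · simp only [deriv_add_fderiv_eq hf]
        exact isBoundedBilinearMap_apply.continuous.comp_aestronglyMeasurable
          ((hf.continuous_fderiv (by simp)).aestronglyMeasurable.prodMk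
            (aestronglyMeasurable_const.prodMk hvm))
      · filter_upwards [ae_flowMeasure_mem] with z hz
        rw [deriv_add_fderiv_eq hf]
        exact abs_fderiv_one_apply_le (hK _ _).1 (hK _ _).2 hC0 (norm_nonneg _) (hC u z hz)
    rw [h.flow.integral_flowMeasure hG, integral_withDensity_ofReal hρ₀ hρ₀',
      integral_withDensity_ofReal hρ₁ hρ₁']
    refine (h.continuity_eq f hf hfc).trans ?_
    congr 1
    · refine integral_congr_ae ?_
      filter_upwards [h.final] with x hx
      rw [hx]
    · refine integral_congr_ae ?_
      filter_upwards [h.initial] with x hx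
      rw [hx]

end Admissible

end OMTwpd

end

noncomputable section

namespace OMTwpd

variable {n p : ℕ}

/-! ### The affine flow of the closed loop. -/

section AffineFlow

theorem hasDerivWithinAt_euclidean_iff {k : ℕ} {ξ : ℝ → EuclideanSpace ℝ (Fin k)}
    {ξ' : EuclideanSpace ℝ (Fin k)} {s : Set ℝ} {t : ℝ} :
    HasDerivWithinAt ξ ξ' s t ↔ ∀ i, HasDerivWithinAt (fun r => ξ r i) (ξ' i) s t := by
  simp only [hasDerivWithinAt_iff_hasFDerivWithinAt]
  rw [hasFDerivWithinAt_euclidean]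
  refine forall_congr' fun i => ?_
  congr!

theorem hasDerivWithinAt_toEuclideanLin {k l : ℕ} {M : ℝ → Matrix (Fin k) (Fin l) ℝ}
    {M' : Matrix (Fin k) (Fin l) ℝ} {s : Set ℝ} {t : ℝ} (hM : HasDerivWithinAt M M' s t)
    (x : EuclideanSpace ℝ (Fin l)) :
    HasDerivWithinAt (fun r => (M r).toEuclideanLin x) (M'.toEuclideanLin x) s t := by
  rw [hasDerivWithinAt_euclidean_iff]
  intro i
  show HasDerivWithinAt (fun r => (M r *ᵥ x.ofLp) i) ((M' *ᵥ x.ofLp) i) s t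
  simp only [mulVec, dotProduct]
  exact HasDerivWithinAt.fun_sum fun j _ =>
    (hasDerivWithinAt_matrix_iff.1 hM i j).mul_const (x j)

theorem toEuclideanLin_mul_apply {k l m : ℕ} (M : Matrix (Fin k) (Fin l) ℝ)
    (N : Matrix (Fin l) (Fin m) ℝ) (x : EuclideanSpace ℝ (Fin m)) :
    (M * N).toEuclideanLin x = M.toEuclideanLin (N.toEuclideanLin x) := by
  ext i
  simp [toLpLin_apply, mulVec_mulVec]

variable {A P Z V : ℝ → Matrix (Fin n) (Fin n) ℝ} {B : ℝ → Matrix (Fin n) (Fin p) ℝ}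

theorem drift_eq (hZ : IsFundamentalPair (closedLoop A B P) Z V) (m₀ m₁ : EuclideanSpace ℝ (Fin n))
    {t : ℝ} (ht : t ∈ Icc (0 : ℝ) 1) :
    drift A B P m₀ m₁ t = ((Z 1 * V t)ᵀ * (gramian (closedLoop A B P) B 1 0)⁻¹).toEuclideanLin
      (m₁ - (Z 1).toEuclideanLin m₀) := by
  have h1 := right_mem_Icc.2 (zero_le_one (α := ℝ))
  have h0 := left_mem_Icc.2 (zero_le_one (α := ℝ))
  rw [drift, hZ.transitionMatrix_eq 1 h1 t ht, hZ.transitionMatrix_eq 1 h1 0 h0, hZ.zero_inv,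
    Matrix.mul_one]

/-- The drift solves the adjoint equation of the closed loop. -/
theorem hasDerivWithinAt_drift (hZ : IsFundamentalPair (closedLoop A B P) Z V)
    (m₀ m₁ : EuclideanSpace ℝ (Fin n)) :
    ∀ t ∈ Icc (0 : ℝ) 1, HasDerivWithinAt (drift A B P m₀ m₁)
      ((-(closedLoop A B P t)ᵀ).toEuclideanLin (drift A B P m₀ m₁ t)) (Icc 0 1) t := fun t ht => by
  set G := (gramian (closedLoop A B P) B 1 0)⁻¹ with hG
  have h := hasDerivWithinAt_toEuclideanLin (hasDerivWithinAt_matrix_mul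
    (hasDerivWithinAt_matrix_transpose (hasDerivWithinAt_matrix_mul
      (hasDerivWithinAt_matrix_const (Z 1)) (hZ.deriv_inv t ht)))
    (hasDerivWithinAt_matrix_const G)) (m₁ - (Z 1).toEuclideanLin m₀)
  refine (h.congr_deriv ?_).congr (fun s hs => drift_eq hZ m₀ m₁ hs) (drift_eq hZ m₀ m₁ ht)
  rw [drift_eq hZ m₀ m₁ ht, ← toEuclideanLin_mul_apply, ← Matrix.mul_assoc]
  congr 2
  simp only [Matrix.zero_mul, zero_add, Matrix.mul_neg, transpose_neg, transpose_mul,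
    Matrix.mul_zero, add_zero, Matrix.neg_mul, Matrix.mul_assoc, hG]

/-- The inhomogeneous part of the flow of `ẋ = (A - BB'Π)x + BB'm`. -/
theorem exists_inhomogeneous_solution (hZ : IsFundamentalPair (closedLoop A B P) Z V)
    (hB : ContinuousOn B (Icc 0 1)) (hM : IsUnit (gramian (closedLoop A B P) B 1 0).det)
    (m₀ m₁ : EuclideanSpace ℝ (Fin n)) :
    ∃ b : ℝ → EuclideanSpace ℝ (Fin n), b 0 = 0 ∧ (Z 1).toEuclideanLin m₀ + b 1 = m₁ ∧
      ∀ t ∈ Icc (0 : ℝ) 1, HasDerivWithinAt b ((closedLoop A B P t).toEuclideanLin (b t) +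
        (B t * (B t)ᵀ).toEuclideanLin (drift A B P m₀ m₁ t)) (Icc 0 1) t := by
  set G := (gramian (closedLoop A B P) B 1 0)⁻¹ with hG
  set N := initialGramian V B with hN
  have h1 := right_mem_Icc.2 (zero_le_one (α := ℝ))
  -- Variation of constants, `∫₀ᵗ Z(t) V(s) B B' m(s) ds`: the drift contains `V(s)'`, so the
  -- integral is a pulled-back Gramian. At time `1` it becomes `M̂(1,0) M̂(1,0)⁻¹ (m₁ - Z(1) m₀)`.
  refine ⟨fun t => (Z t * N t * ((Z 1)ᵀ * G)).toEuclideanLin (m₁ - (Z 1).toEuclideanLin m₀),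
    ?_, ?_, fun t ht => ?_⟩
  · simp [hN, initialGramian_zero]
  · have h : Z 1 * N 1 * ((Z 1)ᵀ * G) = 1 := by
      rw [← Matrix.mul_assoc, hN, ← gramian_eq hZ hB h1, hG, mul_nonsing_inv _ hM]
    simp only [h]
    simp
  · have h := hasDerivWithinAt_toEuclideanLin (hasDerivWithinAt_matrix_mul
      (hasDerivWithinAt_matrix_mul (hZ.deriv t ht)
        (hasDerivWithinAt_initialGramian hZ.continuousOn_inv hB t ht))
      (hasDerivWithinAt_matrix_const ((Z 1)ᵀ * G))) (m₁ - (Z 1).toEuclideanLin m₀)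
    refine h.congr_deriv ?_
    rw [drift_eq hZ m₀ m₁ ht, ← toEuclideanLin_mul_apply, ← toEuclideanLin_mul_apply,
      ← LinearMap.add_apply, ← map_add]
    congr 2
    have hc : Z t * (V t * B t * (V t * B t)ᵀ) = B t * (B t)ᵀ * (V t)ᵀ := by
      rw [transpose_mul, ← Matrix.mul_assoc, ← Matrix.mul_assoc, ← Matrix.mul_assoc,
        hZ.mul_inv t ht, Matrix.one_mul]
    rw [hc, transpose_mul]
    simp only [Matrix.mul_zero, add_zero, Matrix.add_mul, Matrix.mul_assoc, hG, hN]

theorem hasDerivWithinAt_affineFlow (hZ : IsFundamentalPair (closedLoop A B P) Z V)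
    {b c : ℝ → EuclideanSpace ℝ (Fin n)}
    (hb : ∀ t ∈ Icc (0 : ℝ) 1, HasDerivWithinAt b ((closedLoop A B P t).toEuclideanLin (b t) +
      c t) (Icc 0 1) t) (x : EuclideanSpace ℝ (Fin n)) :
    ∀ t ∈ Icc (0 : ℝ) 1, HasDerivWithinAt (fun s => (Z s).toEuclideanLin x + b s)
      ((closedLoop A B P t).toEuclideanLin ((Z t).toEuclideanLin x + b t) + c t)
      (Icc 0 1) t := fun t ht => by
  refine ((hasDerivWithinAt_toEuclideanLin (hZ.deriv t ht) x).add (hb t ht)).congr_deriv ?_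
  rw [toEuclideanLin_mul_apply, map_add, add_assoc]

/-- The difference `ξ - b` solves the homogeneous equation, so `V (ξ - b)` is conserved. -/
theorem eq_affineFlow (hZ : IsFundamentalPair (closedLoop A B P) Z V)
    {b c : ℝ → EuclideanSpace ℝ (Fin n)} (hb0 : b 0 = 0)
    (hb : ∀ t ∈ Icc (0 : ℝ) 1, HasDerivWithinAt b ((closedLoop A B P t).toEuclideanLin (b t) +
      c t) (Icc 0 1) t) {ξ : ℝ → EuclideanSpace ℝ (Fin n)}
    (hξ : ∀ t ∈ Icc (0 : ℝ) 1, HasDerivWithinAt ξ ((closedLoop A B P t).toEuclideanLin (ξ t) +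
      c t) (Icc 0 1) t) :
    ∀ t ∈ Icc (0 : ℝ) 1, ξ t = (Z t).toEuclideanLin (ξ 0) + b t := fun t ht => by
  have hd : ∀ t ∈ Icc (0 : ℝ) 1,
      HasDerivWithinAt (fun t => Matrix.of fun i (_ : Fin 1) => (ξ t - b t) i)
      (closedLoop A B P t * Matrix.of fun i (_ : Fin 1) => (ξ t - b t) i) (Icc 0 1) t :=
    fun t ht => hasDerivWithinAt_matrix_iff.2 fun i j => by
      refine (hasDerivWithinAt_euclidean_iff.1 ((hξ t ht).sub (hb t ht)) i).congr_deriv ?_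
      rw [add_sub_add_right_eq_sub, ← map_sub]
      rfl
  have h := congrArg (Z t * ·) (inverse_mul_eq_of_hasDerivWithinAt hZ.deriv_inv hd t ht)
  simp only [← Matrix.mul_assoc] at h
  rw [hZ.mul_inv t ht, Matrix.one_mul, hZ.zero_inv, Matrix.mul_one, hb0, sub_zero] at h
  rw [← sub_eq_iff_eq_add]
  ext i
  exact congrFun (congrFun h i) 0

end AffineFlow

end OMTwpd

end

noncomputable section

namespace OMTwpd

variable {n p : ℕ}

/-! ### Densities carried by a flow of maps. -/

section Transport

variable {A : ℝ → Matrix (Fin n) (Fin n) ℝ} {B : ℝ → Matrix (Fin n) (Fin p) ℝ}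
  {ρ : ℝ → EuclideanSpace ℝ (Fin n) → ℝ}
  {u : ℝ → EuclideanSpace ℝ (Fin n) → EuclideanSpace ℝ (Fin p)}
  {γ : Measure (EuclideanSpace ℝ (Fin n))}

/-- `ρ(t,·)` is the density of the image of `γ` under `T t`. -/
structure IsTransportedBy (ρ : ℝ → EuclideanSpace ℝ (Fin n) → ℝ)
    (γ : Measure (EuclideanSpace ℝ (Fin n)))
    (T : ℝ → EuclideanSpace ℝ (Fin n) → EuclideanSpace ℝ (Fin n)) : Prop where
  measurable : Measurable (Function.uncurry ρ)
  nonneg : ∀ t ∈ Icc (0 : ℝ) 1, ∀ x, 0 ≤ ρ t x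
  map_eq : ∀ t ∈ Icc (0 : ℝ) 1, γ.map (T t) = volume.withDensity fun x => ENNReal.ofReal (ρ t x)
  continuousOn : ContinuousOn (Function.uncurry T) (Icc 0 1 ×ˢ univ)

variable {T : ℝ → EuclideanSpace ℝ (Fin n) → EuclideanSpace ℝ (Fin n)}

theorem continuous_of_continuousOn_uncurry {F : Type*} [TopologicalSpace F]
    {f : ℝ → EuclideanSpace ℝ (Fin n) → F}
    (hf : ContinuousOn (Function.uncurry f) (Icc 0 1 ×ˢ univ)) {t : ℝ} (ht : t ∈ Icc (0 : ℝ) 1) :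
    Continuous (f t) := by
  rw [← continuousOn_univ]
  exact hf.comp (f := fun x => (t, x)) (by fun_prop) fun x _ => ⟨ht, mem_univ _⟩

theorem IsTransportedBy.measurable_density (h : IsTransportedBy ρ γ T) (t : ℝ) :
    Measurable (ρ t) :=
  h.measurable.comp measurable_prodMk_left

theorem IsTransportedBy.continuous (h : IsTransportedBy ρ γ T) {t : ℝ} (ht : t ∈ Icc (0 : ℝ) 1) :
    Continuous (T t) :=
  continuous_of_continuousOn_uncurry h.continuousOn ht

theorem IsTransportedBy.integral_mul (h : IsTransportedBy ρ γ T) {t : ℝ} (ht : t ∈ Icc (0 : ℝ) 1)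
    {f : EuclideanSpace ℝ (Fin n) → ℝ} (hf : Continuous f) :
    ∫ x, f x * ρ t x = ∫ x, f (T t x) ∂γ := by
  rw [← integral_withDensity_ofReal (h.measurable_density t) (h.nonneg t ht), ← h.map_eq t ht,
    integral_map (h.continuous ht).measurable.aemeasurable hf.aestronglyMeasurable]

theorem IsTransportedBy.lintegral_mul (h : IsTransportedBy ρ γ T) {t : ℝ} (ht : t ∈ Icc (0 : ℝ) 1)
    {f : EuclideanSpace ℝ (Fin n) → ℝ} (hf : Continuous f) (hf0 : ∀ x, 0 ≤ f x) :
    ∫⁻ x, ENNReal.ofReal (f x * ρ t x) = ∫⁻ x, ENNReal.ofReal (f (T t x)) ∂γ := by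
  have hm := hf.measurable.ennreal_ofReal
  rw [← lintegral_map hm (h.continuous ht).measurable, h.map_eq t ht,
    lintegral_withDensity_eq_lintegral_mul _ (h.measurable_density t).ennreal_ofReal hm]
  refine lintegral_congr fun x => ?_
  rw [Pi.mul_apply, mul_comm (ENNReal.ofReal _), ← ENNReal.ofReal_mul (hf0 x)]

theorem IsTransportedBy.isDensityFlow (h : IsTransportedBy ρ γ T) [IsProbabilityMeasure γ] :
    IsDensityFlow ρ where
  measurable := h.measurable
  nonneg := h.nonneg
  lintegral_eq_one t ht := by
    rw [← setLIntegral_univ, ← withDensity_apply _ MeasurableSet.univ, ← h.map_eq t ht]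
    exact (Measure.isProbabilityMeasure_map (h.continuous ht).measurable.aemeasurable).measure_univ

theorem IsTransportedBy.ae_eq (h : IsTransportedBy ρ γ T) [IsFiniteMeasure γ] {t : ℝ}
    (ht : t ∈ Icc (0 : ℝ) 1) {r : EuclideanSpace ℝ (Fin n) → ℝ} (hr : Measurable r)
    (hr0 : ∀ x, 0 ≤ r x) (hmap : γ.map (T t) = volume.withDensity fun x => ENNReal.ofReal (r x)) :
    ρ t =ᵐ[volume] r := by
  have heq := h.map_eq t ht
  have hfin : ∫⁻ x, ENNReal.ofReal (ρ t x) ≠ ⊤ := by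
    rw [← setLIntegral_univ, ← withDensity_apply _ MeasurableSet.univ, ← heq]
    exact measure_ne_top _ _
  rw [hmap, eq_comm, withDensity_eq_iff (h.measurable_density t).ennreal_ofReal.aemeasurable
    hr.ennreal_ofReal.aemeasurable hfin] at heq
  filter_upwards [heq] with x hx
  exact (ENNReal.ofReal_eq_ofReal_iff (h.nonneg t ht x) (hr0 x)).1 hx

/-- Apply the fundamental theorem of calculus to `f(t, T t x)` along each trajectory, integrate over
the initial point, exchange the integrals, and change variables at each time. -/
theorem IsTransportedBy.satisfiesContinuityEq (h : IsTransportedBy ρ γ T) [IsFiniteMeasure γ]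
    (hA : ContinuousOn A (Icc 0 1)) (hB : ContinuousOn B (Icc 0 1))
    (hu : ContinuousOn (Function.uncurry u) (Icc (0 : ℝ) 1 ×ˢ univ)) {C : ℝ} (hC : 0 ≤ C)
    (hgrowth : ∀ z : ℝ × EuclideanSpace ℝ (Fin n), z.1 ∈ Icc (0 : ℝ) 1 →
      ‖velocity A B u z‖ ≤ C * (‖z.2‖ + 1))
    (hT : ∀ x, ∀ t ∈ Icc (0 : ℝ) 1, HasDerivWithinAt (fun s => T s x)
      (velocity A B u (t, T t x)) (Icc 0 1) t) :
    SatisfiesContinuityEq A B ρ u := by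
  intro f hf hfc
  obtain ⟨K, hK0, hK⟩ := exists_fderiv_bound hf hfc
  have hv := continuousOn_velocity hA hB hu
  set G : ℝ → EuclideanSpace ℝ (Fin n) → ℝ := fun t x =>
    fderiv ℝ (Function.uncurry f) (t, x) (1, velocity A B u (t, x)) with hG
  have hGc : ContinuousOn (Function.uncurry G) (Icc 0 1 ×ˢ univ) :=
    (hf.continuous_fderiv (by simp)).continuousOn.clm_apply (continuousOn_const.prodMk hv)
  have hGb : ∀ t ∈ Icc (0 : ℝ) 1, ∀ x, ‖G t x‖ ≤ K + C * (K + K * 1) := fun t ht x =>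
    abs_fderiv_one_apply_le (hK t x).1 (hK t x).2 hC zero_le_one (hgrowth (t, x) ht)
  have hHc : ContinuousOn (Function.uncurry fun t x => G t (T t x)) (Icc 0 1 ×ˢ univ) :=
    hGc.comp (f := fun z : ℝ × EuclideanSpace ℝ (Fin n) => (z.1, T z.1 z.2))
      (continuousOn_fst.prodMk h.continuousOn) fun z hz => ⟨hz.1, mem_univ _⟩
  have hpath : ∀ x, ∫ t in (0 : ℝ)..1, G t (T t x) = f 1 (T 1 x) - f 0 (T 0 x) := fun x => by
    refine intervalIntegral.integral_eq_sub_of_hasDerivAt_of_le (f := fun t => f t (T t x))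
      zero_le_one ?_ (fun t ht => ?_) ?_
    · exact hf.continuous.comp_continuousOn
        (continuousOn_id.prodMk fun t ht => (hT x t ht).continuousWithinAt)
    · have hd := (hT x t (Ioo_subset_Icc_self ht)).hasDerivAt (Icc_mem_nhds ht.1 ht.2)
      exact HasFDerivAt.comp_hasDerivAt (f := fun s => (s, T s x)) t
        (hf.differentiable (by simp) (t, T t x)).hasFDerivAt ((hasDerivAt_id t).prodMk hd)
    · refine ContinuousOn.intervalIntegrable ?_
      rw [uIcc_of_le zero_le_one]
      exact hHc.comp (f := fun t => (t, x)) (by fun_prop) fun t ht => ⟨ht, mem_univ _⟩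
  have hint : Integrable (Function.uncurry fun t x => G t (T t x))
      ((volume.restrict (uIoc (0 : ℝ) 1)).prod γ) := by
    have hle : (volume.restrict (uIoc (0 : ℝ) 1)).prod γ
        = (volume.prod γ).restrict (uIoc (0 : ℝ) 1 ×ˢ univ) := by
      rw [← Measure.prod_restrict, Measure.restrict_univ]
    have hms : MeasurableSet (uIoc (0 : ℝ) 1 ×ˢ (univ : Set (EuclideanSpace ℝ (Fin n)))) :=
      measurableSet_uIoc.prod MeasurableSet.univ
    have hsub : uIoc (0 : ℝ) 1 ⊆ Icc 0 1 := by
      rw [uIoc_of_le zero_le_one]; exact Ioc_subset_Icc_self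
    have hfin : IsFiniteMeasure (volume.restrict (uIoc (0 : ℝ) 1)) := by
      rw [uIoc_of_le zero_le_one]; infer_instance
    refine (integrable_const (K + C * (K + K * 1))).mono' ?_ ?_
    · rw [hle]
      exact (hHc.mono (prod_mono_left hsub)).aestronglyMeasurable hms
    · rw [hle]
      filter_upwards [ae_restrict_mem hms] with z hz
      exact hGb _ (hsub hz.1) _
  have hends : ∀ t, t ∈ Icc (0 : ℝ) 1 → Integrable (fun x => f t (T t x)) γ := fun t ht => by
    obtain ⟨L, hL⟩ := hfc.exists_bound_of_continuous hf.continuous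
    exact (integrable_const L).mono' ((hf.continuous.comp
      (continuous_const.prodMk (h.continuous ht))).aestronglyMeasurable)
      (.of_forall fun x => hL (t, T t x))
  have h0 := left_mem_Icc.2 (zero_le_one (α := ℝ))
  have h1 := right_mem_Icc.2 (zero_le_one (α := ℝ))
  have hfc' : ∀ t, Continuous (f t) := fun t =>
    hf.continuous.comp (continuous_const.prodMk continuous_id)
  rw [h.integral_mul h1 (hfc' 1), h.integral_mul h0 (hfc' 0),
    ← integral_sub (hends 1 h1) (hends 0 h0)]
  simp_rw [← hpath]
  rw [← intervalIntegral_integral_swap hint]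
  refine intervalIntegral.integral_congr fun t ht => ?_
  rw [uIcc_of_le zero_le_one] at ht
  rw [← h.integral_mul ht (continuous_of_continuousOn_uncurry hGc ht)]
  exact integral_congr_ae (.of_forall fun x => by
    simp only [hG, ← deriv_add_fderiv_eq hf, velocity])

theorem IsTransportedBy.cost_ne_top (h : IsTransportedBy ρ γ T)
    (hγ : Integrable (fun x => 1 + ‖x‖ ^ 2) γ)
    (hu : ContinuousOn (Function.uncurry u) (Icc (0 : ℝ) 1 ×ˢ univ)) {C : ℝ}
    (hC : ∀ t ∈ Icc (0 : ℝ) 1, ∀ x, ‖u t (T t x)‖ ≤ C * (‖x‖ + 1)) : cost ρ u ≠ ⊤ := by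
  have hbound : ∀ t ∈ Icc (0 : ℝ) 1, ∫⁻ x, ENNReal.ofReal (1 / 2 * ‖u t x‖ ^ 2 * ρ t x)
      ≤ ∫⁻ x, ENNReal.ofReal (C ^ 2 * (1 + ‖x‖ ^ 2)) ∂γ := fun t ht => by
    have hc := continuous_of_continuousOn_uncurry hu ht
    rw [h.lintegral_mul (f := fun x => 1 / 2 * ‖u t x‖ ^ 2) ht (by fun_prop) fun x => by positivity]
    refine lintegral_mono fun x => ENNReal.ofReal_le_ofReal ?_
    have h1 := pow_le_pow_left₀ (norm_nonneg _) (hC t ht x) 2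
    nlinarith [mul_nonneg (sq_nonneg C) (sq_nonneg (‖x‖ - 1))]
  have hfin : ∫⁻ x, ENNReal.ofReal (C ^ 2 * (1 + ‖x‖ ^ 2)) ∂γ < ⊤ :=
    (hasFiniteIntegral_iff_ofReal (.of_forall fun x => by positivity)).1 (hγ.const_mul (C ^ 2)).2
  refine ((setLIntegral_mono' measurableSet_Icc hbound).trans_lt ?_).ne
  simpa using hfin

end Transport

end OMTwpd

end

noncomputable section

namespace OMTwpd

variable {n p : ℕ}

/-! ### The closed-loop process, its density and its optimality. -/

section GaussianBridge

variable {A P Z V : ℝ → Matrix (Fin n) (Fin n) ℝ} {B : ℝ → Matrix (Fin n) (Fin p) ℝ}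
  {m₀ m₁ : EuclideanSpace ℝ (Fin n)} {S₀ S₁ : Matrix (Fin n) (Fin n) ℝ}

theorem velocity_feedback (z : ℝ × EuclideanSpace ℝ (Fin n)) :
    velocity A B (feedback A B P m₀ m₁) z = (closedLoop A B P z.1).toEuclideanLin z.2 +
      (B z.1 * (B z.1)ᵀ).toEuclideanLin (drift A B P m₀ m₁ z.1) := by
  rw [velocity, feedback, closedLoop, map_add, map_neg, ← toEuclideanLin_mul_apply,
    ← toEuclideanLin_mul_apply, map_sub, LinearMap.sub_apply, Matrix.mul_assoc]
  abel

theorem continuousOn_drift (hZ : IsFundamentalPair (closedLoop A B P) Z V) :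
    ContinuousOn (drift A B P m₀ m₁) (Icc 0 1) := fun t ht =>
  (hasDerivWithinAt_drift hZ m₀ m₁ t ht).continuousWithinAt

theorem continuousOn_feedback (hB : ContinuousOn B (Icc 0 1)) (hP : ContinuousOn P (Icc 0 1))
    (hZ : IsFundamentalPair (closedLoop A B P) Z V) :
    ContinuousOn (Function.uncurry (feedback A B P m₀ m₁)) (Icc (0 : ℝ) 1 ×ˢ univ) := by
  have hBt := continuousOn_matrix_transpose hB
  exact (continuousOn_toEuclideanLin_apply (continuousOn_entries_fst
    (continuousOn_matrix_mul hBt hP)) continuousOn_snd).neg.add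
    (continuousOn_toEuclideanLin_apply (continuousOn_entries_fst hBt)
      ((continuousOn_drift hZ).comp continuousOn_fst fun z hz => hz.1))

theorem exists_norm_feedback_le (hB : ContinuousOn B (Icc 0 1)) (hP : ContinuousOn P (Icc 0 1))
    (hZ : IsFundamentalPair (closedLoop A B P) Z V) (m₀ m₁ : EuclideanSpace ℝ (Fin n)) :
    ∃ C, 0 ≤ C ∧ ∀ t ∈ Icc (0 : ℝ) 1, ∀ x, ‖feedback A B P m₀ m₁ t x‖ ≤ C * (‖x‖ + 1) := by
  have hBt := continuousOn_matrix_transpose hB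
  obtain ⟨K, hK0, hK⟩ := exists_norm_toEuclideanLin_le (continuousOn_matrix_mul hBt hP)
  obtain ⟨L, hL0, hL⟩ := exists_norm_toEuclideanLin_le hBt
  obtain ⟨D, hD⟩ := isCompact_Icc.exists_bound_of_continuousOn
    (continuousOn_drift (m₀ := m₀) (m₁ := m₁) hZ)
  have hD0 : 0 ≤ D := (norm_nonneg _).trans (hD 0 (left_mem_Icc.2 zero_le_one))
  refine ⟨K + L * D, by positivity, fun t ht x => (norm_add_le _ _).trans ?_⟩
  rw [norm_neg]
  have h1 := hK t ht x
  have h2 := (hL t ht (drift A B P m₀ m₁ t)).trans (mul_le_mul_of_nonneg_left (hD t ht) hL0)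
  nlinarith [mul_nonneg (mul_nonneg hL0 hD0) (norm_nonneg x)]

theorem continuousOn_affineFlow (hZ : IsFundamentalPair (closedLoop A B P) Z V)
    {b : ℝ → EuclideanSpace ℝ (Fin n)} (hb : ContinuousOn b (Icc 0 1)) :
    ContinuousOn (Function.uncurry fun t x => (Z t).toEuclideanLin x + b t)
      (Icc (0 : ℝ) 1 ×ˢ univ) :=
  (continuousOn_toEuclideanLin_apply (continuousOn_entries_fst hZ.continuousOn)
    continuousOn_snd).add (hb.comp continuousOn_fst fun _ hz => hz.1)

theorem isProcess_affineFlow (hZ : IsFundamentalPair (closedLoop A B P) Z V)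
    {b : ℝ → EuclideanSpace ℝ (Fin n)} (hb0 : b 0 = 0)
    (hb : ∀ t ∈ Icc (0 : ℝ) 1, HasDerivWithinAt b ((closedLoop A B P t).toEuclideanLin (b t) +
      (B t * (B t)ᵀ).toEuclideanLin (drift A B P m₀ m₁ t)) (Icc 0 1) t) :
    IsProcess (gaussianMeasure m₀ S₀) A B P m₀ m₁ S₀ fun t x => (Z t).toEuclideanLin x + b t where
  aemeasurable t _ := (continuous_affine (Z t) (b t)).measurable.aemeasurable
  initial := by
    simp only [hZ.zero, hb0, add_zero, toLpLin_one, LinearMap.id_apply]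
    exact Measure.map_id
  dynamics := .of_forall fun x => hasDerivWithinAt_affineFlow hZ hb x

variable {Ω : Type*} [MeasurableSpace Ω] {μ : Measure Ω} {X : ℝ → Ω → EuclideanSpace ℝ (Fin n)}

/-- Almost every path is the affine flow applied to its own initial value, so the law at time `t` is
determined by the initial law. -/
theorem IsProcess.map_eq_map_affineFlow (hX : IsProcess μ A B P m₀ m₁ S₀ X)
    (hZ : IsFundamentalPair (closedLoop A B P) Z V)
    {b : ℝ → EuclideanSpace ℝ (Fin n)} (hb0 : b 0 = 0)
    (hb : ∀ t ∈ Icc (0 : ℝ) 1, HasDerivWithinAt b ((closedLoop A B P t).toEuclideanLin (b t) +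
      (B t * (B t)ᵀ).toEuclideanLin (drift A B P m₀ m₁ t)) (Icc 0 1) t)
    {t : ℝ} (ht : t ∈ Icc (0 : ℝ) 1) :
    μ.map (X t) = (gaussianMeasure m₀ S₀).map fun x => (Z t).toEuclideanLin x + b t := by
  have h0 := left_mem_Icc.2 (zero_le_one (α := ℝ))
  rw [gaussianMeasure, ← hX.initial, AEMeasurable.map_map_of_aemeasurable
    (continuous_affine (Z t) (b t)).measurable.aemeasurable (hX.aemeasurable 0 h0)]
  refine Measure.map_congr ?_
  filter_upwards [hX.dynamics] with z hz
  exact eq_affineFlow hZ hb0 hb hz t ht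

/-- The density of the image of a Gaussian under an affine flow, jointly measurable in time and
space. -/
theorem exists_density_affineFlow (hZ : IsFundamentalPair (closedLoop A B P) Z V)
    {b : ℝ → EuclideanSpace ℝ (Fin n)} (hb : ContinuousOn b (Icc 0 1))
    (m₀ : EuclideanSpace ℝ (Fin n)) (S₀ : Matrix (Fin n) (Fin n) ℝ) :
    ∃ ρ : ℝ → EuclideanSpace ℝ (Fin n) → ℝ, Measurable (Function.uncurry ρ) ∧
      (∀ t x, 0 ≤ ρ t x) ∧ ∀ t ∈ Icc (0 : ℝ) 1,
        ((gaussianMeasure m₀ S₀).map fun x => (Z t).toEuclideanLin x + b t)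
          = volume.withDensity fun x => ENNReal.ofReal (ρ t x) := by
  classical
  -- The change of variables formula for the inverse map `x ↦ V(t)(x - b(t))`.
  set r : ℝ × EuclideanSpace ℝ (Fin n) → ℝ := fun z =>
    |(V z.1).det| * gaussianDensity m₀ S₀ ((V z.1).toEuclideanLin (z.2 - b z.1)) with hr
  set s : Set (ℝ × EuclideanSpace ℝ (Fin n)) := Icc (0 : ℝ) 1 ×ˢ univ with hs
  have hrc : ContinuousOn r s := by
    have hVe := continuousOn_entries_fst (Y := EuclideanSpace ℝ (Fin n)) hZ.continuousOn_inv
    have hdet : ContinuousOn (fun z : ℝ × EuclideanSpace ℝ (Fin n) => (V z.1).det) s := by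
      simp only [det_apply]
      exact continuousOn_finsetSum _ fun σ _ =>
        (continuousOn_finsetProd _ fun i _ => hVe _ _).const_smul _
    exact hdet.abs.mul ((continuous_gaussianDensity m₀ S₀).comp_continuousOn
      (continuousOn_toEuclideanLin_apply hVe (continuousOn_snd.sub
        (hb.comp continuousOn_fst fun z hz => hz.1))))
  -- `V` and `b` are controlled on `[0,1]` only; extending by `0` makes the density measurable
  -- everywhere.
  refine ⟨fun t x => s.piecewise r 0 (t, x), ?_, fun t x => ?_, fun t ht => ?_⟩
  · exact hrc.measurable_piecewise continuousOn_const (measurableSet_Icc.prod MeasurableSet.univ)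
  · by_cases h : (t, x) ∈ s
    · simp only [piecewise_eq_of_mem _ _ _ h, hr]
      exact mul_nonneg (abs_nonneg _) (gaussianDensity_nonneg _ _ _)
    · simp only [piecewise_eq_of_notMem _ _ _ h, Pi.zero_apply, le_refl]
  · rw [map_gaussianMeasure_affine m₀ (b t) (hZ.isUnit_det ht), gaussianMeasure]
    congr 1 with x
    beta_reduce
    rw [piecewise_eq_of_mem _ _ _ (show (t, x) ∈ s from ⟨ht, mem_univ _⟩), hr]
    simp only
    rw [gaussianDensity_affine m₀ (b t) (hZ.isUnit_det ht) ((V t).toEuclideanLin (x - b t)),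
      ← mul_assoc, ← abs_mul, ← det_mul, hZ.inv_mul t ht, det_one, abs_one, one_mul,
      ← toEuclideanLin_mul_apply, hZ.mul_inv t ht, toLpLin_one, LinearMap.id_apply,
      sub_add_cancel]

/-- A density flow carried by the closed-loop dynamics from `N(m₀, Σ₀)` to `N(m₁, Σ₁)` solves the
transport problem together with the feedback law. -/
theorem isSolution_of_isTransportedBy {T : ℝ → EuclideanSpace ℝ (Fin n) → EuclideanSpace ℝ (Fin n)}
    {ρ : ℝ → EuclideanSpace ℝ (Fin n) → ℝ}
    (hA : ContinuousOn A (Icc 0 1)) (hB : ContinuousOn B (Icc 0 1))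
    (hS₀ : S₀.PosDef) (hS₁ : S₁.PosDef)
    (hP : ∀ t ∈ Icc (0 : ℝ) 1, HasDerivWithinAt P
      (-((A t)ᵀ * P t) - P t * A t + P t * B t * (B t)ᵀ * P t) (Icc 0 1) t)
    (hPt : ∀ t ∈ Icc (0 : ℝ) 1, (P t)ᵀ = P t)
    (hZ : IsFundamentalPair (closedLoop A B P) Z V)
    (hprob : IsProbabilityMeasure (gaussianMeasure m₀ S₀))
    (hρ : IsTransportedBy ρ (gaussianMeasure m₀ S₀) T)
    (hTd : ∀ x, ∀ t ∈ Icc (0 : ℝ) 1, HasDerivWithinAt (fun s => T s x)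
      ((closedLoop A B P t).toEuclideanLin (T t x) +
        (B t * (B t)ᵀ).toEuclideanLin (drift A B P m₀ m₁ t)) (Icc 0 1) t)
    {C : ℝ} (hC : ∀ t ∈ Icc (0 : ℝ) 1, ∀ x, ‖T t x‖ ≤ C * (‖x‖ + 1))
    (hT0 : (gaussianMeasure m₀ S₀).map (T 0) = gaussianMeasure m₀ S₀)
    (hT1 : (gaussianMeasure m₀ S₀).map (T 1) = gaussianMeasure m₁ S₁) :
    IsSolution A B (gaussianDensity m₀ S₀) (gaussianDensity m₁ S₁) ρ (feedback A B P m₀ m₁) := by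
  have h0 := left_mem_Icc.2 (zero_le_one (α := ℝ))
  have h1 := right_mem_Icc.2 (zero_le_one (α := ℝ))
  have hPc := continuousOn_of_hasDerivWithinAt hP
  have hm : ∀ (m : EuclideanSpace ℝ (Fin n)) (S : Matrix (Fin n) (Fin n) ℝ),
      Measurable (gaussianDensity m S) := fun m S => (continuous_gaussianDensity m S).measurable
  have hγ₀ := integrable_norm_sq_gaussianMeasure m₀ hS₀
  have hγ₁ := integrable_norm_sq_gaussianMeasure m₁ hS₁
  have hu := continuousOn_feedback (m₀ := m₀) (m₁ := m₁) hB hPc hZ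
  obtain ⟨K, hK0, hK⟩ := exists_norm_feedback_le hB hPc hZ m₀ m₁
  obtain ⟨L, hL0, hL⟩ := exists_norm_velocity_le (p := p) hA hB
  have hadm : IsAdmissible A B (gaussianDensity m₀ S₀) (gaussianDensity m₁ S₁) ρ
      (feedback A B P m₀ m₁) := by
    refine ⟨hρ.isDensityFlow, hu, ?_, hρ.ae_eq h0 (hm _ _) (gaussianDensity_nonneg _ _) hT0,
      hρ.ae_eq h1 (hm _ _) (gaussianDensity_nonneg _ _) hT1⟩
    refine hρ.satisfiesContinuityEq hA hB hu (C := L * (1 + K)) (by positivity) (fun z hz => ?_)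
      fun x t ht => ?_
    · refine (hL _ z hz).trans ?_
      rw [mul_assoc]
      refine mul_le_mul_of_nonneg_left ?_ hL0
      linarith [hK z.1 hz z.2]
    · rw [velocity_feedback]
      exact hTd x t ht
  have hfin : cost ρ (feedback A B P m₀ m₁) ≠ ⊤ := by
    refine hρ.cost_ne_top hγ₀ hu (C := K * (C + 1)) fun t ht x => (hK t ht _).trans ?_
    rw [mul_assoc]
    refine mul_le_mul_of_nonneg_left ?_ hK0
    nlinarith [hC t ht x, norm_nonneg x]
  refine ⟨hadm, hfin, fun ρ' u' h' => ?_⟩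
  -- Only a competitor of finite cost is a weak flow with square integrable weight; infinite cost is
  -- trivial.
  by_cases hfin' : cost ρ' u' = ⊤
  · rw [hfin']
    exact le_top
  obtain ⟨D, hD⟩ := exists_integral_inner_feedback_eq hA hB hPt hP
    (fun i t ht => by
      have h := hasDerivWithinAt_euclidean_iff.1 (hasDerivWithinAt_drift hZ m₀ m₁ t ht) i
      simpa only [toLpLin_apply, neg_mulVec] using h)
    hγ₀ hγ₁
  have hflow : ∀ ρ u, IsAdmissible A B (gaussianDensity m₀ S₀) (gaussianDensity m₁ S₁) ρ u →
      cost ρ u ≠ ⊤ → ∃ C, IsWeakFlow (velocity A B u) (fun z => ‖u z.1 z.2‖) C (flowMeasure ρ)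
        (gaussianMeasure m₀ S₀) (gaussianMeasure m₁ S₁) := fun ρ u h hc =>
    isWeakFlow_of_isAdmissible hA hB h hc (hm _ _) (gaussianDensity_nonneg _ _) (hm _ _)
      (gaussianDensity_nonneg _ _) (isFiniteMeasure_of_integrable_one_add hγ₀)
      (isFiniteMeasure_of_integrable_one_add hγ₁)
  have hcost : ∀ ρ u, IsAdmissible A B (gaussianDensity m₀ S₀) (gaussianDensity m₁ S₁) ρ u →
      cost ρ u ≠ ⊤ → Integrable (fun z => 1 / 2 * ‖u z.1 z.2‖ ^ 2) (flowMeasure ρ) ∧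
        cost ρ u = ENNReal.ofReal (∫ z, 1 / 2 * ‖u z.1 z.2‖ ^ 2 ∂flowMeasure ρ) :=
      fun ρ u h hc => by
    obtain ⟨_, hw⟩ := hflow ρ u h hc
    have hi : Integrable (fun z => 1 / 2 * ‖u z.1 z.2‖ ^ 2) (flowMeasure ρ) :=
      hw.memLp.integrable_sq.const_mul _
    exact ⟨hi, by rw [cost_eq_lintegral h.flow h.continuous_control,
      ofReal_integral_eq_lintegral_ofReal hi (.of_forall fun z => by positivity)]⟩
  obtain ⟨_, hw⟩ := hflow _ _ hadm hfin
  obtain ⟨_, hw'⟩ := hflow _ _ h' hfin'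
  -- For `u = u⁎` the invariant integrand is `‖u⁎‖²/2`, so the cost of the feedback is `D` itself.
  have hopt := (hD _ _ _ _ _ hw fun _ => rfl).2
  obtain ⟨hint', hval'⟩ := hD _ _ _ _ _ hw' fun _ => rfl
  rw [(hcost _ _ hadm hfin).2, (hcost _ _ h' hfin').2]
  refine ENNReal.ofReal_le_ofReal ?_
  calc ∫ z, 1 / 2 * ‖feedback A B P m₀ m₁ z.1 z.2‖ ^ 2 ∂flowMeasure ρ = D := by
        rw [← hopt]
        refine integral_congr_ae (.of_forall fun z => ?_)
        show 1 / 2 * ‖feedback A B P m₀ m₁ z.1 z.2‖ ^ 2 =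
          inner ℝ (feedback A B P m₀ m₁ z.1 z.2) (feedback A B P m₀ m₁ z.1 z.2)
            - 1 / 2 * ‖feedback A B P m₀ m₁ z.1 z.2‖ ^ 2
        rw [real_inner_self_eq_norm_sq]
        ring
    _ ≤ ∫ z, 1 / 2 * ‖u' z.1 z.2‖ ^ 2 ∂flowMeasure ρ' := by
        rw [← hval']
        refine integral_mono hint' (hcost _ _ h' hfin').1 fun z => ?_
        show inner ℝ (feedback A B P m₀ m₁ z.1 z.2) (u' z.1 z.2)
            - 1 / 2 * ‖feedback A B P m₀ m₁ z.1 z.2‖ ^ 2 ≤ 1 / 2 * ‖u' z.1 z.2‖ ^ 2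
        -- Cauchy–Schwarz and Young: `⟨u⁎,u'⟩ ≤ ‖u⁎‖²/2 + ‖u'‖²/2`.
        have h := real_inner_le_norm (feedback A B P m₀ m₁ z.1 z.2) (u' z.1 z.2)
        nlinarith [sq_nonneg (‖feedback A B P m₀ m₁ z.1 z.2‖ - ‖u' z.1 z.2‖)]

theorem exists_norm_affineFlow_le (hZ : IsFundamentalPair (closedLoop A B P) Z V)
    {b : ℝ → EuclideanSpace ℝ (Fin n)} (hb : ContinuousOn b (Icc 0 1)) :
    ∃ C, ∀ t ∈ Icc (0 : ℝ) 1, ∀ x, ‖(Z t).toEuclideanLin x + b t‖ ≤ C * (‖x‖ + 1) := by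
  obtain ⟨K, hK0, hK⟩ := exists_norm_toEuclideanLin_le hZ.continuousOn
  obtain ⟨D, hD⟩ := isCompact_Icc.exists_bound_of_continuousOn hb
  have hD0 : 0 ≤ D := (norm_nonneg _).trans (hD 0 (left_mem_Icc.2 zero_le_one))
  refine ⟨K + D, fun t ht x => (norm_add_le _ _).trans ?_⟩
  nlinarith [hK t ht x, hD t ht, mul_nonneg hD0 (norm_nonneg x)]

end GaussianBridge

end OMTwpd

end

/-! ### The main theorem. -/

theorem proposition4 {n p : ℕ}
    (A : ℝ → Matrix (Fin n) (Fin n) ℝ) (B : ℝ → Matrix (Fin n) (Fin p) ℝ)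
    (hA : ContinuousOn A (Icc 0 1)) (hB : ContinuousOn B (Icc 0 1))
    (hAB : OMTwpd.IsControllable A B)
    (m₀ m₁ : EuclideanSpace ℝ (Fin n)) (S₀ S₁ : Matrix (Fin n) (Fin n) ℝ)
    (hS₀ : S₀.PosDef) (hS₁ : S₁.PosDef) :
    -- the Gramian is invertible and the Riccati equation has a solution on the whole of `[0,1]`
    IsUnit (OMTwpd.gramian A B 1 0).det ∧
    (∃ P, OMTwpd.IsRiccatiSolution A B S₀ S₁ P) ∧
    ∀ P : ℝ → Matrix (Fin n) (Fin n) ℝ, OMTwpd.IsRiccatiSolution A B S₀ S₁ P →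
      -- the closed form of the solution, wherever the inverse of `M(t,0)` makes sense
      (∀ t ∈ Ioc (0 : ℝ) 1, IsUnit (OMTwpd.gramian A B t 0).det →
        IsUnit (OMTwpd.riccatiBracket A B S₀ S₁ t).det ∧
        P t = OMTwpd.riccatiClosedForm A B S₀ S₁ t) ∧
      -- the drift is well defined
      IsUnit (OMTwpd.gramian (OMTwpd.closedLoop A B P) B 1 0).det ∧
      -- there is a process, here on the probability space `ℝⁿ` with the initial distribution
      (∃ X : ℝ → EuclideanSpace ℝ (Fin n) → EuclideanSpace ℝ (Fin n),
        OMTwpd.IsProcess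
          (volume.withDensity fun x => ENNReal.ofReal (OMTwpd.gaussianDensity m₀ S₀ x))
          A B P m₀ m₁ S₀ X) ∧
      -- every such process has a density, and the density and the feedback solve the problem
      ∀ (Ω : Type*) [MeasurableSpace Ω] (μ : Measure Ω) [IsProbabilityMeasure μ]
        (X : ℝ → Ω → EuclideanSpace ℝ (Fin n)), OMTwpd.IsProcess μ A B P m₀ m₁ S₀ X →
        (∃ ρ, OMTwpd.IsDensityOf μ X ρ) ∧
        ∀ ρ, OMTwpd.IsDensityOf μ X ρ →
          OMTwpd.IsSolution A B (OMTwpd.gaussianDensity m₀ S₀) (OMTwpd.gaussianDensity m₁ S₁)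
            ρ (OMTwpd.feedback A B P m₀ m₁) := by
  have h0 := left_mem_Icc.2 (zero_le_one (α := ℝ))
  have h1 := right_mem_Icc.2 (zero_le_one (α := ℝ))
  obtain ⟨Φ, Ψ, hΦ⟩ := OMTwpd.exists_isFundamentalPair hA
  refine ⟨OMTwpd.isUnit_det_gramian hΦ hB hAB,
    OMTwpd.exists_isRiccatiSolution hΦ hB hAB hS₀ hS₁, fun P hP => ?_⟩
  have hPc := hP.continuousOn
  obtain ⟨Z, V, hZ⟩ :=
    OMTwpd.exists_isFundamentalPair (OMTwpd.continuousOn_closedLoop hA hB hPc)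
  have hM := OMTwpd.isUnit_det_gramian hZ hB (OMTwpd.isControllable_closedLoop hB hPc hAB)
  obtain ⟨b, hb0, hb1, hb⟩ := OMTwpd.exists_inhomogeneous_solution hZ hB hM m₀ m₁
  have hbc : ContinuousOn b (Icc 0 1) := fun t ht => (hb t ht).continuousWithinAt
  refine ⟨fun t ht => hP.eq_closedForm hΦ hA hB hS₀ (Ioc_subset_Icc_self ht), hM,
    ⟨_, OMTwpd.isProcess_affineFlow hZ hb0 hb⟩, fun Ω _ μ _ X hX => ?_⟩
  have hmap : ∀ t ∈ Icc (0 : ℝ) 1, μ.map (X t) =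
      (OMTwpd.gaussianMeasure m₀ S₀).map fun x => (Z t).toEuclideanLin x + b t := fun t ht =>
    hX.map_eq_map_affineFlow hZ hb0 hb ht
  refine ⟨?_, fun ρ hρ => ?_⟩
  · obtain ⟨ρ, hm, hnn, hρ⟩ := OMTwpd.exists_density_affineFlow hZ hbc m₀ S₀
    exact ⟨ρ, hm, fun t _ => hnn t, fun t ht => (hmap t ht).trans (hρ t ht)⟩
  -- The total mass of the Gaussian is read off from the law of `X 0`, without computing its
  -- integral.
  have hprob : IsProbabilityMeasure (OMTwpd.gaussianMeasure m₀ S₀) := by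
    rw [OMTwpd.gaussianMeasure, ← hX.initial]
    exact Measure.isProbabilityMeasure_map (hX.aemeasurable 0 h0)
  obtain ⟨C, hC⟩ := OMTwpd.exists_norm_affineFlow_le hZ hbc
  refine OMTwpd.isSolution_of_isTransportedBy hA hB hS₀ hS₁ hP.2
    (hP.transpose_eq hΦ hA hB hAB hS₀ hS₁) hZ hprob
    ⟨hρ.measurable, hρ.nonneg, fun t ht => (hmap t ht).symm.trans (hρ.map_eq t ht),
      OMTwpd.continuousOn_affineFlow hZ hbc⟩
    (OMTwpd.hasDerivWithinAt_affineFlow hZ hb) hC ?_ ?_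
  · rw [← hmap 0 h0, hX.initial, OMTwpd.gaussianMeasure]
  -- The mean arrives at `m₁` by the choice of drift, the covariance at `Σ₁` by the choice of
  -- `Π(0)`.
  · rw [OMTwpd.map_gaussianMeasure_affine m₀ (b 1) (hZ.isUnit_det h1), hb1,
      hP.conj_closedLoop_fundamental hΦ hB hAB hS₀ hS₁ hZ]
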